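/- **The FIFO stack-up problem.** Let $k$ be a fixed natural number. An instance consists of a list $Q=(q_1,\dots,q_k)$ of $k$ finite sequences of pairwise distinct bins, a pallet symbol ${\it plt}(b)\in\{1,2,\dots\}$ for every bin $b$, and a positive integer $p$ (the number of stack-up places); the sequences together contain at least two bins for each pallet that occurs. A configuration is a pair $(Q,Q')$ where $Q'=(q'_1,\dots,q'_k)$ and each $q'_i$ is a terminal segment of $q_i$. A pallet is open in $(Q,Q')$ if one of its bins is in some $q'_i$ and another one has already been removed, i.e. lies in $q_j$ before the segment $q'_j$ for some $j$. A transformation step removes the first bin of one of the sequences of $Q'$. A processing of $Q$ with at most $p$ stack-up places is a sequence of transformation steps from $Q$ to $k$ empty sequences such that in each of its configurations at most $p$ pallets are open. The question is whether there is such a processing. Instances are written as words over a four-letter alphabet: $p$ in binary, then for each sequence a semicolon followed by its bins, each of which is written as a comma followed by its pallet symbol in binary. **Theorem.** For every fixed $k$ the following holds. 1. The FIFO stack-up problem with $k$ sequences is in $\mathrm{NL}$: there is a nondeterministic Turing machine with a two-way read-only input tape and finitely many work tapes such that a word $w$ has an accepting computation if and only if $w$ describes an instance that has a processing with at most $p$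 stack-up places, and all computations on all inputs of length $\ell$ use $O(\log \ell)$ work tape cells. 2. For every instance with $k$ sequences and $n$ bins in total, the following nondeterministic procedure with the $k+1$ counters ${\it pos}_1,\dots,{\it pos}_k,{\it open}$, all initially $0$, decides whether there is a processing with at most $p$ stack-up places, i.e. there is one if and only if some run of the procedure reaches ${\it pos}_i=|q_i|$ for all $i$. In each step, choose an index $i$ with ${\it pos}_i<|q_i|$, increment ${\it pos}_i$, and let $t$ be the pallet of the bin at position ${\it pos}_i$ of $q_i$; if no bin for $t$ had been removed before (that is, was among the first ${\it pos}_j$ bins of some $q_j$, with the values before the step), increment ${\it open}$; if now ${\it open}>p$, stop without accepting; if no bin for $t$ remains, decrement ${\it open}$. Moreover, after every step of every run, ${\it pos}_i\le |q_i|$ for all $i$, ${\it open}$ is the number of pallets that are open when the first ${\it pos}_j$ bins of $q_j$ have been removed for each $j$, and every counter has at most $\lfloor\log_2 n\rfloor+1$ bits (at most $1$ bit if $n=0$). -/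

import Mathlib

/-! ### Nondeterministic Turing machines with a read-only input tape -/

namespace OffLine

/-- A head movement. -/
inductive Move
  | left
  | stay
  | right

/-- The new position of a head on a one-way infinite tape; a left move from cell `0` has no
effect. -/
def Move.shift : Move → ℕ → ℕ
  | .left, n => n - 1
  | .stay, n => n
  | .right, n => n + 1

/-- The possible contents of a cell of the input tape: the two end markers and the letters of the
input alphabet. -/
inductive Cell (α : Type)
  | leftEnd
  | letter (a : α)
  | rightEnd

/-- The input tape for the word `x`: the left end marker in cell `0`, the letters of `x` in the
cells `1, …, |x|`, and the right end marker in cell `|x| + 1`. -/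
def inputCell {α : Type} (x : List α) : ℕ → Cell α
  | 0 => .leftEnd
  | h + 1 => match x[h]? with
    | some a => .letter a
    | none => .rightEnd

/-- A nondeterministic Turing machine with a two-way read-only input tape and `tapes` many
one-way infinite read-write work tapes. `trans q a g q' m g' m'` says that in state `q`, reading
`a` on the input tape and `g` on the work tapes, the machine may go to state `q'`, move the input
head by `m`, write `g'` on the work tapes and move the work heads by `m'`. -/
structure NTM (α : Type) where
  State : Type
  finite_state : Finite State
  Work : Type
  finite_work : Finite Work
  tapes : ℕ
  blank : Work
  start : State
  accepting : Set State
  trans : State → Cell α → (Fin tapes → Work) →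
    State → Move → (Fin tapes → Work) → (Fin tapes → Move) → Prop

namespace NTM

variable {α : Type} (M : NTM α)

/-- A configuration: control state, position of the input head, contents of the work tapes, and
positions of the work heads. -/
structure Config where
  state : M.State
  inputHead : ℕ
  content : Fin M.tapes → ℕ → M.Work
  workHead : Fin M.tapes → ℕ

/-- The initial configuration: all work tapes are blank and all heads are on cell `0`. -/
def init : M.Config where
  state := M.start
  inputHead := 0
  content := fun _ _ => M.blank
  workHead := fun _ => 0

/-- One computation step on the input `x`. The input head stays within the cells
`0, …, |x| + 1`. -/
def Step (x : List α) (c c' : M.Config) : Prop :=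
  ∃ (m : Move) (g : Fin M.tapes → M.Work) (d : Fin M.tapes → Move),
    M.trans c.state (inputCell x c.inputHead) (fun i => c.content i (c.workHead i))
      c'.state m g d ∧
    c'.inputHead = min (m.shift c.inputHead) (x.length + 1) ∧
    (∀ i, c'.content i = Function.update (c.content i) (c.workHead i) (g i)) ∧
    (∀ i, c'.workHead i = (d i).shift (c.workHead i))

/-- The configurations that some computation on the input `x` reaches. -/
def Reaches (x : List α) (c : M.Config) : Prop :=
  Relation.ReflTransGen (M.Step x) M.init c

/-- Some computation on `x` reaches an accepting state. -/
def Accepts (x : List α) : Prop :=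
  ∃ c, M.Reaches x c ∧ c.state ∈ M.accepting

/-- No computation on `x` visits a work cell outside the first `s` cells of each work tape. -/
def UsesSpaceAtMost (x : List α) (s : ℕ) : Prop :=
  ∀ c, M.Reaches x c → ∀ i, c.workHead i < s

end NTM

/-- The class `NL` over the finite alphabet `α`: the languages that are decided by a
nondeterministic Turing machine all of whose computations on inputs of length `n` use `O(log n)`
cells of the work tapes. -/
def NL (α : Type) [Finite α] : Set (Language α) :=
  {L | ∃ M : NTM α, (∀ x, x ∈ L ↔ M.Accepts x) ∧
    ∃ C : ℕ, ∀ x, M.UsesSpaceAtMost x (C * (Nat.log 2 x.length + 1))}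

end OffLine

/-! ### The FIFO stack-up problem -/

namespace StackUp

/-- A list of `k` sequences of bins. A bin is an entry of one of the sequences (so bins are pairwise
distinct), and a sequence is given by the pallet symbols of its bins. -/
abbrev Sequences (k : ℕ) := Fin k → List ℕ+

/-- The set of pallets of all bins in the sequences. -/
def plts {k : ℕ} (Q : Sequences k) : Finset ℕ+ :=
  Finset.univ.biUnion fun i => (Q i).toFinset

/-- The total number of bins. -/
def numBins {k : ℕ} (Q : Sequences k) : ℕ :=
  ∑ i, (Q i).length

/-- The bins `q_i - q'_i` that have been removed from the front of each sequence `q_i` of `Q`, when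
the terminal segments `q'_i` in `Q'` remain. -/
def removed {k : ℕ} (Q Q' : Sequences k) : Sequences k :=
  fun i => (Q i).take ((Q i).length - (Q' i).length)

/-- The pallets that are open in the configuration `(Q, Q')`: a bin of the pallet remains and
another one has been removed. -/
def openPallets {k : ℕ} (Q Q' : Sequences k) : Finset ℕ+ :=
  plts Q' ∩ plts (removed Q Q')

/-- A transformation step: the first bin of one of the sequences is removed. -/
def TransformationStep {k : ℕ} (Q' Q'' : Sequences k) : Prop :=
  ∃ i, (∃ b, Q' i = b :: Q'' i) ∧ ∀ j, j ≠ i → Q'' j = Q' j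

/-- There is a processing of `Q` with at most `p` stack-up places: a sequence of transformation
steps from `Q` to `k` empty sequences such that in each configuration at most `p` pallets are
open. -/
def Processable {k : ℕ} (Q : Sequences k) (p : ℕ) : Prop :=
  ∃ (n : ℕ) (R : ℕ → Sequences k), R 0 = Q ∧ (∀ i, R n i = []) ∧
    (∀ s < n, TransformationStep (R s) (R (s + 1))) ∧
    ∀ s ≤ n, (openPallets Q (R s)).card ≤ p

/-- An instance with `k` sequences: the sequences, which together contain at least two bins for
each pallet, and the positive number of stack-up places. -/
structure FifoInstance (k : ℕ) where
  seqs : Sequences k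
  places : ℕ+
  two_bins : ∀ t ∈ plts seqs, 2 ≤ ∑ i, (seqs i).count t

/-- The alphabet in which instances are written. -/
inductive Letter
  | zero
  | one
  | comma
  | semicolon
  deriving DecidableEq

instance : Fintype Letter :=
  ⟨{.zero, .one, .comma, .semicolon}, fun x => by cases x <;> decide⟩

/-- The binary representation of a positive integer, least significant digit first, without
superfluous zeros. -/
def binary (n : ℕ+) : List Letter :=
  (Nat.bits n).map fun b => if b then .one else .zero

/-- The word that describes an instance: the number of places in binary, then for each sequence a
semicolon followed by its bins, where each bin is written as a comma followed by its pallet symbol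
in binary. -/
def FifoInstance.encode {k : ℕ} (I : FifoInstance k) : List Letter :=
  binary I.places ++ (List.ofFn I.seqs).flatMap fun q =>
    .semicolon :: q.flatMap fun t => .comma :: binary t

/-- The FIFO stack-up problem with `k` sequences, as a formal language. -/
def fifoStackUp (k : ℕ) : Language Letter :=
  {w | ∃ I : FifoInstance k, I.encode = w ∧ Processable I.seqs I.places}

/-! ### The nondeterministic procedure with `k + 1` counters -/

/-- The values of the counters: for each sequence the number of bins removed so far (that is, the
position of the bin removed last), and the number of open pallets. -/
structure Counters (k : ℕ) where
  pos : Fin k → ℕ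
  opn : ℕ

/-- All counters are zero. -/
def Counters.zero (k : ℕ) : Counters k := ⟨fun _ => 0, 0⟩

open Classical in
/-- The value of `opn` in the middle of a step that removes a bin for pallet `t`: it has been
incremented if no bin for `t` had been removed before. -/
noncomputable def Counters.opened {k : ℕ} (Q : Sequences k) (c : Counters k) (t : ℕ+) : ℕ :=
  if ∀ j, t ∉ (Q j).take (c.pos j) then c.opn + 1 else c.opn

open Classical in
/-- One step of the procedure: choose a sequence `i` with a remaining bin and increment `pos i`; let
`t` be the pallet of the removed bin; increment `opn` if this is the first bin removed for `t`; stop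
without accepting if now `opn > p`; decrement `opn` if no bin for `t` remains. -/
def Counters.Step {k : ℕ} (Q : Sequences k) (p : ℕ) (c c' : Counters k) : Prop :=
  ∃ (i : Fin k) (t : ℕ+), (Q i)[c.pos i]? = some t ∧
    c'.pos = Function.update c.pos i (c.pos i + 1) ∧
    c.opened Q t ≤ p ∧
    c'.opn = if ∀ j, t ∉ (Q j).drop (c'.pos j) then c.opened Q t - 1 else c.opened Q t

/-- The counter values that some run of the procedure reaches. -/
def Counters.Reachable {k : ℕ} (Q : Sequences k) (p : ℕ) (c : Counters k) : Prop :=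
  Relation.ReflTransGen (Counters.Step Q p) (Counters.zero k) c

end StackUp

/-!
Both parts rest on the observation that the procedure with the counters `pos` and `opn` is exact.

*The procedure.* In every reachable configuration `opn` is the number of open pallets
(`Counters.Correct.of_reachable`). The procedure compares `opn` with `p` in the middle of a step,
when the pallet `t` of the removed bin counts as open even if this was its last bin. This makes no
difference: if the bin is the first one removed for `t`, then another bin for `t` remains since
there are at least two, so `t` is open after the step; otherwise `t` was already open before the
step, and the count does not increase (`exists_remaining_of_first`, `processable_iff`).

*Logarithmic space.* The procedure is implemented through a descriptive form of `NL`. A predicate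
`P w v` on a word `w` and a tuple `v` of numbers of logarithmic length is called an `NLPred` if a
nondeterministic regular program over such registers decides it without changing `v`. These
predicates contain linear equations and tests of input letters, and they are closed under
conjunction, disjunction, bounded existential quantification and reflexive transitive closure
(`NLPred.linear`, `NLPred.cell`, `NLPred.and`, `NLPred.or`, `NLPred.exTuple`, `NLPred.reach`).
Negation is never needed. A regular program becomes a finite automaton by Thompson's construction
(`Prog.exists_automaton`). An elementary action replaces the register values by guessed ones that
satisfy given linear equations. A machine whose single work tape holds all registers as parallel
tracks of bits performs such an action in one pass from the least significant bit on, which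
guesses the new bits and keeps the carries in the control state (`Tr`, `Inv.step`,
`reaches_ready`). The tape is laid out by counting the input cells in binary, so that all
computations, also those with useless guesses, stay within logarithmically many cells
(`mem_NL_of_prog`, `mem_NL_of_nlPred`).

*The formula.* A word describes an instance if and only if there are positions of the semicolons
between which the word reads as sequences of bins (`Layout.eq_encodeWord`, `exists_layout`). A run
of the procedure becomes a walk on the positions of the next bins together with `opn`
(`Layout.exists_run_iff`). All conditions are positive: that two pallet symbols agree or differ is
found by walking through both in parallel (`dig_eq_iff`, `dig_ne_iff`), that a pallet does or does
not occur in a part of a sequence by walking over its bins (`mem_iff`, `notMem_iff`), and that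
`opn ≤ p` by halving `opn` along the digits of `p` (`le_digVal_iff`), because `p` itself may be
too large for a register.
-/

namespace OffLine

/-! ### Regular programs and their finite control -/

open Relation

/-- Regular programs over a set `A` of elementary actions. -/
inductive Prog (A : Type)
  | act (a : A)
  | seq (p q : Prog A)
  | alt (p q : Prog A)
  | star (p : Prog A)

namespace Prog

variable {A C : Type}

/-- The input-output relation of a program, for a given meaning `ρ` of the elementary actions. -/
def sem (ρ : A → C → C → Prop) : Prog A → C → C → Prop
  | act a => ρ a
  | seq p q => Comp (p.sem ρ) (q.sem ρ)
  | alt p q => fun c c' => p.sem ρ c c' ∨ q.sem ρ c c'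
  | star p => ReflTransGen (p.sem ρ)

/-- The steps of a finite automaton whose transitions are labelled by elementary actions, or by
`none` for a silent transition. -/
def AutStep (ρ : A → C → C → Prop) {S : Type} (Δ : S → Option A → S → Prop) (x y : S × C) : Prop :=
  ∃ l, Δ x.1 l y.1 ∧ l.elim (x.2 = y.2) fun a => ρ a x.2 y.2

lemma AutStep.of_silent {ρ : A → C → C → Prop} {S : Type} {Δ : S → Option A → S → Prop} {s t : S}
    (h : Δ s none t) (c : C) : AutStep ρ Δ (s, c) (t, c) :=
  ⟨none, h, rfl⟩

lemma reaches_map {ρ : A → C → C → Prop} {S T : Type} {Δ : S → Option A → S → Prop}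
    {Θ : T → Option A → T → Prop} (f : S → T) (h : ∀ s l t, Δ s l t → Θ (f s) l (f t))
    {x y : S × C} (hxy : ReflTransGen (AutStep ρ Δ) x y) :
    ReflTransGen (AutStep ρ Θ) (f x.1, x.2) (f y.1, y.2) :=
  hxy.lift (fun x => (f x.1, x.2)) fun _ _ ⟨l, h1, h2⟩ => ⟨l, h _ _ _ h1, h2⟩

/-- Transitions of the automaton for `seq p q`. -/
inductive SeqTrans {S T : Type} (Δ : S → Option A → S → Prop) (Θ : T → Option A → T → Prop)
    (s1 : S) (t0 : T) : S ⊕ T → Option A → S ⊕ T → Prop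
  | left {s l s'} : Δ s l s' → SeqTrans Δ Θ s1 t0 (.inl s) l (.inl s')
  | right {t l t'} : Θ t l t' → SeqTrans Δ Θ s1 t0 (.inr t) l (.inr t')
  | link : SeqTrans Δ Θ s1 t0 (.inl s1) none (.inr t0)

/-- Transitions of the automaton for `alt p q`; `false` is the new initial state and `true` the new
final state. -/
inductive AltTrans {S T : Type} (Δ : S → Option A → S → Prop) (Θ : T → Option A → T → Prop)
    (s0 s1 : S) (t0 t1 : T) : Bool ⊕ (S ⊕ T) → Option A → Bool ⊕ (S ⊕ T) → Prop
  | left {s l s'} : Δ s l s' → AltTrans Δ Θ s0 s1 t0 t1 (.inr (.inl s)) l (.inr (.inl s'))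
  | right {t l t'} : Θ t l t' → AltTrans Δ Θ s0 s1 t0 t1 (.inr (.inr t)) l (.inr (.inr t'))
  | inLeft : AltTrans Δ Θ s0 s1 t0 t1 (.inl false) none (.inr (.inl s0))
  | inRight : AltTrans Δ Θ s0 s1 t0 t1 (.inl false) none (.inr (.inr t0))
  | outLeft : AltTrans Δ Θ s0 s1 t0 t1 (.inr (.inl s1)) none (.inl true)
  | outRight : AltTrans Δ Θ s0 s1 t0 t1 (.inr (.inr t1)) none (.inl true)

/-- Transitions of the automaton for `star p`; `none` is the new initial and final state. -/
inductive StarTrans {S : Type} (Δ : S → Option A → S → Prop)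
    (s0 s1 : S) : Option S → Option A → Option S → Prop
  | inner {s l s'} : Δ s l s' → StarTrans Δ s0 s1 (some s) l (some s')
  | enter : StarTrans Δ s0 s1 none none (some s0)
  | leave : StarTrans Δ s0 s1 (some s1) none none

/-- Thompson's construction: the relation of a regular program is realised by a finite automaton
with one initial and one final state. -/
theorem exists_automaton (p : Prog A) :
    ∃ (S : Type) (_ : Finite S) (Δ : S → Option A → S → Prop) (s0 s1 : S),
      ∀ (C : Type) (ρ : A → C → C → Prop) (c c' : C),
        p.sem ρ c c' ↔ ReflTransGen (AutStep ρ Δ) (s0, c) (s1, c') := by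
  induction p with
  | act a =>
    refine ⟨Bool, inferInstance, fun s l t => s = false ∧ l = some a ∧ t = true, false, true, ?_⟩
    intro C ρ c c'
    constructor
    · exact fun h => .single ⟨some a, ⟨rfl, rfl, rfl⟩, h⟩
    · intro h
      have key : ∀ y, ReflTransGen (AutStep ρ fun s l t => s = false ∧ l = some a ∧ t = true)
          (false, c) y → if y.1 then ρ a c y.2 else c = y.2 := by
        intro y hy
        induction hy with
        | refl => simp
        | @tail y z _ hstep ih =>
          obtain ⟨l, ⟨hs, rfl, ht⟩, hρ⟩ := hstep
          simp only [hs, Bool.false_eq_true, if_false] at ih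
          simpa [ht, ih] using hρ
      exact key _ h
  | seq p q ihp ihq =>
    obtain ⟨S, _, Δ, s0, s1, hp⟩ := ihp
    obtain ⟨T, _, Θ, t0, t1, hq⟩ := ihq
    refine ⟨S ⊕ T, inferInstance, SeqTrans Δ Θ s1 t0, .inl s0, .inr t1, ?_⟩
    intro C ρ c c'
    constructor
    · rintro ⟨d, h1, h2⟩
      exact (reaches_map Sum.inl (fun _ _ _ => .left) ((hp C ρ c d).1 h1)).trans
        (.head (AutStep.of_silent .link d)
          (reaches_map Sum.inr (fun _ _ _ => .right) ((hq C ρ d c').1 h2)))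
    · intro h
      have key : ∀ y, ReflTransGen (AutStep ρ (SeqTrans Δ Θ s1 t0)) (.inl s0, c) y →
          y.1.elim (fun s => ReflTransGen (AutStep ρ Δ) (s0, c) (s, y.2))
            (fun t => ∃ d, p.sem ρ c d ∧ ReflTransGen (AutStep ρ Θ) (t0, d) (t, y.2)) := by
        intro y hy
        induction hy with
        | refl => exact .refl
        | @tail y z _ hstep ih =>
          obtain ⟨y, d⟩ := y
          obtain ⟨z, e⟩ := z
          obtain ⟨l, hl, hρ⟩ := hstep
          cases hl with
          | left h => exact ReflTransGen.tail ih ⟨l, h, hρ⟩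
          | right h =>
            obtain ⟨d', h1, h2⟩ := ih
            exact ⟨d', h1, h2.tail ⟨l, h, hρ⟩⟩
          | link =>
            obtain rfl : d = e := hρ
            exact ⟨d, (hp C ρ c d).2 ih, .refl⟩
      obtain ⟨d, h1, h2⟩ := key _ h
      exact ⟨d, h1, (hq C ρ d c').2 h2⟩
  | alt p q ihp ihq =>
    obtain ⟨S, _, Δ, s0, s1, hp⟩ := ihp
    obtain ⟨T, _, Θ, t0, t1, hq⟩ := ihq
    refine ⟨Bool ⊕ (S ⊕ T), inferInstance, AltTrans Δ Θ s0 s1 t0 t1, .inl false, .inl true, ?_⟩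
    intro C ρ c c'
    constructor
    · rintro (h | h)
      · exact .head (AutStep.of_silent .inLeft c) (.tail
          (reaches_map (Sum.inr ∘ Sum.inl) (fun _ _ _ => .left) ((hp C ρ c c').1 h))
          (AutStep.of_silent .outLeft c'))
      · exact .head (AutStep.of_silent .inRight c) (.tail
          (reaches_map (Sum.inr ∘ Sum.inr) (fun _ _ _ => .right) ((hq C ρ c c').1 h))
          (AutStep.of_silent .outRight c'))
    · intro h
      have key : ∀ y, ReflTransGen (AutStep ρ (AltTrans Δ Θ s0 s1 t0 t1)) (.inl false, c) y →
          y.1.elim (fun b => if b then (p.sem ρ c y.2 ∨ q.sem ρ c y.2) else c = y.2)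
            (Sum.elim (fun s => ReflTransGen (AutStep ρ Δ) (s0, c) (s, y.2))
              (fun t => ReflTransGen (AutStep ρ Θ) (t0, c) (t, y.2))) := by
        intro y hy
        induction hy with
        | refl => simp
        | @tail y z _ hstep ih =>
          obtain ⟨y, d⟩ := y
          obtain ⟨z, e⟩ := z
          obtain ⟨l, hl, hρ⟩ := hstep
          cases hl with
          | left h => exact ReflTransGen.tail ih ⟨l, h, hρ⟩
          | right h => exact ReflTransGen.tail ih ⟨l, h, hρ⟩
          | inLeft =>
            obtain rfl : d = e := hρ
            obtain rfl : c = d := by simpa using ih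
            exact .refl
          | inRight =>
            obtain rfl : d = e := hρ
            obtain rfl : c = d := by simpa using ih
            exact .refl
          | outLeft =>
            obtain rfl : d = e := hρ
            simpa using Or.inl ((hp C ρ c d).2 ih)
          | outRight =>
            obtain rfl : d = e := hρ
            simpa using Or.inr ((hq C ρ c d).2 ih)
      exact key _ h
  | star p ihp =>
    obtain ⟨S, _, Δ, s0, s1, hp⟩ := ihp
    refine ⟨Option S, inferInstance, StarTrans Δ s0 s1, none, none, ?_⟩
    intro C ρ c c'
    constructor
    · intro h
      induction h with
      | refl => exact .refl
      | tail _ h ih =>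
        exact ih.trans (.head (AutStep.of_silent .enter _) (.tail
          (reaches_map some (fun _ _ _ => .inner) ((hp C ρ _ _).1 h))
          (AutStep.of_silent .leave _)))
    · intro h
      have key : ∀ y, ReflTransGen (AutStep ρ (StarTrans Δ s0 s1)) (none, c) y →
          y.1.elim (ReflTransGen (p.sem ρ) c y.2) (fun s => ∃ d, ReflTransGen (p.sem ρ) c d ∧
            ReflTransGen (AutStep ρ Δ) (s0, d) (s, y.2)) := by
        intro y hy
        induction hy with
        | refl => exact .refl
        | @tail y z _ hstep ih =>
          obtain ⟨y, d⟩ := y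
          obtain ⟨z, e⟩ := z
          obtain ⟨l, hl, hρ⟩ := hstep
          cases hl with
          | inner h =>
            obtain ⟨d', h1, h2⟩ := ih
            exact ⟨d', h1, h2.tail ⟨l, h, hρ⟩⟩
          | enter =>
            obtain rfl : d = e := hρ
            exact ⟨d, ih, .refl⟩
          | leave =>
            obtain rfl : d = e := hρ
            obtain ⟨d', h1, h2⟩ := ih
            exact ReflTransGen.tail h1 ((hp C ρ d' d).2 h2)
      exact key _ h

end Prog

end OffLine

namespace OffLine

open Relation

/-! ### Register actions and their realisation by one pass over a work tape -/

/-- The value of a term in an action on the registers `R`: `none` is the constant `0`, `inl i` is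
the value of register `i` before the action, and `inr i` is its value after the action. -/
def termVal {R : Type} (r r' : R → ℕ) : Option (R ⊕ R) → ℕ
  | none => 0
  | some (.inl i) => r i
  | some (.inr i) => r' i

/-- The equation `x + y + c = z` between terms, where `c` is `0` or `1`. -/
abbrev Atom (R : Type) := Option (R ⊕ R) × Option (R ⊕ R) × Option (R ⊕ R) × Bool

/-- The equation holds for the old register values `r` and the new ones `r'`. -/
def Atom.Holds {R : Type} (r r' : R → ℕ) (t : Atom R) : Prop :=
  termVal r r' t.1 + termVal r r' t.2.1 + t.2.2.2.toNat = termVal r r' t.2.2.1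

/-- An elementary action: it is possible if the scanned input cell is in `guard`, it moves the input
head, and it replaces the register values by arbitrary values that satisfy the equations in
`cond`. -/
structure Act (α R : Type) where
  mv : Move
  guard : Set (Cell α)
  cond : Set (Atom R)

/-- The strict upper bound on all register values: the registers have as many bits as the position
of the right end marker. -/
def bound {α : Type} (x : List α) : ℕ := 2 ^ Nat.size (x.length + 1)

/-- The effect of an action on the position of the input head and the register values. -/
def Act.Rel {α R : Type} (x : List α) (a : Act α R) (c c' : ℕ × (R → ℕ)) : Prop :=
  inputCell x c.1 ∈ a.guard ∧ c'.1 = min (a.mv.shift c.1) (x.length + 1) ∧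
    (∀ i, c'.2 i < bound x) ∧ ∀ t ∈ a.cond, t.Holds c.2 c'.2

lemma length_lt_bound {α : Type} (x : List α) : x.length + 1 < bound x := Nat.lt_size_self _

lemma inputCell_rightEnd_iff {α : Type} (x : List α) (h : ℕ) :
    inputCell x h = .rightEnd ↔ x.length + 1 ≤ h := by
  cases h with
  | zero => simp [inputCell]
  | succ h =>
    simp only [inputCell]
    rcases hx : x[h]? with _ | a
    · simpa using hx
    · simp [(List.getElem?_eq_some_iff.1 hx).1]

section Words

variable {R : Type}

/-- The register values that are given by a word of columns of bits, least significant bit first. -/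
def wordVal : List (R → Bool) → R → ℕ
  | [], _ => 0
  | d :: w, i => (d i).toNat + 2 * wordVal w i

lemma wordVal_append (u v : List (R → Bool)) (i : R) :
    wordVal (u ++ v) i = wordVal u i + 2 ^ u.length * wordVal v i := by
  induction u with
  | nil => simp [wordVal]
  | cons d u ih => simp [wordVal, ih, pow_succ]; ring

lemma wordVal_lt (u : List (R → Bool)) (i : R) : wordVal u i < 2 ^ u.length := by
  induction u with
  | nil => simp [wordVal]
  | cons d u ih =>
    have := Bool.toNat_le (d i)
    simp only [wordVal, List.length_cons, pow_succ]
    omega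

lemma exists_wordVal (n : ℕ) (r : R → ℕ) (hr : ∀ i, r i < 2 ^ n) :
    ∃ w : List (R → Bool), w.length = n ∧ wordVal w = r := by
  induction n generalizing r with
  | zero =>
    refine ⟨[], rfl, funext fun i => ?_⟩
    have := hr i
    simp only [pow_zero, Nat.lt_one_iff] at this
    simp [wordVal, this]
  | succ n ih =>
    obtain ⟨w, h1, h2⟩ := ih (fun i => r i / 2) fun i => by
      have := hr i
      rw [pow_succ] at this
      omega
    refine ⟨(fun i => decide (r i % 2 = 1)) :: w, by simp [h1], funext fun i => ?_⟩
    simp only [wordVal, h2]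
    by_cases h : r i % 2 = 1
    · simp [h]; omega
    · simp [h]; omega

/-- One column of the pass that adds up the two sides of the equations in `C`, with old bits `d`,
new bits `d'`, incoming carries `κ` and outgoing carries `κ'`. -/
def DigitStep (C : Set (Atom R)) (κ : Atom R → Bool) (d d' : R → Bool)
    (κ' : Atom R → Bool) : Prop :=
  ∀ t ∈ C, termVal (fun i => (d i).toNat) (fun i => (d' i).toNat) t.1 +
    termVal (fun i => (d i).toNat) (fun i => (d' i).toNat) t.2.1 + (κ t).toNat =
    termVal (fun i => (d i).toNat) (fun i => (d' i).toNat) t.2.2.1 + 2 * (κ' t).toNat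

lemma termVal_snoc (u v : List (R → Bool)) (d d' : R → Bool) (h : u.length = v.length)
    (y : Option (R ⊕ R)) :
    termVal (wordVal (u ++ [d])) (wordVal (v ++ [d'])) y = termVal (wordVal u) (wordVal v) y +
      2 ^ u.length * termVal (fun i => (d i).toNat) (fun i => (d' i).toNat) y := by
  rcases y with _ | i | i <;> simp [termVal, wordVal_append, wordVal, h]

lemma termVal_cons (u v : List (R → Bool)) (d d' : R → Bool) (y : Option (R ⊕ R)) :
    termVal (wordVal (d :: u)) (wordVal (d' :: v)) y =
      termVal (fun i => (d i).toNat) (fun i => (d' i).toNat) y +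
      2 * termVal (wordVal u) (wordVal v) y := by
  rcases y with _ | i | i <;> simp [termVal, wordVal]

lemma termVal_bit_le (d d' : R → Bool) (y : Option (R ⊕ R)) :
    termVal (fun i => (d i).toNat) (fun i => (d' i).toNat) y ≤ 1 := by
  rcases y with _ | i | i <;> simp [termVal, Bool.toNat_le]

end Words

/-! ### The Turing machine for a regular program -/

/-- The work alphabet: a blank, a marker for cell `0`, and columns with one bit per register. -/
inductive Sym (R : Type)
  | blank
  | marker
  | digit (d : R → Bool)

instance {R : Type} [Finite R] : Finite (Sym R) :=
  Finite.of_surjective (α := Option (Option (R → Bool)))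
    (fun | none => .blank | some none => .marker | some (some d) => .digit d)
    (by rintro (_ | _ | d); exacts [⟨none, rfl⟩, ⟨some none, rfl⟩, ⟨some (some d), rfl⟩])

/-- The control states of the machine. In the states `boot`, `carry` and `back` it counts the input
cells in binary in order to lay out the work tape. In `ready s` the simulated automaton is in state
`s`; in `pass s C κ` and `rewind s` it is on its way to state `s`, guessing and checking the new
register values and returning to cell `0`, respectively. -/
inductive Ctrl (S R : Type)
  | boot
  | carry
  | back
  | ready (s : S)
  | pass (s : S) (C : Set (Atom R)) (κ : Atom R → Bool)
  | rewind (s : S)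

instance {S R : Type} [Finite S] [Finite R] : Finite (Ctrl S R) :=
  Finite.of_surjective
    (α := (Fin 3 ⊕ S) ⊕ ((S × Set (Atom R) × (Atom R → Bool)) ⊕ S))
    (fun
      | .inl (.inl 0) => .boot
      | .inl (.inl 1) => .carry
      | .inl (.inl 2) => .back
      | .inl (.inr s) => .ready s
      | .inr (.inl (s, C, κ)) => .pass s C κ
      | .inr (.inr s) => .rewind s)
    (by
      rintro (_ | _ | _ | s | ⟨s, C, κ⟩ | s)
      exacts [⟨.inl (.inl 0), rfl⟩, ⟨.inl (.inl 1), rfl⟩, ⟨.inl (.inl 2), rfl⟩,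
        ⟨.inl (.inr s), rfl⟩, ⟨.inr (.inl (s, C, κ)), rfl⟩, ⟨.inr (.inr s), rfl⟩])

section Machine

variable {α R S : Type} (Δ : S → Option (Act α R) → S → Prop) (s0 s1 : S)

/-- The transitions of the machine with one work tape that simulates the automaton with transitions
`Δ` and initial state `s0`. -/
inductive Tr : Ctrl S R → Cell α → Sym R → Ctrl S R → Move → Sym R → Move → Prop
  | boot {a g} : Tr .boot a g .back .stay .marker .stay
  | backDigit {a d} : Tr .back a (.digit d) .back .stay (.digit d) .left
  | backMarker {a} : a ≠ .rightEnd → Tr .back a .marker .carry .right .marker .right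
  | backEnd : Tr .back .rightEnd .marker (.ready s0) .stay .marker .stay
  | carryOne {a} :
      Tr .carry a (.digit fun _ => true) .carry .stay (.digit fun _ => false) .right
  | carryZero {a} :
      Tr .carry a (.digit fun _ => false) .back .stay (.digit fun _ => true) .left
  | carryBlank {a} : Tr .carry a .blank .back .stay (.digit fun _ => true) .left
  | silent {a s s'} : Δ s none s' → Tr (.ready s) a .marker (.ready s') .stay .marker .stay
  | act {a s A s'} : Δ s (some A) s' → a ∈ A.guard →
      Tr (.ready s) a .marker (.pass s' A.cond fun t => t.2.2.2) A.mv .marker .right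
  | passDigit {a s C κ d d' κ'} : DigitStep C κ d d' κ' →
      Tr (.pass s C κ) a (.digit d) (.pass s C κ') .stay (.digit d') .right
  | passEnd {a s C κ} : (∀ t ∈ C, κ t = false) →
      Tr (.pass s C κ) a .blank (.rewind s) .stay .blank .left
  | rewindDigit {a s d} : Tr (.rewind s) a (.digit d) (.rewind s) .stay (.digit d) .left
  | rewindMarker {a s} : Tr (.rewind s) a .marker (.ready s) .stay .marker .stay

/-- The machine with the transitions `Tr`. -/
def progMachine [Finite S] [Finite R] : NTM α where
  State := Ctrl S R
  finite_state := inferInstance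
  Work := Sym R
  finite_work := inferInstance
  tapes := 1
  blank := .blank
  start := .boot
  accepting := {.ready s1}
  trans q a g q' m g' d := Tr Δ s0 q a (g 0) q' m (g' 0) (d 0)

/-- A configuration of a machine with one work tape. -/
structure TapeCfg (S R : Type) where
  state : Ctrl S R
  head : ℕ
  tape : ℕ → Sym R
  pos : ℕ

/-- One step of the machine with the transitions `Tr`. -/
inductive TapeStep (x : List α) : TapeCfg S R → TapeCfg S R → Prop
  | mk {q h f p q' m g d} : Tr Δ s0 q (inputCell x h) (f p) q' m g d →
    TapeStep x ⟨q, h, f, p⟩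
      ⟨q', min (m.shift h) (x.length + 1), Function.update f p g, d.shift p⟩

variable {Δ s0 s1} in
lemma TapeStep.mk' {x : List α} {q q' : Ctrl S R} {h h' p p' : ℕ} {f f' : ℕ → Sym R} {a g m g' d}
    (ht : Tr Δ s0 q a g q' m g' d) (ha : inputCell x h = a) (hg : f p = g)
    (hh : min (m.shift h) (x.length + 1) = h') (hf : Function.update f p g' = f')
    (hp : d.shift p = p') : TapeStep Δ s0 x ⟨q, h, f, p⟩ ⟨q', h', f', p'⟩ := by
  subst ha hg hh hf hp
  exact .mk ht

/-- The initial configuration. -/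
def TapeCfg.init (S R : Type) : TapeCfg S R := ⟨.boot, 0, fun _ => .blank, 0⟩

variable [Finite S] [Finite R]

/-- A configuration with one work tape as a configuration of `progMachine`. -/
def toConfig (c : TapeCfg S R) : (progMachine Δ s0 s1).Config where
  state := c.state
  inputHead := c.head
  content := fun _ => c.tape
  workHead := fun _ => c.pos

lemma step_toConfig {x : List α} {c c' : TapeCfg S R} (h : TapeStep Δ s0 x c c') :
    (progMachine Δ s0 s1).Step x (toConfig Δ s0 s1 c) (toConfig Δ s0 s1 c') := by
  obtain ⟨ht⟩ := h
  exact ⟨_, fun _ => _, fun _ => _, ht, rfl, fun _ => rfl, fun _ => rfl⟩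

lemma exists_of_step {x : List α} {c : TapeCfg S R} {e : (progMachine Δ s0 s1).Config}
    (h : (progMachine Δ s0 s1).Step x (toConfig Δ s0 s1 c) e) :
    ∃ c', e = toConfig Δ s0 s1 c' ∧ TapeStep Δ s0 x c c' := by
  obtain ⟨m, g, d, ht, h1, h2, h3⟩ := h
  obtain ⟨q, hd, f, p⟩ := c
  refine ⟨_, ?_, .mk ht⟩
  obtain ⟨eq, eh, ef, ep⟩ := e
  simp only [toConfig] at h1 h2 h3 ⊢
  subst h1
  congr 1
  · funext i
    obtain rfl : i = (0 : Fin 1) := Subsingleton.elim (α := Fin 1) _ _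
    exact h2 _
  · funext i
    obtain rfl : i = (0 : Fin 1) := Subsingleton.elim (α := Fin 1) _ _
    exact h3 _

lemma reaches_iff {x : List α} {e : (progMachine Δ s0 s1).Config} :
    (progMachine Δ s0 s1).Reaches x e ↔
      ∃ c, e = toConfig Δ s0 s1 c ∧ ReflTransGen (TapeStep Δ s0 x) (TapeCfg.init S R) c := by
  constructor
  · intro h
    induction h with
    | refl => exact ⟨_, rfl, .refl⟩
    | tail _ h ih =>
      obtain ⟨c, rfl, hc⟩ := ih
      obtain ⟨c', rfl, hc'⟩ := exists_of_step Δ s0 s1 h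
      exact ⟨c', rfl, hc.tail hc'⟩
  · rintro ⟨c, rfl, hc⟩
    exact hc.lift (toConfig Δ s0 s1) fun _ _ => step_toConfig Δ s0 s1

end Machine

end OffLine

namespace OffLine

open Relation

/-! ### Contents of the work tape -/

section Tape

variable {R : Type}

/-- The tape with the marker in cell `0`, followed by the columns of `w`, followed by blanks. -/
def tapeOf (w : List (R → Bool)) : ℕ → Sym R
  | 0 => .marker
  | j + 1 => match w[j]? with
    | some d => .digit d
    | none => .blank

lemma tapeOf_succ_of_append (v w : List (R → Bool)) (d : R → Bool) :
    tapeOf (v ++ d :: w) (v.length + 1) = .digit d := by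
  simp [tapeOf]

lemma tapeOf_length_succ (w : List (R → Bool)) : tapeOf w (w.length + 1) = .blank := by
  simp [tapeOf]

lemma exists_append_of_tapeOf_eq_digit {w : List (R → Bool)} {p : ℕ} {d : R → Bool}
    (h : tapeOf w p = .digit d) : ∃ v u, w = v ++ d :: u ∧ p = v.length + 1 := by
  cases p with
  | zero => simp [tapeOf] at h
  | succ j =>
    rcases hj : w[j]? with _ | d'
    · simp [tapeOf, hj] at h
    · simp only [tapeOf, hj, Sym.digit.injEq] at h
      subst h
      obtain ⟨hlt, rfl⟩ := List.getElem?_eq_some_iff.1 hj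
      exact ⟨w.take j, w.drop (j + 1), by simp, by simp; omega⟩

lemma tapeOf_eq_marker_iff {w : List (R → Bool)} {p : ℕ} : tapeOf w p = .marker ↔ p = 0 := by
  cases p with
  | zero => simp [tapeOf]
  | succ j =>
    rcases hj : w[j]? with _ | d' <;> simp [tapeOf, hj]

lemma length_lt_of_tapeOf_eq_blank {w : List (R → Bool)} {p : ℕ} (h : tapeOf w p = .blank) :
    w.length < p := by
  cases p with
  | zero => simp [tapeOf] at h
  | succ j =>
    rcases hj : w[j]? with _ | d'
    · simpa [Nat.lt_succ_iff] using hj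
    · simp [tapeOf, hj] at h

lemma update_tapeOf_append (v w : List (R → Bool)) (d d' : R → Bool) :
    Function.update (tapeOf (v ++ d :: w)) (v.length + 1) (.digit d') = tapeOf (v ++ d' :: w) := by
  funext p
  rcases p with _ | j
  · simp [tapeOf]
  · rcases eq_or_ne j v.length with rfl | h
    · simp [tapeOf]
    · rw [Function.update_of_ne (by simpa using h)]
      simp only [tapeOf]
      rcases lt_or_gt_of_ne h with h | h
      · simp [List.getElem?_append_left h]
      · obtain ⟨e, rfl⟩ := Nat.exists_eq_add_of_lt h
        rw [List.getElem?_append_right (by omega), List.getElem?_append_right (by omega)]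
        simp [show v.length + e + 1 - v.length = e + 1 by omega]

lemma update_tapeOf_length_succ (w : List (R → Bool)) (d : R → Bool) :
    Function.update (tapeOf w) (w.length + 1) (.digit d) = tapeOf (w ++ [d]) := by
  funext p
  rcases p with _ | j
  · simp [tapeOf]
  · rcases eq_or_ne j w.length with rfl | h
    · simp [tapeOf]
    · rw [Function.update_of_ne (by simpa using h)]
      simp only [tapeOf]
      rcases lt_or_gt_of_ne h with h | h
      · simp [List.getElem?_append_left h]
      · rw [List.getElem?_append_right (by omega), List.getElem?_eq_none (by omega),
          List.getElem?_eq_none (by simp; omega)]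

lemma update_blank_zero : Function.update (fun _ => Sym.blank) 0 .marker =
    tapeOf ([] : List (R → Bool)) := by
  funext p
  rcases p with _ | j <;> simp [tapeOf]

end Tape

/-! ### Correctness of the machine -/

section Correct

variable {α R S : Type} {Δ : S → Option (Act α R) → S → Prop} {s0 : S}

/-- The initial configuration of the simulated automaton: the input head is on the right end marker,
and all registers hold its position. -/
def startCfg (R : Type) (x : List α) : ℕ × (R → ℕ) := (x.length + 1, fun _ => x.length + 1)

/-- What holds in the configurations that the machine reaches. In `carry`, the digits and the
pending carry together represent the position of the input head. In `pass`, the columns `v` have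
replaced the old columns `u`, and `κ` holds the carries of the equations `C` on these columns. -/
def Inv (Δ : S → Option (Act α R) → S → Prop) (s0 : S) (x : List α) (c : TapeCfg S R) : Prop :=
  c.head ≤ x.length + 1 ∧
  match c.state with
  | .boot => c.tape = (fun _ => .blank) ∧ c.head = 0 ∧ c.pos = 0
  | .back => ∃ w, c.tape = tapeOf w ∧ c.pos ≤ w.length ∧ w.length ≤ Nat.size c.head ∧
      ∀ i, wordVal w i = c.head
  | .carry => ∃ w j, c.tape = tapeOf w ∧ c.pos = j + 1 ∧ j ≤ w.length ∧
      w.length ≤ Nat.size c.head ∧ ∀ i, wordVal w i + 2 ^ j = c.head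
  | .ready s => ∃ w, c.tape = tapeOf w ∧ c.pos = 0 ∧ w.length = Nat.size (x.length + 1) ∧
      ReflTransGen (Prog.AutStep (Act.Rel x) Δ) (s0, startCfg R x) (s, (c.head, wordVal w))
  | .rewind s => ∃ w, c.tape = tapeOf w ∧ c.pos ≤ w.length ∧ w.length = Nat.size (x.length + 1) ∧
      ReflTransGen (Prog.AutStep (Act.Rel x) Δ) (s0, startCfg R x) (s, (c.head, wordVal w))
  | .pass s C κ => ∃ u v rest, c.tape = tapeOf (v ++ rest) ∧ c.pos = v.length + 1 ∧
      u.length = v.length ∧ (v ++ rest).length = Nat.size (x.length + 1) ∧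
      (∀ t ∈ C, termVal (wordVal u) (wordVal v) t.1 + termVal (wordVal u) (wordVal v) t.2.1 +
        t.2.2.2.toNat = termVal (wordVal u) (wordVal v) t.2.2.1 + 2 ^ u.length * (κ t).toNat) ∧
      ∃ s' A h, Δ s' (some A) s ∧ A.cond = C ∧ inputCell x h ∈ A.guard ∧
        c.head = min (A.mv.shift h) (x.length + 1) ∧
        ReflTransGen (Prog.AutStep (Act.Rel x) Δ) (s0, startCfg R x) (s', (h, wordVal (u ++ rest)))

lemma Inv.init (x : List α) : Inv Δ s0 x (TapeCfg.init S R) := by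
  simp [Inv, TapeCfg.init]

lemma Inv.step [Nonempty R] {x : List α} {c c' : TapeCfg S R} (hc : Inv Δ s0 x c)
    (h : TapeStep Δ s0 x c c') : Inv Δ s0 x c' := by
  obtain ⟨r₀⟩ := ‹Nonempty R›
  obtain ⟨ht⟩ := h
  rename_i q h f p q' m g d
  obtain ⟨hh, hc⟩ := hc
  refine ⟨min_le_right _ _, ?_⟩
  simp only at hh hc ⊢
  have hstay : min (Move.stay.shift h) (x.length + 1) = h := min_eq_left hh
  generalize hg : f p = g₀ at ht
  generalize ha₀ : inputCell x h = a₀ at ht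
  cases ht with
  | boot =>
    obtain ⟨rfl, rfl, rfl⟩ := hc
    exact ⟨[], update_blank_zero, le_rfl, by simp, fun i => by simp [wordVal, Move.shift]⟩
  | backDigit =>
    obtain ⟨w, rfl, hp, hw, hv⟩ := hc
    rw [hstay]
    exact ⟨w, by rw [← hg, Function.update_eq_self], (Nat.sub_le _ _).trans hp, hw, hv⟩
  | backMarker ha =>
    obtain ⟨w, rfl, hp, hw, hv⟩ := hc
    have hlt : h < x.length + 1 := by
      by_contra hle
      exact ha (ha₀ ▸ (inputCell_rightEnd_iff x h).2 (by omega))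
    obtain rfl := tapeOf_eq_marker_iff.1 hg
    have : min (Move.right.shift h) (x.length + 1) = h + 1 := min_eq_left hlt
    rw [this]
    exact ⟨w, 0, by rw [← hg, Function.update_eq_self], rfl, Nat.zero_le _,
      hw.trans (Nat.size_le_size (Nat.le_succ h)), fun i => by simp [hv]⟩
  | backEnd =>
    obtain ⟨w, rfl, hp, hw, hv⟩ := hc
    obtain rfl := tapeOf_eq_marker_iff.1 hg
    have hle := (inputCell_rightEnd_iff x h).1 ha₀
    obtain rfl : h = x.length + 1 := le_antisymm hh hle
    rw [hstay]
    refine ⟨w, by rw [← hg, Function.update_eq_self], rfl, le_antisymm hw ?_, ?_⟩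
    · exact Nat.size_le.2 ((hv r₀).symm.trans_lt (wordVal_lt w r₀))
    · rw [funext hv]
      exact .refl
  | carryOne =>
    obtain ⟨w, j, rfl, rfl, hj, hw, hv⟩ := hc
    obtain ⟨v, u, rfl, hp⟩ := exists_append_of_tapeOf_eq_digit hg
    obtain rfl : j = v.length := by omega
    rw [hstay]
    refine ⟨v ++ (fun _ => false) :: u, v.length + 1, update_tapeOf_append .., rfl, ?_, ?_, ?_⟩
    · simp
    · simpa using hw
    · intro i
      rw [← hv i]
      simp [wordVal_append, wordVal, pow_succ]
      ring
  | carryZero =>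
    obtain ⟨w, j, rfl, rfl, hj, hw, hv⟩ := hc
    obtain ⟨v, u, rfl, hp⟩ := exists_append_of_tapeOf_eq_digit hg
    obtain rfl : j = v.length := by omega
    rw [hstay]
    refine ⟨v ++ (fun _ => true) :: u, update_tapeOf_append .., ?_, ?_, ?_⟩
    · simp [Move.shift]
    · simpa using hw
    · intro i
      rw [← hv i]
      simp [wordVal_append, wordVal]
      ring
  | carryBlank =>
    obtain ⟨w, j, rfl, rfl, hj, hw, hv⟩ := hc
    have := length_lt_of_tapeOf_eq_blank hg
    obtain rfl : j = w.length := by omega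
    rw [hstay]
    refine ⟨w ++ [fun _ => true], update_tapeOf_length_succ .., ?_, ?_, ?_⟩
    · simp [Move.shift]
    · have : 2 ^ w.length ≤ h := by rw [← hv r₀]; exact Nat.le_add_left _ _
      simpa using Nat.lt_size.2 this
    · intro i
      rw [← hv i]
      simp [wordVal_append, wordVal]
  | silent hΔ =>
    obtain ⟨w, rfl, rfl, hw, hr⟩ := hc
    rw [hstay]
    exact ⟨w, by rw [← hg, Function.update_eq_self], rfl, hw, hr.tail (.of_silent hΔ _)⟩
  | act hΔ hgd =>
    subst ha₀
    obtain ⟨w, rfl, rfl, hw, hr⟩ := hc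
    refine ⟨[], [], w, by rw [← hg, Function.update_eq_self]; rfl, rfl, rfl, hw, ?_, _, _, h,
        hΔ, rfl,
      hgd, rfl, hr⟩
    intro t _
    have h0 : ∀ y : Option (R ⊕ R), termVal (wordVal []) (wordVal []) y = 0 := by
      rintro (_ | i | i) <;> rfl
    simp [h0]
  | passDigit hd =>
    obtain ⟨u, v, rest, rfl, rfl, huv, hw, hv, s', A, h', hΔ, hC, hgd, hh', hr⟩ := hc
    rename_i dg dg' κ'
    obtain ⟨v', u', hvu, hp⟩ := exists_append_of_tapeOf_eq_digit hg
    obtain ⟨rfl, rfl⟩ := List.append_inj hvu (by omega)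
    rw [hstay]
    refine ⟨u ++ [dg], v ++ [dg'], u', ?_, ?_, by simp [huv], ?_, ?_, s', A, h', hΔ, hC, hgd,
        hh', ?_⟩
    · rw [List.append_assoc]
      exact update_tapeOf_append ..
    · simp [Move.shift]
    · simpa using hw
    · intro t ht
      have h1 := hv t ht
      have h2 := congrArg (fun n => 2 ^ u.length * n) (hd t ht)
      simp only [termVal_snoc _ _ _ _ huv, List.length_append, List.length_singleton, pow_succ]
      simp only [mul_add] at h2
      linarith
    · simpa using hr
  | passEnd hκ =>
    obtain ⟨u, v, rest, rfl, rfl, huv, hw, hv, s', A, h', hΔ, rfl, hgd, hh', hr⟩ := hc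
    have := length_lt_of_tapeOf_eq_blank hg
    obtain rfl : rest = [] := List.length_eq_zero_iff.1 (by rw [List.length_append] at this; omega)
    rw [hstay]
    simp only [List.append_nil] at *
    refine ⟨v, by rw [← hg, Function.update_eq_self], le_rfl, hw, hr.tail ⟨some A, hΔ, hgd, hh',
        ?_, ?_⟩⟩
    · intro i
      exact (wordVal_lt v i).trans_eq (by rw [hw, bound])
    · intro t ht
      have h := hv t ht
      rwa [hκ t ht, Bool.toNat_false, mul_zero, add_zero] at h
  | rewindDigit =>
    obtain ⟨w, rfl, hp, hw, hr⟩ := hc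
    rw [hstay]
    exact ⟨w, by rw [← hg, Function.update_eq_self], (Nat.sub_le _ _).trans hp, hw, hr⟩
  | rewindMarker =>
    obtain ⟨w, rfl, hp, hw, hr⟩ := hc
    obtain rfl := tapeOf_eq_marker_iff.1 hg
    rw [hstay]
    exact ⟨w, by rw [← hg, Function.update_eq_self], rfl, hw, hr⟩

lemma Inv.of_reaches [Nonempty R] {x : List α} {c : TapeCfg S R}
    (h : ReflTransGen (TapeStep Δ s0 x) (TapeCfg.init S R) c) : Inv Δ s0 x c := by
  induction h with
  | refl => exact .init x
  | tail _ hs ih => exact ih.step hs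

lemma Inv.pos_le {x : List α} {c : TapeCfg S R} (h : Inv Δ s0 x c) :
    c.pos ≤ Nat.size (x.length + 1) + 1 := by
  obtain ⟨q, hd, f, p⟩ := c
  obtain ⟨hh, h⟩ := h
  have hs := Nat.size_le_size hh
  cases q <;> simp only at h hs ⊢
  · omega
  · obtain ⟨w, j, -, rfl, h1, h2, -⟩ := h
    omega
  · obtain ⟨w, -, h1, h2, -⟩ := h
    omega
  · obtain ⟨w, -, h1, h2, -⟩ := h
    omega
  · obtain ⟨u, v, rest, -, rfl, -, h2, -⟩ := h
    rw [List.length_append] at h2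
    omega
  · obtain ⟨w, -, h1, h2, -⟩ := h
    omega

lemma reaches_left {x : List α} {q : Ctrl S R} (hq : ∀ a d, Tr Δ s0 q a (.digit d)
    q .stay (.digit d) .left)
    {h : ℕ} (hh : h ≤ x.length + 1) (w : List (R → Bool)) {p : ℕ} (hp : p ≤ w.length) :
    ReflTransGen (TapeStep Δ s0 x) ⟨q, h, tapeOf w, p⟩ ⟨q, h, tapeOf w, 0⟩ := by
  induction p with
  | zero => exact .refl
  | succ j ih =>
    have hg : tapeOf w (j + 1) = .digit w[j] := by simp [tapeOf, List.getElem?_eq_getElem hp]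
    refine .head (TapeStep.mk' (hq _ _) rfl hg (min_eq_left hh) ?_ rfl) (ih (by omega))
    rw [← hg, Function.update_eq_self]

lemma reaches_of_carry {x : List α} {h : ℕ} (hh : h ≤ x.length + 1) (l : List Bool)
    (v : List (R → Bool)) : ∃ l' : List Bool, ReflTransGen (TapeStep Δ s0 x)
      ⟨.carry, h, tapeOf (v ++ l.map fun b _ => b), v.length + 1⟩
      ⟨.back, h, tapeOf (v ++ l'.map fun b _ => b), 0⟩ := by
  induction l generalizing v with
  | nil =>
    refine ⟨[true], .head (TapeStep.mk' .carryBlank rfl ?_ (min_eq_left hh) ?_ rfl)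
      (reaches_left (fun _ _ => .backDigit) hh _ ?_)⟩
    · simpa using tapeOf_length_succ v
    · simpa using update_tapeOf_length_succ v _
    · simp [Move.shift]
  | cons b l ih =>
    cases b with
    | false =>
      refine ⟨true :: l, .head (TapeStep.mk' .carryZero rfl ?_ (min_eq_left hh) ?_ rfl)
        (reaches_left (fun _ _ => .backDigit) hh _ ?_)⟩
      · simpa using tapeOf_succ_of_append v _ _
      · simpa using update_tapeOf_append v _ _ _
      · simp [Move.shift]
    | true =>
      obtain ⟨l', hl'⟩ := ih (v ++ [fun _ => false])
      exact ⟨false :: l', .head (TapeStep.mk' .carryOne rfl (tapeOf_succ_of_append v _ _)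
        (min_eq_left hh) (update_tapeOf_append v _ _ _) rfl) (by simpa [Move.shift] using hl')⟩

lemma reaches_back {x : List α} {h : ℕ} (hh : h ≤ x.length + 1) :
    ∃ l : List Bool, ReflTransGen (TapeStep Δ s0 x) (TapeCfg.init S R)
      ⟨.back, h, tapeOf (l.map fun b _ => b), 0⟩ := by
  induction h with
  | zero =>
    exact ⟨[], .single (TapeStep.mk' .boot rfl rfl (by simp [Move.shift]) update_blank_zero rfl)⟩
  | succ h ih =>
    obtain ⟨l, hl⟩ := ih (by omega)
    obtain ⟨l', hl'⟩ := reaches_of_carry (Δ := Δ) (s0 := s0) (R := R) hh l []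
    have hne : inputCell x h ≠ .rightEnd := by
      rw [Ne, inputCell_rightEnd_iff]; omega
    refine ⟨l', (hl.tail (TapeStep.mk' (.backMarker hne) rfl rfl (min_eq_left hh) ?_ rfl)).trans
        hl'⟩
    exact Function.update_eq_self 0 (tapeOf _)

lemma reaches_of_pass {x : List α} {s : S} {C : Set (Atom R)} {h : ℕ} (hh : h ≤ x.length + 1)
    (r r' : List (R → Bool)) (hr : r.length = r'.length) (v : List (R → Bool)) (κ : Atom R → Bool)
    (hC : ∀ t ∈ C, termVal (wordVal r) (wordVal r') t.1 + termVal (wordVal r) (wordVal r') t.2.1 +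
        (κ t).toNat = termVal (wordVal r) (wordVal r') t.2.2.1) :
    ReflTransGen (TapeStep Δ s0 x) ⟨.pass s C κ, h, tapeOf (v ++ r), v.length + 1⟩
      ⟨.rewind s, h, tapeOf (v ++ r'), v.length + r.length⟩ := by
  induction r generalizing r' v κ with
  | nil =>
    obtain rfl : r' = [] := List.length_eq_zero_iff.1 hr.symm
    rw [List.append_nil]
    refine .single (TapeStep.mk' (.passEnd ?_) rfl (tapeOf_length_succ v) (min_eq_left hh) ?_ rfl)
    · intro t ht
      have h0 : ∀ y : Option (R ⊕ R), termVal (wordVal []) (wordVal []) y = 0 := by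
        rintro (_ | i | i) <;> rfl
      simpa [h0] using hC t ht
    · rw [← tapeOf_length_succ v, Function.update_eq_self]
  | cons d r ih =>
    obtain _ | ⟨d', r'⟩ := r'
    · simp at hr
    let b := fun y => termVal (fun i => (d i).toNat) (fun i => (d' i).toNat) y
    let κ' : Atom R → Bool := fun t => decide (2 ≤ b t.1 + b t.2.1 + (κ t).toNat)
    -- the sums are congruent modulo 2, so that the carry is determined by the lowest bits
    have hcar : ∀ t ∈ C, b t.1 + b t.2.1 + (κ t).toNat = b t.2.2.1 + 2 * (κ' t).toNat ∧
        termVal (wordVal r) (wordVal r') t.1 + termVal (wordVal r) (wordVal r') t.2.1 +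
        (κ' t).toNat = termVal (wordVal r) (wordVal r') t.2.2.1 := by
      intro t ht
      have h1 := hC t ht
      simp only [termVal_cons] at h1
      have b1 : b t.1 ≤ 1 := termVal_bit_le ..
      have b2 : b t.2.1 ≤ 1 := termVal_bit_le ..
      have b3 : b t.2.2.1 ≤ 1 := termVal_bit_le ..
      have b4 := Bool.toNat_le (κ t)
      change b t.1 + _ + (b t.2.1 + _) + _ = b t.2.2.1 + _ at h1
      by_cases hk : 2 ≤ b t.1 + b t.2.1 + (κ t).toNat
      · have : (κ' t).toNat = 1 := by simp [κ', hk]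
        omega
      · have : (κ' t).toNat = 0 := by simpa [κ'] using hk
        omega
    have := ih r' (by simpa using hr) (v ++ [d']) κ' fun t ht => (hcar t ht).2
    refine .head (TapeStep.mk' (.passDigit fun t ht => (hcar t ht).1) rfl
      (tapeOf_succ_of_append v _ _) (min_eq_left hh) (update_tapeOf_append v _ _ _) rfl) ?_
    simpa [Move.shift, add_assoc, add_comm 1] using this

lemma reaches_ready {x : List α} {s : S} {c : ℕ × (R → ℕ)} [Nonempty R]
    (h : ReflTransGen (Prog.AutStep (Act.Rel x) Δ) (s0, startCfg R x) (s, c)) :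
    ∃ w, wordVal w = c.2 ∧ ReflTransGen (TapeStep Δ s0 x) (TapeCfg.init S R)
      ⟨.ready s, c.1, tapeOf w, 0⟩ := by
  obtain ⟨r₀⟩ := ‹Nonempty R›
  suffices H : ∀ y, ReflTransGen (Prog.AutStep (Act.Rel x) Δ) (s0, startCfg R x) y →
      ∃ w, w.length = Nat.size (x.length + 1) ∧ wordVal w = y.2.2 ∧ y.2.1 ≤ x.length + 1 ∧
      ReflTransGen (TapeStep Δ s0 x) (TapeCfg.init S R) ⟨.ready y.1, y.2.1, tapeOf w, 0⟩ by
    obtain ⟨w, -, h1, -, h2⟩ := H _ h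
    exact ⟨w, h1, h2⟩
  intro y hy
  induction hy with
  | refl =>
    obtain ⟨l, hl⟩ := reaches_back (Δ := Δ) (s0 := s0) (R := R) (le_refl (x.length + 1))
    have : Nonempty R := ⟨r₀⟩
    obtain ⟨-, w, hw, -, h2, h3⟩ := Inv.of_reaches hl
    simp only at hw h2 h3
    rw [hw] at hl
    refine ⟨w, le_antisymm h2 ?_, funext h3, le_rfl, hl.tail (TapeStep.mk' .backEnd
      ((inputCell_rightEnd_iff x _).2 le_rfl) rfl (min_eq_left le_rfl) ?_ rfl)⟩
    · exact Nat.size_le.2 ((h3 r₀).symm.trans_lt (wordVal_lt w r₀))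
    · exact Function.update_eq_self 0 (tapeOf _)
  | @tail y z _ hs ih =>
    obtain ⟨w, h1, h2, h3, h4⟩ := ih
    obtain ⟨s, h, r⟩ := y
    obtain ⟨s', h', r'⟩ := z
    obtain ⟨_ | A, hΔ, hρ⟩ := hs
    · cases hρ
      exact ⟨w, h1, h2, h3, h4.tail (TapeStep.mk' (.silent hΔ) rfl rfl (min_eq_left h3)
        (Function.update_eq_self 0 (tapeOf _)) rfl)⟩
    · obtain ⟨hgd, hh', hb, hC⟩ := hρ
      simp only at h2 h3 h4 hgd hh' hb hC hΔ
      obtain ⟨w', hw', rfl⟩ := exists_wordVal _ r' hb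
      subst h2
      have hle : h' ≤ x.length + 1 := hh' ▸ min_le_right _ _
      refine ⟨w', hw', rfl, hle, h4.trans (.head (TapeStep.mk' (.act hΔ hgd) rfl rfl hh'.symm
        (Function.update_eq_self 0 (tapeOf _)) rfl) ((reaches_of_pass hle w w' (h1.trans
          hw'.symm) [] _
        hC).trans ((reaches_left (fun _ _ => .rewindDigit) hle w' (by simp [h1, hw'])).tail
          (TapeStep.mk' .rewindMarker rfl rfl (min_eq_left hle)
            (Function.update_eq_self 0 (tapeOf _)) rfl))))⟩

end Correct

/-- A language that is accepted by a regular program over register actions is in `NL`. -/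
theorem mem_NL_of_prog {α R : Type} [Finite α] [Finite R] [Nonempty R] (L : Language α)
    (p : Prog (Act α R)) (hL : ∀ x, x ∈ L ↔ ∃ c, p.sem (Act.Rel x) (startCfg R x) c) :
    L ∈ NL α := by
  obtain ⟨S, _, Δ, s0, s1, hp⟩ := p.exists_automaton
  refine ⟨progMachine Δ s0 s1, fun x => ?_, 4, fun x e he i => ?_⟩
  · simp only [hL, hp, NTM.Accepts, reaches_iff]
    constructor
    · rintro ⟨c, hc⟩
      obtain ⟨w, -, h⟩ := reaches_ready hc
      exact ⟨_, ⟨_, rfl, h⟩, rfl⟩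
    · rintro ⟨_, ⟨⟨q, h, f, p⟩, rfl, hc⟩, hq⟩
      obtain rfl : q = .ready s1 := hq
      obtain ⟨-, w, -, -, -, h⟩ := Inv.of_reaches hc
      exact ⟨_, h⟩
  · obtain ⟨c, rfl, hc⟩ := (reaches_iff Δ s0 s1).1 he
    have h1 : c.pos ≤ _ := (Inv.of_reaches hc).pos_le
    have h2 : Nat.size (x.length + 1) ≤ Nat.log 2 x.length + 2 := by
      rw [Nat.size_le]
      have := Nat.lt_pow_succ_log_self one_lt_two x.length
      rw [pow_succ]
      have := Nat.one_le_two_pow (n := Nat.log 2 x.length)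
      simp only [Nat.succ_eq_add_one, pow_succ] at *
      omega
    change c.pos < _
    omega

end OffLine

namespace OffLine

open Relation

/-! ### Programs on a part of the registers -/

/-- The values that a configuration may hold on the input `x`. -/
def Good {α R : Type} (x : List α) (c : ℕ × (R → ℕ)) : Prop :=
  c.1 ≤ x.length + 1 ∧ ∀ i, c.2 i < bound x

section Rename

variable {α R R' : Type}

lemma Good.of_sem {x : List α} {p : Prog (Act α R)} {c c' : ℕ × (R → ℕ)} (hc : Good x c)
    (h : p.sem (Act.Rel x) c c') : Good x c' := by
  induction p generalizing c c' with
  | act a => exact ⟨h.2.1 ▸ min_le_right _ _, h.2.2.1⟩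
  | seq p q ihp ihq =>
    obtain ⟨d, h1, h2⟩ := h
    exact ihq (ihp hc h1) h2
  | alt p q ihp ihq => exact h.elim (ihp hc) (ihq hc)
  | star p ih =>
    induction h with
    | refl => exact hc
    | tail _ h1 h2 => exact ih h2 h1

/-- The equation that keeps or copies the old value of `i` to the new value of `j`. -/
def copyAtom (i j : R) : Atom R := (some (.inl i), none, some (.inr j), false)

@[simp] lemma copyAtom_holds {r r' : R → ℕ} {i j : R} : (copyAtom i j).Holds r r' ↔ r' j = r i := by
  simp [copyAtom, Atom.Holds, termVal, eq_comm]

/-- The action on the registers `R'` that performs `a` on the registers in the range of `f` and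
keeps all others. -/
def Act.rename (f : R → R') (a : Act α R) : Act α R' where
  mv := a.mv
  guard := a.guard
  cond := (fun t => (t.1.map (Sum.map f f), t.2.1.map (Sum.map f f), t.2.2.1.map (Sum.map f f),
    t.2.2.2)) '' a.cond ∪ {t | ∃ j, j ∉ Set.range f ∧ t = copyAtom j j}

/-- The program that performs `p` on the registers in the range of `f`. -/
def Prog.rename (f : R → R') : Prog (Act α R) → Prog (Act α R')
  | .act a => .act (a.rename f)
  | .seq p q => .seq (p.rename f) (q.rename f)
  | .alt p q => .alt (p.rename f) (q.rename f)
  | .star p => .star (p.rename f)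

/-- The part of a configuration that is visible through `f`. -/
def pull (f : R → R') (c : ℕ × (R' → ℕ)) : ℕ × (R → ℕ) := (c.1, c.2 ∘ f)

lemma Good.pull {x : List α} {c : ℕ × (R' → ℕ)} (h : Good x c) (f : R → R') :
    Good x (pull f c) := ⟨h.1, fun i => h.2 (f i)⟩

lemma termVal_map (f : R → R') (r r' : R' → ℕ) (y : Option (R ⊕ R)) :
    termVal r r' (y.map (Sum.map f f)) = termVal (r ∘ f) (r' ∘ f) y := by
  rcases y with _ | i | i <;> rfl

lemma Act.rel_rename {x : List α} {f : R → R'} {a : Act α R} {c c' : ℕ × (R' → ℕ)} :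
    (a.rename f).Rel x c c' ↔ a.Rel x (pull f c) (pull f c') ∧
      (∀ j, j ∉ Set.range f → c'.2 j = c.2 j) ∧ ∀ i, c'.2 i < bound x := by
  constructor
  · rintro ⟨h1, h2, h3, h4⟩
    refine ⟨⟨h1, h2, fun i => h3 _, fun t ht => ?_⟩, fun j hj => ?_, h3⟩
    · have := h4 _ (.inl ⟨t, ht, rfl⟩)
      simp only [Atom.Holds, termVal_map] at this
      exact this
    · exact copyAtom_holds.1 (h4 _ (.inr ⟨j, hj, rfl⟩))
  · rintro ⟨⟨h1, h2, -, h4⟩, h5, h6⟩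
    refine ⟨h1, h2, h6, ?_⟩
    rintro _ (⟨t, ht, rfl⟩ | ⟨j, hj, rfl⟩)
    · have := h4 t ht
      simp only [Atom.Holds, termVal_map]
      exact this
    · exact copyAtom_holds.2 (h5 j hj)

lemma Prog.sem_of_rename {x : List α} {f : R → R'} {p : Prog (Act α R)} {c c' : ℕ × (R' → ℕ)}
    (h : (p.rename f).sem (Act.Rel x) c c') : p.sem (Act.Rel x) (pull f c) (pull f c') ∧
      ∀ j, j ∉ Set.range f → c'.2 j = c.2 j := by
  induction p generalizing c c' with
  | act a =>
    obtain ⟨h1, h2, -⟩ := Act.rel_rename.1 h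
    exact ⟨h1, h2⟩
  | seq p q ihp ihq =>
    obtain ⟨d, h1, h2⟩ := h
    exact ⟨⟨_, (ihp h1).1, (ihq h2).1⟩, fun j hj => ((ihq h2).2 j hj).trans ((ihp h1).2 j hj)⟩
  | alt p q ihp ihq =>
    rcases h with h | h
    · exact ⟨.inl (ihp h).1, (ihp h).2⟩
    · exact ⟨.inr (ihq h).1, (ihq h).2⟩
  | star p ih =>
    induction h with
    | refl => exact ⟨.refl, fun _ _ => rfl⟩
    | tail _ h1 h2 => exact ⟨h2.1.tail (ih h1).1, fun j hj => ((ih h1).2 j hj).trans (h2.2 j hj)⟩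

lemma Prog.exists_sem_rename {x : List α} {f : R → R'} (hf : f.Injective) {p : Prog (Act α R)}
    {c : ℕ × (R' → ℕ)} {d : ℕ × (R → ℕ)} (hc : Good x c) (h : p.sem (Act.Rel x) (pull f c) d) :
    ∃ c', pull f c' = d ∧ (p.rename f).sem (Act.Rel x) c c' := by
  induction p generalizing c d with
  | act a =>
    have hd : pull f (d.1, Function.extend f d.2 c.2) = d :=
      Prod.ext rfl (funext fun i => hf.extend_apply _ _ i)
    refine ⟨(d.1, Function.extend f d.2 c.2), hd, Act.rel_rename.2 ⟨?_, ?_, ?_⟩⟩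
    · rw [hd]
      exact h
    · intro j hj
      exact Function.extend_apply' _ _ _ hj
    · intro j
      by_cases hj : j ∈ Set.range f
      · obtain ⟨i, rfl⟩ := hj
        simpa only [hf.extend_apply] using h.2.2.1 i
      · simpa only [Function.extend_apply' _ _ _ hj] using hc.2 j
  | seq p q ihp ihq =>
    obtain ⟨e, h1, h2⟩ := h
    obtain ⟨c1, rfl, h3⟩ := ihp hc h1
    obtain ⟨c2, rfl, h4⟩ := ihq (hc.of_sem h3) h2
    exact ⟨c2, rfl, _, h3, h4⟩
  | alt p q ihp ihq =>
    rcases h with h | h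
    · obtain ⟨c1, rfl, h3⟩ := ihp hc h
      exact ⟨c1, rfl, .inl h3⟩
    · obtain ⟨c1, rfl, h3⟩ := ihq hc h
      exact ⟨c1, rfl, .inr h3⟩
  | star p ih =>
    induction h with
    | refl => exact ⟨c, rfl, .refl⟩
    | tail _ h1 h2 =>
      obtain ⟨c1, rfl, h3⟩ := h2
      have hc1 : Good x c1 := Good.of_sem (p := .star (p.rename f)) hc h3
      obtain ⟨c2, rfl, h4⟩ := ih hc1 h1
      exact ⟨c2, rfl, ReflTransGen.tail h3 h4⟩

/-- The action that guesses new register values with `new (dst j) = old (src j)` for all `j`. -/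
def Act.assign {J : Type} (src dst : J → R) : Act α R where
  mv := .stay
  guard := Set.univ
  cond := Set.range fun j => copyAtom (src j) (dst j)

lemma Act.rel_assign {J : Type} {src dst : J → R} {x : List α} {c c' : ℕ × (R → ℕ)}
    (hc : Good x c) : (Act.assign src dst).Rel x c c' ↔
      c'.1 = c.1 ∧ (∀ i, c'.2 i < bound x) ∧ ∀ j, c'.2 (dst j) = c.2 (src j) := by
  have h : min (Move.stay.shift c.1) (x.length + 1) = c.1 := min_eq_left hc.1
  simp [Act.assign, Act.Rel, h]

end Rename

/-! ### Predicates that are decided in nondeterministic logarithmic space -/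

/-- The predicate `P` on words and tuples of register values is decided by a program that keeps
these values and uses further registers `T`, whatever the initial values of `T` and the initial
position of the input head are. -/
def NLPred {α V : Type} (P : List α → (V → ℕ) → Prop) : Prop :=
  ∃ (T : Type) (_ : Finite T) (p : Prog (Act α (V ⊕ T))), ∀ x c, Good x c →
    ((∃ c', p.sem (Act.Rel x) c c') ↔ P x (c.2 ∘ .inl)) ∧
    ∀ c', p.sem (Act.Rel x) c c' → ∀ i, c'.2 (.inl i) = c.2 (.inl i)

namespace NLPred

variable {α V W U : Type}

lemma embed {P : List α → (V → ℕ) → Prop} (hP : NLPred P) : ∃ (T : Type) (_ : Finite T),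
    ∀ (R : Type) (g : V ⊕ T → R), g.Injective → ∃ p : Prog (Act α R), ∀ x c, Good x c →
      ((∃ c', p.sem (Act.Rel x) c c') ↔ P x (c.2 ∘ g ∘ .inl)) ∧
      ∀ c', p.sem (Act.Rel x) c c' → ∀ j, (∀ t, j ≠ g (.inr t)) → c'.2 j = c.2 j := by
  obtain ⟨T, hT, p, hp⟩ := hP
  refine ⟨T, hT, fun R g hg => ⟨p.rename g, fun x c hc => ⟨?_, fun c' h j hj => ?_⟩⟩⟩
  · refine Iff.trans ?_ (hp x (pull g c) (hc.pull g)).1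
    constructor
    · rintro ⟨c', h⟩
      exact ⟨_, (Prog.sem_of_rename h).1⟩
    · rintro ⟨d, h⟩
      obtain ⟨c', -, h'⟩ := Prog.exists_sem_rename hg hc h
      exact ⟨c', h'⟩
  · obtain ⟨h1, h2⟩ := Prog.sem_of_rename h
    by_cases hj' : j ∈ Set.range g
    · obtain ⟨i | t, rfl⟩ := hj'
      · exact (hp x (pull g c) (hc.pull g)).2 _ h1 i
      · exact absurd rfl (hj t)
    · exact h2 j hj'

/-- Only register values below the bound matter. -/
lemma congr {P Q : List α → (V → ℕ) → Prop} (hP : NLPred P)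
    (h : ∀ x v, (∀ i, v i < bound x) → (P x v ↔ Q x v)) : NLPred Q := by
  obtain ⟨T, hT, p, hp⟩ := hP
  exact ⟨T, hT, p, fun x c hc => ⟨(hp x c hc).1.trans (h x _ fun i => hc.2 _), (hp x c hc).2⟩⟩

lemma and {P Q : List α → (V → ℕ) → Prop} (hP : NLPred P) (hQ : NLPred Q) :
    NLPred fun x v => P x v ∧ Q x v := by
  obtain ⟨T, _, hP⟩ := hP.embed
  obtain ⟨T', _, hQ⟩ := hQ.embed
  obtain ⟨p, hp⟩ := hP (V ⊕ (T ⊕ T')) (Sum.map id .inl)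
    (Sum.map_injective.2 ⟨Function.injective_id, Sum.inl_injective⟩)
  obtain ⟨q, hq⟩ := hQ (V ⊕ (T ⊕ T')) (Sum.map id .inr)
    (Sum.map_injective.2 ⟨Function.injective_id, Sum.inr_injective⟩)
  refine ⟨T ⊕ T', inferInstance, .seq p q, fun x c hc => ?_⟩
  have hv : ∀ d, p.sem (Act.Rel x) c d → ∀ i : V, d.2 (.inl i) = c.2 (.inl i) := fun d hd i =>
    (hp x c hc).2 d hd _ (by simp)
  have hQv : ∀ d, p.sem (Act.Rel x) c d → ((∃ c', q.sem (Act.Rel x) d c') ↔ Q x (c.2 ∘ .inl)) := by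
    intro d hd
    rw [(hq x d (hc.of_sem hd)).1]
    have : d.2 ∘ Sum.map id Sum.inr ∘ Sum.inl = c.2 ∘ Sum.inl := funext fun i => hv d hd i
    rw [this]
  refine ⟨⟨?_, ?_⟩, ?_⟩
  · rintro ⟨c', d, h1, h2⟩
    exact ⟨(hp x c hc).1.1 ⟨d, h1⟩, (hQv d h1).1 ⟨c', h2⟩⟩
  · rintro ⟨h1, h2⟩
    obtain ⟨d, h1⟩ := (hp x c hc).1.2 h1
    obtain ⟨c', h2⟩ := (hQv d h1).2 h2
    exact ⟨c', d, h1, h2⟩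
  · rintro c' ⟨d, h1, h2⟩ i
    exact ((hq x d (hc.of_sem h1)).2 c' h2 _ (by simp)).trans (hv d h1 i)

lemma or {P Q : List α → (V → ℕ) → Prop} (hP : NLPred P) (hQ : NLPred Q) :
    NLPred fun x v => P x v ∨ Q x v := by
  obtain ⟨T, _, hP⟩ := hP.embed
  obtain ⟨T', _, hQ⟩ := hQ.embed
  obtain ⟨p, hp⟩ := hP (V ⊕ (T ⊕ T')) (Sum.map id .inl)
    (Sum.map_injective.2 ⟨Function.injective_id, Sum.inl_injective⟩)
  obtain ⟨q, hq⟩ := hQ (V ⊕ (T ⊕ T')) (Sum.map id .inr)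
    (Sum.map_injective.2 ⟨Function.injective_id, Sum.inr_injective⟩)
  refine ⟨T ⊕ T', inferInstance, .alt p q, fun x c hc => ⟨?_, ?_⟩⟩
  · refine (exists_or.trans (or_congr ?_ ?_) :)
    · exact (hp x c hc).1
    · exact (hq x c hc).1
  · rintro c' (h | h) i
    · exact (hp x c hc).2 c' h _ (by simp)
    · exact (hq x c hc).2 c' h _ (by simp)

/-- Substitution of variables. The values are copied to fresh registers, because `f` may identify
variables. -/
lemma comp [Finite W] {P : List α → (W → ℕ) → Prop} (hP : NLPred P) (f : W → V) :
    NLPred fun x (v : V → ℕ) => P x (v ∘ f) := by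
  obtain ⟨T, _, hP⟩ := hP.embed
  obtain ⟨p, hp⟩ := hP (V ⊕ (W ⊕ T)) .inr Sum.inr_injective
  refine ⟨W ⊕ T, inferInstance, .seq (.act (.assign
    (Sum.elim .inl fun w => .inl (f w)) (Sum.elim .inl fun w => .inr (.inl w)))) p,
    fun x c hc => ?_⟩
  have hd : ∀ d, (Act.assign (Sum.elim .inl fun w => .inl (f w))
      (Sum.elim .inl fun w => .inr (.inl w)) : Act α (V ⊕ (W ⊕ T))).Rel x c d →
      Good x d ∧ (∀ i, d.2 (.inl i) = c.2 (.inl i)) ∧ d.2 ∘ Sum.inr ∘ Sum.inl =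
        (c.2 ∘ .inl) ∘ f := by
    intro d h
    obtain ⟨h1, h2, h3⟩ := (Act.rel_assign hc).1 h
    exact ⟨⟨h1 ▸ hc.1, h2⟩, fun i => h3 (.inl i), funext fun w => h3 (.inr w)⟩
  refine ⟨⟨?_, fun h => ?_⟩, ?_⟩
  · rintro ⟨c', d, h1, h2⟩
    obtain ⟨hg, -, h3⟩ := hd d h1
    rw [← h3]
    exact (hp x d hg).1.1 ⟨c', h2⟩
  · let d : ℕ × (V ⊕ (W ⊕ T) → ℕ) := (c.1, Sum.elim (c.2 ∘ .inl)
      (Sum.elim (fun w => c.2 (.inl (f w)))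
      fun t => c.2 (.inr (.inr t))))
    have h1 := (Act.rel_assign (c' := d) (src := Sum.elim .inl fun w => .inl (f w))
      (dst := Sum.elim .inl fun w => .inr (.inl w)) hc).2 ⟨rfl, ?_, ?_⟩
    · obtain ⟨hg, -, h3⟩ := hd d h1
      change P x _ at h
      rw [← h3] at h
      obtain ⟨c', h⟩ := (hp x d hg).1.2 h
      exact ⟨c', d, h1, h⟩
    · rintro (i | w | t)
      exacts [hc.2 _, hc.2 _, hc.2 _]
    · rintro (i | w) <;> rfl
  · rintro c' ⟨d, h1, h2⟩ i
    obtain ⟨hg, h3, -⟩ := hd d h1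
    exact ((hp x d hg).2 c' h2 _ (by simp)).trans (h3 i)

/-- Bounded existential quantification over tuples: the values are guessed. -/
lemma exTuple [Finite U] {P : List α → (V → ℕ) → (U → ℕ) → Prop}
    (hP : NLPred fun x (v : V ⊕ U → ℕ) => P x (fun i => v (.inl i)) (fun i => v (.inr i))) :
    NLPred fun x (v : V → ℕ) => ∃ s : U → ℕ, (∀ i, s i < bound x) ∧ P x v s := by
  obtain ⟨T, _, hP⟩ := hP.embed
  obtain ⟨p, hp⟩ := hP (V ⊕ (U ⊕ T)) (Equiv.sumAssoc _ _ _) (Equiv.injective _)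
  refine ⟨U ⊕ T, inferInstance, .seq (.act (.assign Sum.inl Sum.inl)) p, fun x c hc => ?_⟩
  have hd : ∀ d, (Act.assign Sum.inl Sum.inl : Act α (V ⊕ (U ⊕ T))).Rel x c d →
      Good x d ∧ (∀ i, d.2 (.inl i) = c.2 (.inl i)) := by
    intro d h
    obtain ⟨h1, h2, h3⟩ := (Act.rel_assign hc).1 h
    exact ⟨⟨h1 ▸ hc.1, h2⟩, h3⟩
  refine ⟨⟨?_, ?_⟩, ?_⟩
  · rintro ⟨c', d, h1, h2⟩
    obtain ⟨hg, h3⟩ := hd d h1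
    have h4 := (hp x d hg).1.1 ⟨c', h2⟩
    refine ⟨fun i => d.2 (.inr (.inl i)), fun i => hg.2 _, ?_⟩
    have : c.2 ∘ Sum.inl = fun i => d.2 (.inl i) := funext fun i => (h3 i).symm
    rw [this]
    exact h4
  · rintro ⟨s, hs, h⟩
    let d : ℕ × (V ⊕ (U ⊕ T) → ℕ) :=
      (c.1, Sum.elim (c.2 ∘ .inl) (Sum.elim s fun t => c.2 (.inr (.inr t))))
    have h1 : (Act.assign Sum.inl Sum.inl : Act α (V ⊕ (U ⊕ T))).Rel x c d := by
      refine (Act.rel_assign hc).2 ⟨rfl, ?_, fun i => rfl⟩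
      rintro (i | i | t)
      exacts [hc.2 _, hs i, hc.2 _]
    obtain ⟨c', h⟩ := (hp x d (hd d h1).1).1.2 h
    exact ⟨c', d, h1, h⟩
  · rintro c' ⟨d, h1, h2⟩ i
    obtain ⟨hg, h3⟩ := hd d h1
    exact ((hp x d hg).2 c' h2 _ (by simp)).trans (h3 i)

/-- Bounded existential quantification. -/
lemma ex [Finite V] {P : List α → (V → ℕ) → ℕ → Prop}
    (hP : NLPred fun x (v : Option V → ℕ) => P x (fun i => v (some i)) (v none)) :
    NLPred fun x (v : V → ℕ) => ∃ a < bound x, P x v a := by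
  refine (exTuple (U := Unit) (P := fun x v s => P x v (s ()))
    (hP.comp fun o : Option V => (o.elim (.inr ()) .inl : V ⊕ Unit))).congr fun x v _ => ⟨?_, ?_⟩
  · rintro ⟨s, hs, h⟩
    exact ⟨s (), hs (), h⟩
  · rintro ⟨a, ha, h⟩
    exact ⟨fun _ => a, fun _ => ha, h⟩

/-- Reachability by steps that are decided in nondeterministic logarithmic space: the current tuple
is kept in registers, and the next one is guessed. -/
lemma reach [Finite U] {P : List α → (V → ℕ) → (U → ℕ) → (U → ℕ) → Prop}
    (hP : NLPred fun x (v : V ⊕ (U ⊕ U) → ℕ) =>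
      P x (fun i => v (.inl i)) (fun i => v (.inr (.inl i))) (fun i => v (.inr (.inr i))))
    (f g : U → V) : NLPred fun x (v : V → ℕ) => ReflTransGen
      (fun s s' => (∀ i, s' i < bound x) ∧ P x v s s') (fun i => v (f i)) (fun i => v (g i)) := by
  obtain ⟨T, _, hP⟩ := hP.embed
  obtain ⟨p, hp⟩ := hP (V ⊕ ((U ⊕ U) ⊕ T)) (Equiv.sumAssoc _ _ _) (Equiv.injective _)
  let cur : U → V ⊕ ((U ⊕ U) ⊕ T) := fun u => .inr (.inl (.inl u))
  let nxt : U → V ⊕ ((U ⊕ U) ⊕ T) := fun u => .inr (.inl (.inr u))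
  let enter : Act α (V ⊕ ((U ⊕ U) ⊕ T)) :=
    .assign (Sum.elim .inl fun u => .inl (f u)) (Sum.elim .inl cur)
  let guess : Act α (V ⊕ ((U ⊕ U) ⊕ T)) := .assign (Sum.elim .inl cur) (Sum.elim .inl cur)
  let move : Act α (V ⊕ ((U ⊕ U) ⊕ T)) := .assign (Sum.elim .inl nxt) (Sum.elim .inl cur)
  -- two copies to the same register compare the copied values
  let leave : Act α (V ⊕ ((U ⊕ U) ⊕ T)) :=
    .assign (Sum.elim .inl (Sum.elim cur fun u => .inl (g u))) (Sum.elim .inl (Sum.elim cur cur))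
  let body : Prog (Act α (V ⊕ ((U ⊕ U) ⊕ T))) := .seq (.act guess) (.seq p (.act move))
  have body_sound : ∀ x c c', Good x c → body.sem (Act.Rel x) c c' →
      (∀ i, c'.2 (.inl i) = c.2 (.inl i)) ∧ (∀ i, c'.2 (cur i) < bound x) ∧
      P x (fun i => c.2 (.inl i)) (fun i => c.2 (cur i)) fun i => c'.2 (cur i) := by
    rintro x c c' hc ⟨d, h1, e, h2, h3⟩
    have hd : Good x d := hc.of_sem (p := .act guess) h1
    have he : Good x e := hd.of_sem h2
    obtain ⟨-, -, k1⟩ := (Act.rel_assign hc).1 h1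
    obtain ⟨-, k2, k3⟩ := (Act.rel_assign he).1 h3
    have k4 := (hp x d hd).1.1 ⟨e, h2⟩
    have k5 := (hp x d hd).2 e h2
    refine ⟨fun i => ?_, fun i => k2 _, ?_⟩
    · exact (k3 (.inl i)).trans ((k5 _ (by simp)).trans (k1 (.inl i)))
    · have e1 : ∀ i, c.2 (.inl i) = d.2 (.inl i) := fun i => (k1 (.inl i)).symm
      have e2 : ∀ i, c.2 (cur i) = d.2 (cur i) := fun i => (k1 (.inr i)).symm
      have e3 : ∀ i, c'.2 (cur i) = d.2 (nxt i) := fun i =>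
        (k3 (.inr i)).trans (k5 _ (by simp [nxt]))
      simp only [e1, e2, e3]
      exact k4
  have body_complete : ∀ x c (s' : U → ℕ), Good x c → (∀ i, s' i < bound x) →
      P x (fun i => c.2 (.inl i)) (fun i => c.2 (cur i)) s' →
      ∃ c', body.sem (Act.Rel x) c c' ∧ ∀ i, c'.2 (cur i) = s' i := by
    intro x c s' hc hs h
    let d : ℕ × (V ⊕ ((U ⊕ U) ⊕ T) → ℕ) := (c.1, Sum.elim (fun i => c.2 (.inl i))
      (Sum.elim (Sum.elim (fun i => c.2 (cur i)) s') fun t => c.2 (.inr (.inr t))))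
    have h1 : guess.Rel x c d := by
      refine (Act.rel_assign hc).2 ⟨rfl, ?_, ?_⟩
      · rintro (i | (i | i) | t)
        exacts [hc.2 _, hc.2 _, hs i, hc.2 _]
      · rintro (i | i) <;> rfl
    have hd : Good x d := hc.of_sem (p := .act guess) h1
    obtain ⟨e, h2⟩ := (hp x d hd).1.2 h
    have he : Good x e := hd.of_sem h2
    have k5 := (hp x d hd).2 e h2
    refine ⟨(e.1, Sum.elim (fun i => e.2 (.inl i)) (Sum.elim (Sum.elim (fun i => e.2 (nxt i))
      fun i => e.2 (nxt i)) fun t => e.2 (.inr (.inr t)))), ⟨d, h1, e, h2, ?_⟩, fun i => ?_⟩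
    · refine (Act.rel_assign he).2 ⟨rfl, ?_, ?_⟩
      · rintro (i | (i | i) | t)
        exacts [he.2 _, he.2 _, he.2 _, he.2 _]
      · rintro (i | i) <;> rfl
    · exact k5 (nxt i) (by simp [nxt])
  refine ⟨(U ⊕ U) ⊕ T, inferInstance, .seq (.act enter) (.seq (.star body) (.act leave)),
    fun x c hc => ?_⟩
  have loop : ∀ d e, Good x d → ReflTransGen (body.sem (Act.Rel x)) d e →
      Good x e ∧ (∀ i, e.2 (.inl i) = d.2 (.inl i)) ∧ ReflTransGen (fun s s' =>
        (∀ i, s' i < bound x) ∧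
        P x (fun i => d.2 (.inl i)) s s') (fun i => d.2 (cur i)) (fun i => e.2 (cur i)) := by
    intro d e hd h
    induction h with
    | refl => exact ⟨hd, fun _ => rfl, .refl⟩
    | tail _ h1 h2 =>
      obtain ⟨g1, g2, g3⟩ := h2
      obtain ⟨k1, k2, k3⟩ := body_sound _ _ _ g1 h1
      refine ⟨g1.of_sem h1, fun i => (k1 i).trans (g2 i), g3.tail ⟨k2, ?_⟩⟩
      simpa only [g2] using k3
  refine ⟨⟨?_, fun h => ?_⟩, ?_⟩
  · rintro ⟨c', d, h1, e, h2, h3⟩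
    have hd : Good x d := hc.of_sem (p := .act enter) h1
    obtain ⟨he, l1, l2⟩ := loop d e hd h2
    obtain ⟨-, -, k1⟩ := (Act.rel_assign hc).1 h1
    obtain ⟨-, -, k3⟩ := (Act.rel_assign he).1 h3
    have e1 : ∀ i, d.2 (.inl i) = c.2 (.inl i) := fun i => k1 (.inl i)
    have e2 : ∀ i, d.2 (cur i) = c.2 (.inl (f i)) := fun i => k1 (.inr i)
    have e3 : ∀ i, e.2 (cur i) = c.2 (.inl (g i)) := fun i =>
      (k3 (.inr (.inl i))).symm.trans ((k3 (.inr (.inr i))).trans ((l1 _).trans (e1 _)))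
    simp only [e1, e2, e3] at l2
    exact l2
  · let d : ℕ × (V ⊕ ((U ⊕ U) ⊕ T) → ℕ) := (c.1, Sum.elim (fun i => c.2 (.inl i))
      (Sum.elim (Sum.elim (fun i => c.2 (.inl (f i))) fun i => c.2 (cur i))
        fun t => c.2 (.inr (.inr t))))
    have h1 : enter.Rel x c d := by
      refine (Act.rel_assign hc).2 ⟨rfl, ?_, ?_⟩
      · rintro (i | (i | i) | t)
        exacts [hc.2 _, hc.2 _, hc.2 _, hc.2 _]
      · rintro (i | i) <;> rfl
    have hd : Good x d := hc.of_sem (p := .act enter) h1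
    suffices H : ∀ s', ReflTransGen (fun s s' => (∀ i, s' i < bound x) ∧
        P x (c.2 ∘ .inl) s s') (fun i => (c.2 ∘ .inl) (f i)) s' →
        ∃ e, ReflTransGen (body.sem (Act.Rel x)) d e ∧ ∀ i, e.2 (cur i) = s' i by
      obtain ⟨e, h2, h3⟩ := H _ h
      obtain ⟨he, l1, -⟩ := loop d e hd h2
      refine ⟨e, d, h1, e, h2, (Act.rel_assign he).2 ⟨rfl, he.2, ?_⟩⟩
      rintro (i | i | i)
      · rfl
      · rfl
      · exact (h3 i).trans (l1 (g i)).symm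
    intro s' hs
    induction hs with
    | refl => exact ⟨d, .refl, fun i => rfl⟩
    | tail _ hs ih =>
      obtain ⟨e, h2, h3⟩ := ih
      obtain ⟨he, l1, -⟩ := loop d e hd h2
      obtain ⟨e', h4, h5⟩ := body_complete x e _ he hs.1 (by
        simp only [h3, l1]
        exact hs.2)
      exact ⟨e', h2.tail h4, h5⟩
  · rintro c' ⟨d, h1, e, h2, h3⟩ i
    have hd : Good x d := hc.of_sem (p := .act enter) h1
    obtain ⟨he, l1, -⟩ := loop d e hd h2
    obtain ⟨-, -, k1⟩ := (Act.rel_assign hc).1 h1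
    obtain ⟨-, -, k3⟩ := (Act.rel_assign he).1 h3
    exact (k3 (.inl i)).trans ((l1 i).trans (k1 (.inl i)))

/-- The value of a variable, or `0` for `none`. -/
def val (v : V → ℕ) (y : Option V) : ℕ := y.elim 0 v

lemma linear (y₁ y₂ y₃ : Option V) (b : Bool) :
    NLPred fun (_ : List α) v => val v y₁ + val v y₂ + b.toNat = val v y₃ := by
  have hval : ∀ (r r' : V ⊕ Empty → ℕ) (y : Option V),
      termVal r r' (y.map fun i => .inl (.inl i)) = val (r ∘ .inl) y := by
    rintro r r' (_ | i) <;> rfl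
  refine ⟨Empty, inferInstance, .act ⟨.stay, Set.univ, insert (y₁.map fun i => .inl (.inl i),
    y₂.map fun i => .inl (.inl i), y₃.map fun i => .inl (.inl i), b)
      (Set.range fun i => copyAtom i i)⟩, fun x c hc => ?_⟩
  simp only [Prog.sem, Act.Rel, Set.mem_univ, true_and, Set.forall_mem_insert,
    Set.forall_mem_range, Atom.Holds, hval]
  refine ⟨⟨fun ⟨_, _, _, h, _⟩ => h, fun h => ⟨c, (min_eq_left hc.1).symm, hc.2, h, fun _ => rfl⟩⟩,
    fun c' ⟨_, _, _, h⟩ i => copyAtom_holds.1 (h _)⟩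

/-- The input cell of a given letter is found by counting from the left end marker. -/
lemma cell (i : V) (G : Set (Cell α)) :
    NLPred fun x v => v i ≤ x.length ∧ inputCell x (v i + 1) ∈ G := by
  let keep : Set (Atom (V ⊕ Unit)) := Set.range fun i => copyAtom (.inl i) (.inl i)
  let cnt : V ⊕ Unit := .inr ()
  let goLeft : Act α (V ⊕ Unit) := ⟨.left, Set.univ, keep⟩
  let reset : Act α (V ⊕ Unit) :=
    ⟨.stay, {.leftEnd}, insert (none, none, some (.inr cnt), false) keep⟩
  let goRight : Act α (V ⊕ Unit) :=
    ⟨.right, {.rightEnd}ᶜ, insert (some (.inl cnt), none, some (.inr cnt), true) keep⟩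
  let test : Act α (V ⊕ Unit) :=
    ⟨.stay, G, insert (some (.inl (.inl i)), none, some (.inl cnt), true) keep⟩
  refine ⟨Unit, inferInstance, .seq (.star (.act goLeft)) (.seq (.act reset) (.seq
    (.star (.act goRight)) (.act test))), fun x c hc => ?_⟩
  have sound : ∀ c', (Prog.seq (.star (.act goLeft)) (.seq (.act reset) (.seq
      (.star (.act goRight)) (.act test)))).sem (Act.Rel x) c c' →
      (c.2 (.inl i) ≤ x.length ∧ inputCell x (c.2 (.inl i) + 1) ∈ G) ∧
      ∀ i, c'.2 (.inl i) = c.2 (.inl i) := by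
    rintro c' ⟨c1, h1, c2, h2, c3, h3, h4⟩
    have k1 : ∀ i, c1.2 (.inl i) = c.2 (.inl i) := by
      intro i
      clear h2
      induction h1 with
      | refl => rfl
      | tail _ hs ih => exact (copyAtom_holds.1 (hs.2.2.2 _ ⟨i, rfl⟩)).trans ih
    have hg1 : Good x c1 := Good.of_sem (p := .star (.act goLeft)) hc h1
    have k2 : ∀ i, c2.2 (.inl i) = c1.2 (.inl i) := fun i =>
      copyAtom_holds.1 (h2.2.2.2 _ (.inr ⟨i, rfl⟩))
    have hc1 : c1.1 = 0 := by
      have : inputCell x c1.1 = .leftEnd := h2.1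
      rcases hh : c1.1 with _ | n
      · rfl
      · rw [hh] at this
        rcases hn : x[n]? with _ | a <;> simp [inputCell, hn] at this
    have hc2 : c2.1 = c2.2 cnt := by
      have e1 : c2.1 = _ := h2.2.1
      have e2 : (0 : ℕ) + 0 + 0 = c2.2 cnt := h2.2.2.2 _ (.inl rfl)
      rw [e1, hc1, ← e2]
      simp [reset, Move.shift]
    have k3 : (∀ i, c3.2 (.inl i) = c2.2 (.inl i)) ∧ c3.1 = c3.2 cnt ∧ c3.1 ≤ x.length + 1 := by
      have hg2 : c2.1 ≤ x.length + 1 := by rw [h2.2.1]; exact min_le_right _ _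
      clear h4
      induction h3 with
      | refl => exact ⟨fun _ => rfl, hc2, hg2⟩
      | tail _ hs ih =>
        obtain ⟨i1, i2, i3⟩ := ih
        refine ⟨fun i => (copyAtom_holds.1 (hs.2.2.2 _ (.inr ⟨i, rfl⟩))).trans (i1 i), ?_, ?_⟩
        · have e1 := hs.2.1
          have e2 := hs.2.2.2 _ (.inl rfl)
          simp only [Atom.Holds, termVal, Bool.toNat_true, add_zero] at e2
          have e3 := mt (inputCell_rightEnd_iff x _).2 hs.1
          rw [← e2, ← i2, e1, min_eq_left]
          · rfl
          · simp only [goRight, Move.shift]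
            omega
        · rw [hs.2.1]
          exact min_le_right _ _
    obtain ⟨k3, k4, k5⟩ := k3
    have e2 := h4.2.2.2 _ (.inl rfl)
    simp only [Atom.Holds, termVal, Bool.toNat_true, add_zero] at e2
    rw [k3, k2, k1, ← k4] at e2
    refine ⟨⟨by omega, ?_⟩, fun i => ?_⟩
    · rw [e2]
      exact h4.1
    · rw [copyAtom_holds.1 (h4.2.2.2 _ (.inr ⟨i, rfl⟩)), k3, k2, k1]
  refine ⟨⟨fun ⟨c', h⟩ => (sound c' h).1, ?_⟩, fun c' h => (sound c' h).2⟩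
  rintro ⟨hle, hG⟩
  have hB := length_lt_bound x
  let st : ℕ → ℕ → ℕ × (V ⊕ Unit → ℕ) := fun h n => (h, Sum.elim (fun i => c.2 (.inl i)) fun _ => n)
  have hst : ∀ h n, n < bound x → ∀ i, (st h n).2 i < bound x := by
    rintro h n hn (i | i)
    exacts [hc.2 _, hn]
  have hkeep : ∀ h n h' n', ∀ t ∈ keep, t.Holds (st h n).2 (st h' n').2 := by
    rintro h n h' n' _ ⟨i, rfl⟩
    exact copyAtom_holds.2 rfl
  have p1 : ∀ h ≤ x.length + 1, ReflTransGen (goLeft.Rel x) (st h (c.2 cnt)) (st 0 (c.2 cnt)) := by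
    intro h
    induction h with
    | zero => exact fun _ => .refl
    | succ n ih =>
      intro hn
      exact .head ⟨trivial, (min_eq_left (by simp [st]; omega)).symm,
        hst _ _ (hc.2 _), hkeep _ _ _ _⟩ (ih (by omega))
  have p3 : ∀ h ≤ x.length + 1, ReflTransGen (goRight.Rel x) (st 0 0) (st h h) := by
    intro h
    induction h with
    | zero => exact fun _ => .refl
    | succ n ih =>
      intro hn
      refine (ih (by omega)).tail ⟨?_, (min_eq_left hn).symm, hst _ _ (by omega), ?_⟩
      · exact mt (inputCell_rightEnd_iff x n).1 (by omega)
      · rintro _ (rfl | ht)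
        · simp [Atom.Holds, termVal, st, cnt]
        · exact hkeep _ _ _ _ _ ht
  have hcst : c = st c.1 (c.2 cnt) := by
    refine Prod.ext rfl (funext ?_)
    rintro (i | i) <;> rfl
  refine ⟨st (c.2 (.inl i) + 1) (c.2 (.inl i) + 1), st 0 (c.2 cnt), ?_, st 0 0, ?_,
    st (c.2 (.inl i) + 1) (c.2 (.inl i) + 1), p3 _ (by simpa using hle), ?_⟩
  · have := p1 c.1 hc.1
    rwa [← hcst] at this
  · refine ⟨rfl, by simp [reset, Move.shift, st], hst _ _ (by omega), ?_⟩
    rintro _ (rfl | ht)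
    · simp [Atom.Holds, termVal, st, cnt]
    · exact hkeep _ _ _ _ _ ht
  · refine ⟨hG, (min_eq_left (by simpa [Move.shift, test, st] using hle)).symm,
      hst _ _ (by simp only [Function.comp] at hle; omega), ?_⟩
    rintro _ (rfl | ht)
    · simp [Atom.Holds, termVal, st, cnt]
    · exact hkeep _ _ _ _ _ ht

end NLPred

open NLPred in
/-- A language whose membership predicate is decided in nondeterministic logarithmic space is in
`NL`. -/
theorem mem_NL_of_nlPred {α : Type} [Finite α] {L : Language α}
    (hP : NLPred fun (x : List α) (_ : Empty → ℕ) => x ∈ L) : L ∈ NL α := by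
  obtain ⟨T, _, hP⟩ := hP.embed
  obtain ⟨p, hp⟩ := hP (Option (Empty ⊕ T)) some (Option.some_injective _)
  refine mem_NL_of_prog L p fun x => ?_
  exact (hp x (startCfg _ x) ⟨le_rfl, fun _ => length_lt_bound x⟩).1.symm

end OffLine

namespace StackUp

open Relation

/-! ### Open pallets along a run of the procedure -/

section Counting

variable {k : ℕ} {Q : Sequences k} {p : ℕ}

lemma mem_plts {Q : Sequences k} {t : ℕ+} : t ∈ plts Q ↔ ∃ i, t ∈ Q i := by
  simp [plts]

/-- The terminal segments that remain when the first `pos j` bins of each `q_j` are removed. -/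
def remaining (Q : Sequences k) (pos : Fin k → ℕ) : Sequences k := fun i => (Q i).drop (pos i)

/-- The initial segments of `pos j` bins. -/
def front (Q : Sequences k) (pos : Fin k → ℕ) : Sequences k := fun i => (Q i).take (pos i)

lemma removed_remaining {pos : Fin k → ℕ} (h : ∀ i, pos i ≤ (Q i).length) :
    removed Q (remaining Q pos) = front Q pos := by
  funext i
  have := h i
  simp only [removed, remaining, front, List.length_drop]
  congr 1
  omega

lemma openPallets_remaining {pos : Fin k → ℕ} (h : ∀ i, pos i ≤ (Q i).length) :
    openPallets Q (remaining Q pos) = plts (remaining Q pos) ∩ plts (front Q pos) := by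
  rw [openPallets, removed_remaining h]

lemma drop_eq_cons {q : List ℕ+} {n : ℕ} {t : ℕ+} (h : q[n]? = some t) :
    q.drop n = t :: q.drop (n + 1) := by
  obtain ⟨hn, rfl⟩ := List.getElem?_eq_some_iff.1 h
  exact List.drop_eq_getElem_cons hn

lemma plts_remaining_of_step {pos : Fin k → ℕ} {i : Fin k} {t : ℕ+} (h : (Q i)[pos i]? = some t) :
    plts (remaining Q pos) =
      insert t (plts (remaining Q (Function.update pos i (pos i + 1)))) := by
  ext u
  simp only [mem_plts, Finset.mem_insert, remaining]
  constructor
  · rintro ⟨j, hj⟩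
    rcases eq_or_ne j i with rfl | hne
    · rw [drop_eq_cons h, List.mem_cons] at hj
      exact hj.imp id fun hj => ⟨j, by simpa using hj⟩
    · exact .inr ⟨j, by simpa [hne] using hj⟩
  · rintro (rfl | ⟨j, hj⟩)
    · exact ⟨i, by simp [drop_eq_cons h]⟩
    · rcases eq_or_ne j i with rfl | hne
      · rw [Function.update_self] at hj
        exact ⟨j, by simp [drop_eq_cons h, hj]⟩
      · exact ⟨j, by simpa [hne] using hj⟩

lemma plts_front_of_step {pos : Fin k → ℕ} {i : Fin k} {t : ℕ+} (h : (Q i)[pos i]? = some t) :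
    plts (front Q (Function.update pos i (pos i + 1))) = insert t (plts (front Q pos)) := by
  have h' : (Q i).take (pos i + 1) = (Q i).take (pos i) ++ [t] := by
    rw [List.take_add_one, h]
    rfl
  ext u
  simp only [mem_plts, Finset.mem_insert, front]
  constructor
  · rintro ⟨j, hj⟩
    rcases eq_or_ne j i with rfl | hne
    · rw [Function.update_self, h', List.mem_append, List.mem_singleton] at hj
      exact hj.symm.imp id fun hj => ⟨j, hj⟩
    · exact .inr ⟨j, by simpa [hne] using hj⟩
  · rintro (rfl | ⟨j, hj⟩)
    · exact ⟨i, by simp [h']⟩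
    · rcases eq_or_ne j i with rfl | hne
      · exact ⟨j, by simp [h', hj]⟩
      · exact ⟨j, by simpa [hne] using hj⟩

lemma update_le_length {pos : Fin k → ℕ} (hpos : ∀ i, pos i ≤ (Q i).length) {i : Fin k} {t : ℕ+}
    (h : (Q i)[pos i]? = some t) (j : Fin k) :
    Function.update pos i (pos i + 1) j ≤ (Q j).length := by
  rcases eq_or_ne j i with rfl | hne
  · simpa using (List.getElem?_eq_some_iff.1 h).1
  · simpa [hne] using hpos j

lemma opened_eq {c : Counters k} (hpos : ∀ i, c.pos i ≤ (Q i).length)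
    (hopn : c.opn = (openPallets Q (remaining Q c.pos)).card) {i : Fin k} {t : ℕ+}
    (h : (Q i)[c.pos i]? = some t) :
    c.opened Q t = (insert t (openPallets Q (remaining Q c.pos))).card := by
  classical
  have ht : t ∈ plts (remaining Q c.pos) := by
    rw [plts_remaining_of_step h]
    exact Finset.mem_insert_self _ _
  have hnot : (∀ j, t ∉ (Q j).take (c.pos j)) ↔ t ∉ openPallets Q (remaining Q c.pos) := by
    rw [openPallets_remaining hpos, Finset.mem_inter, mem_plts (Q := front Q c.pos)]
    simp [ht, front]
  rw [Counters.opened]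
  split_ifs with hnew
  · rw [Finset.card_insert_of_notMem (hnot.1 hnew), hopn]
  · rw [Finset.insert_eq_self.2 (not_not.1 (mt hnot.2 hnew)), hopn]

lemma openPallets_of_step {pos : Fin k → ℕ} (hpos : ∀ i, pos i ≤ (Q i).length) {i : Fin k} {t : ℕ+}
    (h : (Q i)[pos i]? = some t) :
    openPallets Q (remaining Q (Function.update pos i (pos i + 1))) =
      if ∀ j, t ∉ (Q j).drop (Function.update pos i (pos i + 1) j) then
        (insert t (openPallets Q (remaining Q pos))).erase t
      else insert t (openPallets Q (remaining Q pos)) := by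
  rw [openPallets_remaining hpos, openPallets_remaining (update_le_length hpos h),
    plts_front_of_step h, plts_remaining_of_step h]
  have hmem : (∀ j, t ∉ (Q j).drop (Function.update pos i (pos i + 1) j)) ↔
      t ∉ plts (remaining Q (Function.update pos i (pos i + 1))) := by
    simp [mem_plts, remaining]
  split_ifs with hlast
  · ext u
    have := hmem.1 hlast
    by_cases hu : u = t
    · subst hu; simp [this]
    · simp [hu]
  · have := not_not.1 (mt hmem.2 hlast)
    ext u
    by_cases hu : u = t
    · subst hu; simp [this]
    · simp [hu]

/-- The properties of the counters that every step preserves. -/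
def Counters.Correct (Q : Sequences k) (c : Counters k) : Prop :=
  (∀ i, c.pos i ≤ (Q i).length) ∧ c.opn = (openPallets Q (remaining Q c.pos)).card

lemma Counters.Correct.zero : (Counters.zero k).Correct Q := by
  refine ⟨fun i => Nat.zero_le _, ?_⟩
  have h0 : ∀ i, (Counters.zero k).pos i ≤ (Q i).length := fun i => Nat.zero_le _
  rw [openPallets_remaining h0]
  have : plts (front Q (Counters.zero k).pos) = ∅ := by
    ext; simp [mem_plts, front, Counters.zero]
  rw [this, Finset.inter_empty, Finset.card_empty]
  rfl

lemma Counters.Correct.step {c c' : Counters k} (hc : c.Correct Q) (h : Counters.Step Q p c c') :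
    c'.Correct Q := by
  obtain ⟨i, t, ht, hpos, -, hopn⟩ := h
  refine ⟨fun j => hpos ▸ update_le_length hc.1 ht j, ?_⟩
  rw [hopn, opened_eq hc.1 hc.2 ht, hpos, openPallets_of_step hc.1 ht]
  split_ifs with h
  · rw [Finset.card_erase_of_mem (Finset.mem_insert_self _ _)]
  · rfl

lemma Counters.Correct.of_reachable {c : Counters k} (h : c.Reachable Q p) : c.Correct Q := by
  induction h with
  | refl => exact .zero
  | tail _ hs ih => exact ih.step hs

lemma card_openPallets_le (Q Q' : Sequences k) : (openPallets Q Q').card ≤ numBins Q' := by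
  refine (Finset.card_le_card Finset.inter_subset_left).trans (Finset.card_biUnion_le.trans ?_)
  exact Finset.sum_le_sum fun i _ => (Q' i).toFinset_card_le

lemma Counters.Correct.pos_le {c : Counters k} (hc : c.Correct Q) (i : Fin k) :
    c.pos i ≤ numBins Q :=
  (hc.1 i).trans (Finset.single_le_sum (f := fun i => (Q i).length) (fun _ _ => Nat.zero_le _)
    (Finset.mem_univ i))

lemma Counters.Correct.opn_le {c : Counters k} (hc : c.Correct Q) : c.opn ≤ numBins Q := by
  rw [hc.2]
  refine (card_openPallets_le _ _).trans (Finset.sum_le_sum fun i _ => ?_)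
  simp [remaining]

lemma size_le_log_add_one {m n : ℕ} (h : m ≤ n) : Nat.size m ≤ Nat.log 2 n + 1 :=
  Nat.size_le.2 (h.trans_lt (Nat.lt_pow_succ_log_self one_lt_two n))

/-- A first removed bin is not the last one of its pallet. -/
lemma exists_remaining_of_first (two_bins : ∀ t ∈ plts Q, 2 ≤ ∑ i, (Q i).count t) {pos : Fin k → ℕ}
    {i : Fin k} {t : ℕ+} (h : (Q i)[pos i]? = some t) (hfirst : ∀ j, t ∉ (Q j).take (pos j)) :
    ¬ ∀ j, t ∉ (Q j).drop (Function.update pos i (pos i + 1) j) := by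
  intro hlast
  have ht : t ∈ plts Q := mem_plts.2 ⟨i, List.mem_of_getElem? h⟩
  have hcount : ∀ j, (Q j).count t = if j = i then 1 else 0 := by
    intro j
    rw [← List.take_append_drop (pos j) (Q j), List.count_append,
      List.count_eq_zero_of_not_mem (hfirst j), zero_add]
    have := hlast j
    split_ifs with hj
    · subst hj
      rw [Function.update_self] at this
      rw [drop_eq_cons h, List.count_cons_self, List.count_eq_zero_of_not_mem this]
    · rw [Function.update_of_ne hj] at this
      exact List.count_eq_zero_of_not_mem this
  have := two_bins t ht
  simp [hcount] at this

lemma opened_le_of_two_bins (two_bins : ∀ t ∈ plts Q, 2 ≤ ∑ i, (Q i).count t) {c : Counters k}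
    (hc : c.Correct Q) {i : Fin k} {t : ℕ+} (h : (Q i)[c.pos i]? = some t) {n : ℕ}
    (h1 : (openPallets Q (remaining Q c.pos)).card ≤ n)
    (h2 : (openPallets Q (remaining Q (Function.update c.pos i (c.pos i + 1)))).card ≤ n) :
    c.opened Q t ≤ n := by
  by_cases hfirst : ∀ j, t ∉ (Q j).take (c.pos j)
  · rw [openPallets_of_step hc.1 h, if_neg (exists_remaining_of_first two_bins h hfirst)] at h2
    rwa [opened_eq hc.1 hc.2 h]
  · rw [Counters.opened, if_neg hfirst, hc.2]
    exact h1

lemma Counters.exists_step {c : Counters k} {i : Fin k} {t : ℕ+} (h : (Q i)[c.pos i]? = some t)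
    (hle : c.opened Q t ≤ p) :
    ∃ c', Counters.Step Q p c c' ∧ c'.pos = Function.update c.pos i (c.pos i + 1) := by
  classical
  refine ⟨⟨Function.update c.pos i (c.pos i + 1),
    if ∀ j, t ∉ (Q j).drop (Function.update c.pos i (c.pos i + 1) j) then c.opened Q t - 1
    else c.opened Q t⟩, ⟨i, t, h, rfl, hle, ?_⟩, rfl⟩
  congr

/-- The procedure compares the number of open pallets with `p` before it closes the pallet of the
removed bin. This does not exclude any processing, because the pallet of a first removed bin stays
open. -/
theorem processable_iff (two_bins : ∀ t ∈ plts Q, 2 ≤ ∑ i, (Q i).count t) :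
    Processable Q p ↔ ∃ c : Counters k, c.Reachable Q p ∧ ∀ i, c.pos i = (Q i).length := by
  constructor
  · rintro ⟨n, R, h0, hn, hstep, hopen⟩
    have key : ∀ s ≤ n, ∃ c : Counters k, c.Reachable Q p ∧ remaining Q c.pos = R s := by
      intro s hs
      induction s with
      | zero => exact ⟨.zero k, .refl, h0.symm ▸ rfl⟩
      | succ s ih =>
        obtain ⟨c, hc, hR⟩ := ih (by omega)
        have hcor := Counters.Correct.of_reachable hc
        obtain ⟨i, ⟨t, ht⟩, hj⟩ := hstep s hs
        rw [← hR] at ht hj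
        have hQ : (Q i)[c.pos i]? = some t := by
          have := congrArg (·[0]?) ht
          simpa [remaining] using this
        have hrem : remaining Q (Function.update c.pos i (c.pos i + 1)) = R (s + 1) := by
          funext j
          rcases eq_or_ne j i with rfl | hne
          · rw [remaining, drop_eq_cons hQ] at ht
            simpa [remaining] using ht
          · simp [remaining, hj j hne, hne]
        have hle : c.opened Q t ≤ p := by
          refine opened_le_of_two_bins two_bins hcor hQ ?_ ?_
          · rw [hR]
            exact hopen s (by omega)
          · rw [hrem]
            exact hopen _ hs
        obtain ⟨c', hs', hc'⟩ := Counters.exists_step hQ hle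
        exact ⟨c', hc.tail hs', hc' ▸ hrem⟩
    obtain ⟨c, hc, hR⟩ := key n le_rfl
    refine ⟨c, hc, fun i => le_antisymm ((Counters.Correct.of_reachable hc).1 i) ?_⟩
    have := (congrFun hR i).trans (hn i)
    simpa [remaining] using this
  · rintro ⟨c, hc, hpos⟩
    have key : ∃ (n : ℕ) (R : ℕ → Sequences k), R 0 = Q ∧ R n = remaining Q c.pos ∧
        (∀ s < n, TransformationStep (R s) (R (s + 1))) ∧
        ∀ s ≤ n, (openPallets Q (R s)).card ≤ p := by
      clear hpos
      induction hc with
      | refl =>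
        refine ⟨0, fun _ => Q, rfl, rfl, by simp, fun _ _ => ?_⟩
        have h := (Counters.Correct.zero (Q := Q)).2
        exact (h.symm.le.trans (Nat.zero_le p) : (openPallets Q (remaining Q fun _ => 0)).card ≤ p)
      | @tail c c' hc hs ih =>
        obtain ⟨n, R, h0, hn, hstep, hopen⟩ := ih
        have hcor := Counters.Correct.of_reachable hc
        have hcor' := hcor.step hs
        obtain ⟨i, t, ht, hpos, hle, hopn⟩ := hs
        refine ⟨n + 1, fun s => if s ≤ n then R s else remaining Q c'.pos, by simpa using h0, by
            simp,
          ?_, ?_⟩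
        · intro s hs
          rcases (Nat.lt_succ_iff.1 hs).lt_or_eq with hlt | rfl
          · simpa [hlt.le, Nat.succ_le_iff.2 hlt] using hstep s hlt
          · simp only [le_refl, if_true, Nat.not_succ_le_self, if_false, hn, hpos]
            refine ⟨i, ⟨t, ?_⟩, fun j hne => ?_⟩
            · simp [remaining, drop_eq_cons ht]
            · simp [remaining, hne]
        · intro s hs
          by_cases hsn : s ≤ n
          · simpa [hsn] using hopen s hsn
          · simp only [hsn, if_false]
            rw [← hcor'.2, hopn]
            split_ifs <;> omega
    obtain ⟨n, R, h0, hn, h⟩ := key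
    exact ⟨n, R, h0, fun i => by simp [hn, remaining, hpos], h⟩

end Counting

end StackUp

namespace StackUp

open Relation

/-! ### Binary numbers in a word -/

/-- The letters `zero` and `one`. -/
def isDigit : Letter → Bool
  | .zero => true
  | .one => true
  | _ => false

/-- The maximal block of digits of `w` that starts at position `u`. -/
def dig (w : List Letter) (u : ℕ) : List Letter := (w.drop u).takeWhile isDigit

lemma dig_of_digit {w : List Letter} {u : ℕ} {d : Letter} (h : w[u]? = some d) (hd : isDigit d) :
    dig w u = d :: dig w (u + 1) := by
  obtain ⟨hu, rfl⟩ := List.getElem?_eq_some_iff.1 h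
  rw [dig, List.drop_eq_getElem_cons hu, List.takeWhile_cons_of_pos hd, dig]

lemma getElem?_of_dig {w : List Letter} {u : ℕ} {d : Letter} {l : List Letter}
    (h : dig w u = d :: l) : w[u]? = some d ∧ isDigit d ∧ dig w (u + 1) = l := by
  rcases hu : w[u]? with _ | e
  · rw [dig, List.drop_eq_nil_of_le (by simpa using hu)] at h
    simp at h
  · by_cases he : isDigit e
    · rw [dig_of_digit hu he] at h
      simp_all
    · obtain ⟨hu', rfl⟩ := List.getElem?_eq_some_iff.1 hu
      rw [dig, List.drop_eq_getElem_cons hu', List.takeWhile_cons_of_neg he] at h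
      simp at h

lemma dig_eq_nil_iff {w : List Letter} {u : ℕ} :
    dig w u = [] ↔ w[u]? ≠ some .zero ∧ w[u]? ≠ some .one := by
  constructor
  · intro h
    constructor <;> intro hd <;> simp [dig_of_digit hd rfl] at h
  · rintro ⟨h0, h1⟩
    rcases h : dig w u with _ | ⟨d, l⟩
    · rfl
    · obtain ⟨h2, h3, -⟩ := getElem?_of_dig h
      cases d <;> simp_all [isDigit]

lemma dig_drop {w : List Letter} {u : ℕ} {pre l : List Letter} (h : dig w u = pre ++ l) :
    dig w (u + pre.length) = l := by
  induction pre generalizing u with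
  | nil => simpa using h
  | cons d pre ih =>
    have := ih (getElem?_of_dig h).2.2
    rwa [List.length_cons, ← add_assoc, add_right_comm]

lemma isDigit_of_mem_dig {w : List Letter} {u : ℕ} {d : Letter} (h : d ∈ dig w u) : isDigit d :=
  List.mem_takeWhile_imp h

lemma drop_eq_dig_append (w : List Letter) (u : ℕ) :
    w.drop u = dig w u ++ w.drop (u + (dig w u).length) := by
  rw [← List.drop_drop]
  conv_lhs => rw [← List.takeWhile_append_dropWhile (p := isDigit) (l := w.drop u)]
  congr 1
  conv_rhs => rw [← List.takeWhile_append_dropWhile (p := isDigit) (l := w.drop u)]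
  rw [dig, List.drop_left]

lemma add_length_dig_le (w : List Letter) (u : ℕ) : u + (dig w u).length ≤ max u w.length := by
  have := (List.takeWhile_prefix (p := isDigit) (l := w.drop u)).length_le
  rw [List.length_drop] at this
  rw [dig]
  omega

lemma dig_of_drop {w : List Letter} {u : ℕ} {l r : List Letter} (h : w.drop u = l ++ r)
    (hl : ∀ d ∈ l, isDigit d) (hr : ∀ d ∈ r.head?, isDigit d = false) : dig w u = l := by
  rw [dig, h, List.takeWhile_append_of_pos hl]
  rcases r with _ | ⟨d, r⟩
  · simp
  · rw [List.takeWhile_cons_of_neg (by simp [hr d rfl]), List.append_nil]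

/-- The value of a block of digits, least significant digit first. -/
def digVal : List Letter → ℕ
  | [] => 0
  | d :: l => (if d = .one then 1 else 0) + 2 * digVal l

lemma digVal_bits (n : ℕ) :
    digVal ((Nat.bits n).map fun b => if b then Letter.one else .zero) = n := by
  induction n using Nat.binaryRec' with
  | zero => rfl
  | bit b n h ih =>
    rw [Nat.bits_append_bit _ _ h, List.map_cons, digVal, ih, Nat.bit_val]
    cases b <;> simp [add_comm]

lemma digVal_binary (t : ℕ+) : digVal (binary t) = t := digVal_bits t

lemma binary_injective : Function.Injective binary := fun s t h =>
  PNat.coe_injective (by rw [← digVal_binary, h, digVal_binary])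

lemma isDigit_of_mem_binary {t : ℕ+} {d : Letter} (h : d ∈ binary t) : isDigit d := by
  obtain ⟨b, -, rfl⟩ := List.mem_map.1 h
  cases b <;> rfl

lemma getLast?_bits {n : ℕ} (hn : n ≠ 0) :
    ((Nat.bits n).map fun b => if b then Letter.one else .zero).getLast? = some .one := by
  induction n using Nat.binaryRec' with
  | zero => exact absurd rfl hn
  | bit b n h ih =>
    rw [Nat.bits_append_bit _ _ h, List.map_cons]
    by_cases h0 : n = 0
    · simp [h0, h h0]
    · rw [List.getLast?_cons, ih h0]
      rfl

lemma exists_binary_append (t : ℕ+) : ∃ pre, binary t = pre ++ [.one] := by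
  have := getLast?_bits t.ne_zero
  exact ⟨_, (List.dropLast_append_getLast? _ this).symm⟩

lemma exists_binary_eq (pre : List Letter) (h : ∀ d ∈ pre, isDigit d) :
    ∃ t, binary t = pre ++ [.one] := by
  suffices H : ∃ n : ℕ, n ≠ 0 ∧
      ((Nat.bits n).map fun b => if b then Letter.one else .zero) = pre ++ [.one] by
    obtain ⟨n, hn, h⟩ := H
    exact ⟨⟨n, Nat.pos_of_ne_zero hn⟩, h⟩
  induction pre with
  | nil => exact ⟨1, one_ne_zero, by simp⟩
  | cons d pre ih =>
    obtain ⟨n, hn, h'⟩ := ih fun e he => h e (List.mem_cons_of_mem _ he)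
    refine ⟨Nat.bit (d == .one) n, by simp [hn], ?_⟩
    rw [Nat.bits_append_bit _ _ (fun h => absurd h hn), List.map_cons, h']
    have := h d List.mem_cons_self
    cases d <;> simp_all [isDigit]

/-- One step through a block of digits. -/
def WalkStep (w : List Letter) (u u' : ℕ) : Prop :=
  (w[u]? = some .zero ∨ w[u]? = some .one) ∧ u + 1 = u'

lemma exists_digit {w : List Letter} {u : ℕ} (h : w[u]? = some .zero ∨ w[u]? = some .one) :
    ∃ d, isDigit d ∧ w[u]? = some d := by
  rcases h with h | h
  exacts [⟨_, rfl, h⟩, ⟨_, rfl, h⟩]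

lemma digit_cases {w : List Letter} {u : ℕ} {d : Letter} (hd : isDigit d) (h : w[u]? = some d) :
    w[u]? = some .zero ∨ w[u]? = some .one := by
  cases d <;> simp_all [isDigit]

lemma walk_iff {w : List Letter} {u e : ℕ} : ReflTransGen (WalkStep w) u e ↔
    ∃ pre, dig w u = pre ++ dig w e ∧ e = u + pre.length := by
  constructor
  · intro h
    induction h using ReflTransGen.head_induction_on with
    | refl => exact ⟨[], rfl, rfl⟩
    | head h _ ih =>
      obtain ⟨h1, rfl⟩ := h
      obtain ⟨d, hd, h1⟩ := exists_digit h1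
      obtain ⟨pre, h2, rfl⟩ := ih
      refine ⟨d :: pre, ?_, by simp; ring⟩
      rw [dig_of_digit h1 hd, h2]
      rfl
  · rintro ⟨pre, h, rfl⟩
    induction pre generalizing u with
    | nil => exact .refl
    | cons d pre ih =>
      obtain ⟨h1, h2, h3⟩ := getElem?_of_dig h
      refine .head ⟨digit_cases h2 h1, rfl⟩ ?_
      have := ih (u := u + 1)
      rw [show u + 1 + pre.length = u + (d :: pre).length by simp; ring] at this
      exact this h3

/-- The letters from position `u` up to position `e` are the binary representation of a positive
integer, and they are a maximal block of digits. -/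
def IsNum (w : List Letter) (u e : ℕ) : Prop :=
  ∃ t : ℕ+, dig w u = binary t ∧ e = u + (binary t).length

lemma isNum_iff {w : List Letter} {u e : ℕ} : IsNum w u e ↔
    ∃ c, ReflTransGen (WalkStep w) u c ∧ w[c]? = some .one ∧ c + 1 = e ∧ dig w e = [] := by
  constructor
  · rintro ⟨t, h, rfl⟩
    obtain ⟨pre, hpre⟩ := exists_binary_append t
    rw [hpre] at h ⊢
    have h1 := dig_drop h
    obtain ⟨h2, -, h3⟩ := getElem?_of_dig h1
    exact ⟨u + pre.length, walk_iff.2 ⟨pre, by rw [h1, h], rfl⟩, h2, by simp [add_assoc],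
      by simpa [add_assoc] using h3⟩
  · rintro ⟨c, h1, h2, rfl, h3⟩
    obtain ⟨pre, h4, rfl⟩ := walk_iff.1 h1
    rw [dig_of_digit h2 rfl, h3] at h4
    obtain ⟨t, ht⟩ := exists_binary_eq pre fun d hd =>
      isDigit_of_mem_dig (w := w) (u := u) (by rw [h4]; exact List.mem_append_left _ hd)
    exact ⟨t, by rw [ht, h4], by simp [ht, add_assoc]⟩

/-- One step of a parallel walk through two equal blocks of digits. -/
def SameStep (w : List Letter) (s s' : ℕ × ℕ) : Prop :=
  ((w[s.1]? = some .zero ∧ w[s.2]? = some .zero) ∨ (w[s.1]? = some .one ∧ w[s.2]? = some .one)) ∧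
    s.1 + 1 = s'.1 ∧ s.2 + 1 = s'.2

lemma sameWalk_iff {w : List Letter} {s s' : ℕ × ℕ} : ReflTransGen (SameStep w) s s' ↔
    ∃ pre, dig w s.1 = pre ++ dig w s'.1 ∧ dig w s.2 = pre ++ dig w s'.2 ∧
      s' = (s.1 + pre.length, s.2 + pre.length) := by
  constructor
  · intro h
    induction h using ReflTransGen.head_induction_on with
    | refl => exact ⟨[], rfl, rfl, rfl⟩
    | @head s s₁ h _ ih =>
      obtain ⟨h1, h2, h3⟩ := h
      obtain ⟨pre, h4, h5, rfl⟩ := ih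
      obtain ⟨d, hd, h6, h7⟩ : ∃ d, isDigit d ∧ w[s.1]? = some d ∧ w[s.2]? = some d := by
        rcases h1 with h1 | h1
        exacts [⟨_, rfl, h1⟩, ⟨_, rfl, h1⟩]
      refine ⟨d :: pre, ?_, ?_, ?_⟩
      · rw [dig_of_digit h6 hd, h2, h4]
        rfl
      · rw [dig_of_digit h7 hd, h3, h5]
        rfl
      · ext <;> simp [← h2, ← h3] <;> ring
  · rintro ⟨pre, h, h', rfl⟩
    induction pre generalizing s with
    | nil => exact .refl
    | cons d pre ih =>
      obtain ⟨h1, h2, h3⟩ := getElem?_of_dig h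
      obtain ⟨h1', -, h3'⟩ := getElem?_of_dig h'
      refine .head (b := (s.1 + 1, s.2 + 1)) ⟨?_, rfl, rfl⟩ ?_
      · cases d <;> simp_all [isDigit]
      · have := ih (s := (s.1 + 1, s.2 + 1))
        simp only [show ∀ u, u + 1 + pre.length = u + (d :: pre).length by intro u; simp; ring]
          at this
        exact this h3 h3'

lemma dig_eq_iff {w : List Letter} {u u' : ℕ} : dig w u = dig w u' ↔
    ∃ e e', ReflTransGen (SameStep w) (u, u') (e, e') ∧ dig w e = [] ∧ dig w e' = [] := by
  constructor
  · intro h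
    have h1 := dig_drop (List.append_nil (dig w u)).symm
    have h2 := dig_drop (List.append_nil (dig w u')).symm
    rw [← h] at h2
    refine ⟨_, _, sameWalk_iff.2 ⟨dig w u, by simp [h1], ?_, rfl⟩, h1, h2⟩
    change dig w u' = dig w u ++ dig w (u' + (dig w u).length)
    rw [h2, List.append_nil, h]
  · rintro ⟨e, e', h, h1, h2⟩
    obtain ⟨pre, h3, h4, -⟩ := sameWalk_iff.1 h
    simp only [h1, h2] at h3 h4
    rw [h3, h4]

lemma exists_first_difference {l l' : List Letter} (h : l ≠ l') : ∃ pre r r', l = pre ++ r ∧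
    l' = pre ++ r' ∧ ∃ d, (r.head? = some d ∧ r'.head? ≠ some d) ∨
      (r'.head? = some d ∧ r.head? ≠ some d) := by
  induction l generalizing l' with
  | nil =>
    obtain _ | ⟨d, l'⟩ := l'
    · exact absurd rfl h
    · exact ⟨[], [], d :: l', rfl, rfl, d, .inr ⟨rfl, by simp⟩⟩
  | cons d l ih =>
    obtain _ | ⟨d', l'⟩ := l'
    · exact ⟨[], d :: l, [], rfl, rfl, d, .inl ⟨rfl, by simp⟩⟩
    · by_cases hd : d = d'
      · subst hd
        obtain ⟨pre, r, r', h1, h2, h3⟩ := ih (l' := l') (by simpa using h)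
        exact ⟨d :: pre, r, r', by simp [h1], by simp [h2], h3⟩
      · exact ⟨[], d :: l, d' :: l', rfl, rfl, d, .inl ⟨rfl, by simpa using Ne.symm hd⟩⟩

lemma head?_dig_iff {w : List Letter} {u : ℕ} {d : Letter} :
    (dig w u).head? = some d ↔ isDigit d ∧ w[u]? = some d := by
  constructor
  · intro h
    obtain ⟨l, hl⟩ : ∃ l, dig w u = d :: l := List.head?_eq_some_iff.1 h
    obtain ⟨h1, h2, -⟩ := getElem?_of_dig hl
    exact ⟨h2, h1⟩
  · rintro ⟨h1, h2⟩
    rw [dig_of_digit h2 h1]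
    rfl

/-- One of the two positions carries the digit `d`, and the other one does not. -/
def Split (w : List Letter) (d : Letter) (e e' : ℕ) : Prop :=
  (w[e]? = some d ∧ w[e']? ≠ some d) ∨ (w[e']? = some d ∧ w[e]? ≠ some d)

lemma dig_ne_iff {w : List Letter} {u u' : ℕ} : dig w u ≠ dig w u' ↔
    ∃ e e', ReflTransGen (SameStep w) (u, u') (e, e') ∧
      (Split w .zero e e' ∨ Split w .one e e') := by
  constructor
  · intro h
    obtain ⟨pre, r, r', h1, h2, d, h3⟩ := exists_first_difference h
    have h4 := dig_drop h1
    have h5 := dig_drop h2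
    refine ⟨u + pre.length, u' + pre.length, sameWalk_iff.2 ⟨pre, by simp [h4, h1], by simp [h5,
        h2],
      rfl⟩, ?_⟩
    rw [← h4, ← h5] at h3
    simp only [Ne, head?_dig_iff] at h3
    cases d <;> simp_all [isDigit, Split]
  · rintro ⟨e, e', h, h1⟩ heq
    obtain ⟨pre, h3, h4, -⟩ := sameWalk_iff.1 h
    simp only at h3 h4
    rw [h3, h4] at heq
    have heq := congrArg List.head? (List.append_cancel_left heq)
    have h5 : ∀ d, isDigit d → (w[e]? = some d ↔ w[e']? = some d) := by
      intro d hd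
      have := head?_dig_iff (w := w) (u := e) (d := d)
      rw [heq, head?_dig_iff] at this
      simpa [hd] using this.symm
    have h6 := h5 .zero rfl
    have h7 := h5 .one rfl
    simp only [Split] at h1
    tauto

/-- One step of the comparison of a number with a block of digits: the number `2 o + b` or
`2 o + b - 1` is replaced by `o` after reading the digit `b`. -/
def LeStep (w : List Letter) (s s' : ℕ × ℕ) : Prop :=
  ((w[s.2]? = some .zero ∧ (s'.1 + s'.1 = s.1 ∨ ∃ d, d + 1 = s'.1 ∧ s'.1 + d = s.1)) ∨
    (w[s.2]? = some .one ∧ (s'.1 + s'.1 + 1 = s.1 ∨ s'.1 + s'.1 = s.1))) ∧ s.2 + 1 = s'.2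

lemma LeStep.fst_le {w : List Letter} {s s' : ℕ × ℕ} (h : LeStep w s s') : s'.1 ≤ s.1 := by
  obtain ⟨⟨-, h | ⟨d, h, h'⟩⟩ | ⟨-, h | h⟩, -⟩ := h <;> omega

lemma le_digVal_iff {w : List Letter} {o u : ℕ} : o ≤ digVal (dig w u) ↔
    ∃ e, ReflTransGen (LeStep w) (o, u) (0, e) ∧ dig w e = [] := by
  constructor
  · generalize hl : dig w u = l
    induction l generalizing o u with
    | nil =>
      intro h
      obtain rfl : o = 0 := Nat.le_zero.1 h
      exact ⟨u, .refl, hl⟩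
    | cons d l ih =>
      intro h
      obtain ⟨h1, h2, h3⟩ := getElem?_of_dig hl
      simp only [digVal] at h
      cases d with
      | zero =>
        obtain ⟨e, h4, h5⟩ := ih h3 (o := (o + 1) / 2) (by simp at h; omega)
        refine ⟨e, .head (b := ((o + 1) / 2, u + 1)) ⟨.inl ⟨h1, ?_⟩, rfl⟩ h4, h5⟩
        rcases Nat.even_or_odd' o with ⟨m, rfl | rfl⟩
        · exact .inl (by simp only; omega)
        · exact .inr ⟨m, by simp only; omega, by simp only; omega⟩
      | one =>
        obtain ⟨e, h4, h5⟩ := ih h3 (o := o / 2) (by simp at h; omega)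
        exact ⟨e, .head (b := (o / 2, u + 1)) ⟨.inr ⟨h1, by simp only; omega⟩, rfl⟩ h4, h5⟩
      | comma => simp [isDigit] at h2
      | semicolon => simp [isDigit] at h2
  · rintro ⟨e, h, he⟩
    have key : ∀ s, ReflTransGen (LeStep w) s (0, e) → s.1 ≤ digVal (dig w s.2) := by
      intro s hs
      induction hs using ReflTransGen.head_induction_on with
      | refl => exact Nat.zero_le _
      | head h1 _ ih =>
        obtain ⟨⟨h2, h3⟩ | ⟨h2, h3⟩, h4⟩ := h1
        · rw [dig_of_digit h2 rfl, h4, digVal]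
          rcases h3 with h3 | ⟨d, h3, h3'⟩ <;> omega
        · rw [dig_of_digit h2 rfl, h4, digVal, if_pos rfl]
          omega
    exact key _ h

/-! ### Sequences of bins in a word -/

/-- The bin for the pallet `t` is written from position `a` up to position `b`. -/
def Bin (w : List Letter) (a : ℕ) (t : ℕ+) (b : ℕ) : Prop :=
  w[a]? = some .comma ∧ dig w (a + 1) = binary t ∧ b = a + 1 + (binary t).length

/-- A bin is written from position `a` up to position `b`. -/
def Item (w : List Letter) (a b : ℕ) : Prop := w[a]? = some .comma ∧ IsNum w (a + 1) b

lemma item_iff {w : List Letter} {a b : ℕ} : Item w a b ↔ ∃ t, Bin w a t b := by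
  simp [Item, IsNum, Bin]

lemma Bin.lt {w : List Letter} {a b : ℕ} {t : ℕ+} (h : Bin w a t b) : a < b := by
  rw [h.2.2]
  omega

lemma Bin.le_length {w : List Letter} {a b : ℕ} {t : ℕ+} (h : Bin w a t b) : b ≤ w.length := by
  have h1 := add_length_dig_le w (a + 1)
  rw [h.2.1, ← h.2.2] at h1
  have := (List.getElem?_eq_some_iff.1 h.1).1
  omega

lemma Bin.unique {w : List Letter} {a b b' : ℕ} {t t' : ℕ+} (h : Bin w a t b) (h' : Bin w a t' b') :
    t = t' ∧ b = b' := by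
  obtain rfl : t = t' := binary_injective (h.2.1.symm.trans h'.2.1)
  exact ⟨rfl, h.2.2.trans h'.2.2.symm⟩

/-- The bins for the pallets in `l` are written from position `a` up to position `b`. -/
def Reads (w : List Letter) : ℕ → List ℕ+ → ℕ → Prop
  | a, [], b => a = b
  | a, t :: l, b => ∃ m, Bin w a t m ∧ Reads w m l b

lemma Reads.le {w : List Letter} {a b : ℕ} {l : List ℕ+} (h : Reads w a l b) : a ≤ b := by
  induction l generalizing a with
  | nil => exact Eq.le h
  | cons t l ih =>
    obtain ⟨m, h1, h2⟩ := h
    exact h1.lt.le.trans (ih h2)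

lemma Reads.unique {w : List Letter} {a b : ℕ} {l l' : List ℕ+} (h : Reads w a l b)
    (h' : Reads w a l' b) : l = l' := by
  induction l generalizing a l' with
  | nil =>
    obtain _ | ⟨t, l'⟩ := l'
    · rfl
    · obtain ⟨m, h1, h2⟩ := h'
      exact absurd (h1.lt.trans_le h2.le) (h : a = b).not_lt
  | cons t l ih =>
    obtain ⟨m, h1, h2⟩ := h
    obtain _ | ⟨t', l'⟩ := l'
    · exact absurd (h1.lt.trans_le h2.le) (h' : a = b).not_lt
    · obtain ⟨m', h1', h2'⟩ := h'
      obtain ⟨rfl, rfl⟩ := h1.unique h1'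
      rw [ih h2 h2']

lemma reads_append {w : List Letter} {a b : ℕ} {l l' : List ℕ+} :
    Reads w a (l ++ l') b ↔ ∃ m, Reads w a l m ∧ Reads w m l' b := by
  induction l generalizing a with
  | nil => simp [Reads]
  | cons t l ih =>
    simp only [List.cons_append, Reads, ih]
    constructor
    · rintro ⟨m, h1, m', h2, h3⟩
      exact ⟨m', ⟨m, h1, h2⟩, h3⟩
    · rintro ⟨m', ⟨m, h1, h2⟩, h3⟩
      exact ⟨m, h1, m', h2, h3⟩

lemma reads_middle {w : List Letter} {a b : ℕ} {l l' : List ℕ+} {t : ℕ+} :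
    Reads w a (l ++ t :: l') b ↔ ∃ m m', Reads w a l m ∧ Bin w m t m' ∧ Reads w m' l' b := by
  simp only [reads_append, Reads]
  constructor
  · rintro ⟨m, h1, m', h2, h3⟩
    exact ⟨m, m', h1, h2, h3⟩
  · rintro ⟨m, m', h1, h2, h3⟩
    exact ⟨m, h1, m', h2, h3⟩

/-- The end position of a part of a sequence is determined by its start position. -/
lemma Reads.right_unique {w : List Letter} {a b b' : ℕ} {l : List ℕ+} (h : Reads w a l b)
    (h' : Reads w a l b') : b = b' := by
  induction l generalizing a with
  | nil => exact Eq.trans (Eq.symm h) h'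
  | cons t l ih =>
    obtain ⟨m, h1, h2⟩ := h
    obtain ⟨m', h1', h2'⟩ := h'
    obtain ⟨-, rfl⟩ := h1.unique h1'
    exact ih h2 h2'

/-- A walk over a sequence of bins that checks each of them. -/
lemma Reads.reflTransGen_iff {w : List Letter} {φ : ℕ → ℕ → Prop} {a b : ℕ} {l : List ℕ+}
    (h : Reads w a l b) : ReflTransGen (fun u u' => Item w u u' ∧ φ u u') a b ↔
      ∀ l₁ t l₂ m m', l = l₁ ++ t :: l₂ → Reads w a l₁ m → Bin w m t m' → Reads w m' l₂ b →
        φ m m' := by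
  induction l generalizing a with
  | nil =>
    obtain rfl : a = b := h
    exact ⟨fun _ l₁ t l₂ m m' h => by simp at h, fun _ => .refl⟩
  | cons t l ih =>
    obtain ⟨c, h1, h2⟩ := h
    have hlt : a < b := h1.lt.trans_le h2.le
    constructor
    · intro hr
      obtain rfl | ⟨c', ⟨h3, h4⟩, h5⟩ := hr.cases_head
      · exact absurd hlt (lt_irrefl _)
      · obtain ⟨t', h3⟩ := item_iff.1 h3
        obtain ⟨rfl, rfl⟩ := h1.unique h3
        have h6 := (ih h2).1 h5
        rintro (_ | ⟨s, l₁⟩) t' l₂ m m' heq k1 k2 k3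
        · obtain rfl : a = m := k1
          obtain ⟨-, rfl⟩ := h1.unique k2
          exact h4
        · simp only [List.cons_append, List.cons.injEq] at heq
          obtain ⟨rfl, rfl⟩ := heq
          obtain ⟨c', k0, k1⟩ := k1
          obtain ⟨-, rfl⟩ := h1.unique k0
          exact h6 l₁ t' l₂ m m' rfl k1 k2 k3
    · intro H
      refine .head ⟨item_iff.2 ⟨t, h1⟩, H [] t l a c rfl rfl h1 h2⟩ ((ih h2).2 ?_)
      rintro l₁ t' l₂ m m' rfl k1 k2 k3
      exact H (t :: l₁) t' l₂ m m' rfl ⟨c, h1, k1⟩ k2 k3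

lemma reflTransGen_item_iff {w : List Letter} {a b : ℕ} :
    ReflTransGen (Item w) a b ↔ ∃ l, Reads w a l b := by
  constructor
  · intro h
    induction h using ReflTransGen.head_induction_on with
    | refl => exact ⟨[], rfl⟩
    | head h _ ih =>
      obtain ⟨t, h⟩ := item_iff.1 h
      obtain ⟨l, hl⟩ := ih
      exact ⟨t :: l, _, h, hl⟩
  · rintro ⟨l, h⟩
    have := (h.reflTransGen_iff (φ := fun _ _ => True)).2 fun _ _ _ _ _ _ _ _ _ => trivial
    simp only [and_true] at this
    exact this

/-- No bin that is written between the positions `a` and `b` has the pallet whose symbol starts at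
position `c`. -/
def NotMem (w : List Letter) (c a b : ℕ) : Prop :=
  ReflTransGen (fun u u' => Item w u u' ∧ dig w (u + 1) ≠ dig w c) a b

/-- Some bin that is written between the positions `a` and `b` has the pallet whose symbol starts at
position `c`. -/
def Mem (w : List Letter) (c a b : ℕ) : Prop :=
  ∃ u u', ReflTransGen (Item w) a u ∧ Item w u u' ∧ dig w (u + 1) = dig w c ∧
    ReflTransGen (Item w) u' b

lemma notMem_iff {w : List Letter} {a b c : ℕ} {t : ℕ+} {l : List ℕ+} (hc : dig w c = binary t)
    (h : Reads w a l b) : NotMem w c a b ↔ t ∉ l := by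
  rw [NotMem, h.reflTransGen_iff]
  constructor
  · intro H ht
    obtain ⟨l₁, l₂, rfl⟩ := List.append_of_mem ht
    obtain ⟨m, m', h1, h2, h3⟩ := reads_middle.1 h
    exact H l₁ t l₂ m m' rfl h1 h2 h3 (h2.2.1.trans hc.symm)
  · rintro ht l₁ t' l₂ m m' rfl h1 h2 h3 heq
    rw [h2.2.1, hc] at heq
    exact ht (by simp [binary_injective heq])

lemma mem_iff {w : List Letter} {a b c : ℕ} {t : ℕ+} {l : List ℕ+} (hc : dig w c = binary t)
    (h : Reads w a l b) : Mem w c a b ↔ t ∈ l := by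
  constructor
  · rintro ⟨u, u', h1, h2, h3, h4⟩
    obtain ⟨l₁, h1⟩ := reflTransGen_item_iff.1 h1
    obtain ⟨t', h2⟩ := item_iff.1 h2
    obtain ⟨l₂, h4⟩ := reflTransGen_item_iff.1 h4
    rw [h2.2.1, hc] at h3
    obtain rfl := binary_injective h3
    rw [h.unique (reads_middle.2 ⟨u, u', h1, h2, h4⟩)]
    simp
  · intro ht
    obtain ⟨l₁, l₂, rfl⟩ := List.append_of_mem ht
    obtain ⟨m, m', h1, h2, h3⟩ := reads_middle.1 h
    exact ⟨m, m', reflTransGen_item_iff.2 ⟨_, h1⟩, item_iff.2 ⟨_, h2⟩, h2.2.1.trans hc.symm,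
      reflTransGen_item_iff.2 ⟨_, h3⟩⟩

/-- The bins of a sequence as a word. -/
def encodeSeq (q : List ℕ+) : List Letter := q.flatMap fun t => .comma :: binary t

lemma Reads.drop_eq {w : List Letter} {a b : ℕ} {l : List ℕ+} (h : Reads w a l b) :
    w.drop a = encodeSeq l ++ w.drop b := by
  induction l generalizing a with
  | nil =>
    obtain rfl : a = b := h
    rfl
  | cons t l ih =>
    obtain ⟨m, ⟨h1, h2, rfl⟩, h3⟩ := h
    obtain ⟨ha, h1⟩ := List.getElem?_eq_some_iff.1 h1
    rw [List.drop_eq_getElem_cons ha, h1, drop_eq_dig_append, h2, ih h3]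
    simp [encodeSeq]

lemma reads_of_drop_eq {w : List Letter} {a : ℕ} {l : List ℕ+} {r : List Letter}
    (h : w.drop a = encodeSeq l ++ r) (hr : ∀ d ∈ r.head?, isDigit d = false) :
    Reads w a l (a + (encodeSeq l).length) := by
  induction l generalizing a with
  | nil => rfl
  | cons t l ih =>
    have h' : w.drop a = .comma :: (binary t ++ (encodeSeq l ++ r)) := by
      rw [h]; simp [encodeSeq]
    have h1 : w[a]? = some .comma := by
      have := congrArg (·[0]?) h'
      simpa using this
    have h2 : w.drop (a + 1) = binary t ++ (encodeSeq l ++ r) := by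
      rw [← List.drop_drop, h']
      rfl
    have h3 : w.drop (a + 1 + (binary t).length) = encodeSeq l ++ r := by
      rw [← List.drop_drop, h2, List.drop_left]
    refine ⟨a + 1 + (binary t).length, ⟨h1, ?_, rfl⟩, ?_⟩
    · refine dig_of_drop h2 (fun d hd => isDigit_of_mem_binary hd) ?_
      cases l with
      | nil => exact hr
      | cons s l => simp [encodeSeq, isDigit]
    · have := ih h3
      convert this using 1
      simp [encodeSeq]
      ring

/-- The word `w` describes an instance with the sequences `Q` and `p` places; the sequence `q_i`
starts after the semicolon in position `b i` and ends before position `b (i + 1)`. -/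
structure Layout {k : ℕ} (w : List Letter) (b : Fin (k + 1) → ℕ) (p : ℕ+) (Q : Sequences k) :
    Prop where
  dig_zero : dig w 0 = binary p
  first : b 0 = (binary p).length
  semicolon (i : Fin k) : w[b i.castSucc]? = some .semicolon
  reads (i : Fin k) : Reads w (b i.castSucc + 1) (Q i) (b i.succ)
  last : b (Fin.last k) = w.length

/-- The word that describes the number of places and the sequences. -/
def encodeWord {k : ℕ} (p : ℕ+) (Q : Sequences k) : List Letter :=
  binary p ++ (List.ofFn Q).flatMap fun q => .semicolon :: encodeSeq q

lemma Layout.eq_encodeWord {k : ℕ} {w : List Letter} {b : Fin (k + 1) → ℕ} {p : ℕ+}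
    {Q : Sequences k} (h : Layout w b p Q) : w = encodeWord p Q := by
  have key : ∀ j : Fin (k + 1), w = (binary p ++ ((List.ofFn Q).take j).flatMap fun q =>
      .semicolon :: encodeSeq q) ++ w.drop (b j) := by
    intro j
    induction j using Fin.induction with
    | zero =>
      have := drop_eq_dig_append w 0
      rw [h.dig_zero, zero_add, ← h.first] at this
      simpa using this
    | succ i ih =>
      obtain ⟨hb, h1⟩ := List.getElem?_eq_some_iff.1 (h.semicolon i)
      rw [List.drop_eq_getElem_cons hb, h1, (h.reads i).drop_eq] at ih
      conv_lhs => rw [ih]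
      rw [Fin.val_succ, List.take_add_one, List.getElem?_ofFn, dif_pos i.2]
      simp
  have := key (Fin.last k)
  rwa [h.last, List.drop_length, List.append_nil, Fin.val_last,
    List.take_of_length_le (by simp)] at this

lemma exists_layout {k : ℕ} (p : ℕ+) (Q : Sequences k) :
    ∃ b, Layout (encodeWord p Q) b p Q := by
  set f : List ℕ+ → List Letter := fun q => .semicolon :: encodeSeq q with hf
  set w := encodeWord p Q with hw
  let g : ℕ → List Letter := fun j => binary p ++ ((List.ofFn Q).take j).flatMap f
  let r : ℕ → List Letter := fun j => ((List.ofFn Q).drop j).flatMap f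
  have hsplit : ∀ j, w = g j ++ r j := by
    intro j
    simp only [g, r, List.append_assoc, ← List.flatMap_append, List.take_append_drop]
    rfl
  have hdrop : ∀ j, w.drop (g j).length = r j := fun j => by rw [hsplit j, List.drop_left]
  have hr : ∀ i : Fin k, r i = .semicolon :: (encodeSeq (Q i) ++ r (i + 1)) := by
    intro i
    simp only [r]
    rw [List.drop_eq_getElem_cons (by simp)]
    simp [hf]
  have hg : ∀ i : Fin k, (g (i + 1)).length = (g i).length + 1 + (encodeSeq (Q i)).length := by
    intro i
    simp only [g]
    rw [List.take_add_one, List.getElem?_ofFn, dif_pos i.2]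
    simp [hf]
    ring
  have hhead : ∀ j, ∀ d ∈ (r j).head?, isDigit d = false := by
    intro j d hd
    simp only [r] at hd
    generalize (List.ofFn Q).drop j = qs at hd
    cases qs with
    | nil => simp at hd
    | cons q qs =>
      simp only [List.flatMap_cons, hf, List.cons_append, List.head?_cons,
        Option.mem_some_iff] at hd
      subst hd
      rfl
  refine ⟨fun j => (g j).length, ?_, ?_, fun i => ?_, fun i => ?_, ?_⟩
  · refine dig_of_drop (r := r 0) ?_ (fun d hd => isDigit_of_mem_binary hd) (hhead 0)
    simpa [g] using hsplit 0
  · simp [g]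
  · have := congrArg (·[0]?) ((hdrop i).trans (hr i))
    simpa using this
  · have h1 : w.drop ((g i).length + 1) = encodeSeq (Q i) ++ r (i + 1) := by
      rw [← List.drop_drop, hdrop, hr]
      rfl
    have := reads_of_drop_eq h1 (hhead _)
    rwa [← hg] at this
  · have h1 := hsplit k
    have h2 : r k = [] := by
      simp only [r]
      rw [List.drop_eq_nil_of_le (by simp), List.flatMap_nil]
    rw [h2, List.append_nil] at h1
    rw [h1, Fin.val_last]

end StackUp

namespace OffLine

open Relation

namespace NLPred

variable {α V : Type}

/-! ### Arithmetic and tests of input letters -/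

lemma eq (i j : V) : NLPred fun (_ : List α) v => v i = v j :=
  (linear (some i) none (some j) false).congr fun _ _ _ => by simp [val]

lemma eq_zero (i : V) : NLPred fun (_ : List α) v => v i = 0 :=
  (linear (some i) none none false).congr fun _ _ _ => by simp [val]

lemma succ_eq (i j : V) : NLPred fun (_ : List α) v => v i + 1 = v j :=
  (linear (some i) none (some j) true).congr fun _ _ _ => by simp [val]

lemma add_eq (i j l : V) : NLPred fun (_ : List α) v => v i + v j = v l :=
  (linear (some i) (some j) (some l) false).congr fun _ _ _ => by simp [val]

lemma add_succ_eq (i j l : V) : NLPred fun (_ : List α) v => v i + v j + 1 = v l :=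
  (linear (some i) (some j) (some l) true).congr fun _ _ _ => by simp [val]

lemma const (p : Prop) : NLPred fun (_ : List α) (_ : V → ℕ) => p := by
  by_cases hp : p
  · exact (linear none none none false).congr fun _ _ _ => by simp [val, hp]
  · exact (linear none none none true).congr fun _ _ _ => by simp [val, hp]

lemma forall_fin {n : ℕ} {P : Fin n → List α → (V → ℕ) → Prop} (h : ∀ j, NLPred (P j)) :
    NLPred fun x v => ∀ j, P j x v := by
  induction n with
  | zero => exact (const True).congr fun _ _ _ => by simp
  | succ n ih =>
    exact ((h 0).and (ih fun j => h j.succ)).congr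
      fun x v _ => (Fin.forall_fin_succ (P := fun j => P j x v)).symm

lemma exists_fin {n : ℕ} {P : Fin n → List α → (V → ℕ) → Prop} (h : ∀ j, NLPred (P j)) :
    NLPred fun x v => ∃ j, P j x v := by
  induction n with
  | zero => exact (const False).congr fun _ _ _ => by simp
  | succ n ih =>
    exact ((h 0).or (ih fun j => h j.succ)).congr
      fun x v _ => (Fin.exists_fin_succ (P := fun j => P j x v)).symm

lemma getElem_eq (i : V) (a : α) : NLPred fun x v => x[v i]? = some a :=
  (cell i {.letter a}).congr fun x v _ => by
    rcases h : x[v i]? with _ | b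
    · simp [inputCell, h]
    · have := (List.getElem?_eq_some_iff.1 h).1
      simp [inputCell, h, this.le]

lemma eq_length (i : V) : NLPred fun (x : List α) v => v i = x.length :=
  (cell i {.rightEnd}).congr fun x v _ => by
    rw [Set.mem_singleton_iff, inputCell_rightEnd_iff]
    omega

lemma lt [Finite V] (i j : V) : NLPred fun (_ : List α) v => v i < v j := by
  refine (ex (P := fun _ v a => v i + a + 1 = v j) (add_succ_eq (some i) none (some j))).congr
    fun x v hv => ⟨fun ⟨a, _, h⟩ => by omega, fun h => ⟨v j - v i - 1, ?_, by omega⟩⟩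
  have := hv j
  omega

lemma getElem_ne [Finite V] (i : V) (a : α) : NLPred fun x v => x[v i]? ≠ some a := by
  refine ((cell i {.letter a}ᶜ).or (ex (P := fun x v b => b = x.length ∧ b < v i)
    ((eq_length none).and (lt none (some i))))).congr fun x v _ => ?_
  rcases h : x[v i]? with _ | b
  · have h1 : x.length ≤ v i := by simpa using h
    have h2 := length_lt_bound x
    simp only [inputCell, h]
    rcases h1.eq_or_lt with h1 | h1
    · simp [h1]
    · exact iff_of_true (.inr ⟨x.length, by omega, rfl, h1⟩) (by simp)
  · have := (List.getElem?_eq_some_iff.1 h).1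
    simp [inputCell, h, this.le]

/-! ### Reachability for numbers and pairs -/

lemma reflTransGen_invariant_iff {β : Type*} {r : β → β → Prop} {p : β → Prop}
    (h : ∀ a b, p a → r a b → p b) {a b : β} (ha : p a) :
    ReflTransGen (fun a b => p b ∧ r a b) a b ↔ ReflTransGen r a b := by
  constructor
  · intro h
    induction h with
    | refl => exact .refl
    | tail _ h ih => exact ih.tail h.2
  · intro hr
    suffices ReflTransGen (fun a b => p b ∧ r a b) a b ∧ p b from this.1
    induction hr with
    | refl => exact ⟨.refl, ha⟩
    | tail _ hs ih => exact ⟨ih.1.tail ⟨h _ _ ih.2 hs, hs⟩, h _ _ ih.2 hs⟩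

lemma reflTransGen_equiv_iff {β γ : Type*} (e : β ≃ γ) {r : γ → γ → Prop} {a b : β} :
    ReflTransGen (fun a b => r (e a) (e b)) a b ↔ ReflTransGen r (e a) (e b) := by
  constructor
  · exact fun h => h.lift e fun _ _ h => h
  · intro h
    have := h.lift (p := fun a b => r (e a) (e b)) e.symm fun _ _ h => by
      simpa [Function.onFun] using h
    simpa [Function.onFun] using this

/-- Reachability for tuples, where the steps preserve the bound. -/
lemma reachTuple {U : Type} [Finite U] {P : List α → (V → ℕ) → (U → ℕ) → (U → ℕ) → Prop}
    (hP : NLPred fun x (v : V ⊕ (U ⊕ U) → ℕ) =>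
      P x (fun i => v (.inl i)) (fun i => v (.inr (.inl i))) (fun i => v (.inr (.inr i))))
    (hb : ∀ x v s s', (∀ i, s i < bound x) → P x v s s' → ∀ i, s' i < bound x) (f g : U → V) :
    NLPred fun x (v : V → ℕ) =>
      ReflTransGen (P x v) (fun i => v (f i)) (fun i => v (g i)) :=
  (reach hP f g).congr fun x v hv =>
    reflTransGen_invariant_iff (p := fun s : U → ℕ => ∀ i, s i < bound x) (hb x v) fun _ => hv _

/-- Reachability for numbers. -/
lemma reachNat {P : List α → (V → ℕ) → ℕ → ℕ → Prop}
    (hP : NLPred fun x (v : V ⊕ (Unit ⊕ Unit) → ℕ) =>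
      P x (fun i => v (.inl i)) (v (.inr (.inl ()))) (v (.inr (.inr ()))))
    (hb : ∀ x v a b, a < bound x → P x v a b → b < bound x) (i j : V) :
    NLPred fun x (v : V → ℕ) => ReflTransGen (P x v) (v i) (v j) :=
  (reachTuple (U := Unit) (P := fun x v s s' => P x v (s ()) (s' ())) hP
    (fun x v _ _ hs h _ => hb x v _ _ (hs ()) h) (fun _ => i) (fun _ => j)).congr fun x v _ =>
      reflTransGen_equiv_iff (Equiv.funUnique Unit ℕ) (r := P x v)

/-- Reachability for pairs; the components have the indices `false` and `true`. -/
lemma reachPair {P : List α → (V → ℕ) → ℕ × ℕ → ℕ × ℕ → Prop}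
    (hP : NLPred fun x (v : V ⊕ (Bool ⊕ Bool) → ℕ) =>
      P x (fun i => v (.inl i)) (v (.inr (.inl false)), v (.inr (.inl true)))
        (v (.inr (.inr false)), v (.inr (.inr true))))
    (hb : ∀ x v s s', s.1 < bound x → s.2 < bound x → P x v s s' →
      s'.1 < bound x ∧ s'.2 < bound x) (i i' j j' : V) :
    NLPred fun x (v : V → ℕ) => ReflTransGen (P x v) (v i, v i') (v j, v j') :=
  (reachTuple (U := Bool)
    (P := fun x v s s' => P x v (s false, s true) (s' false, s' true)) hP
    (fun x v s s' hs h => by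
      have := hb x v _ _ (hs false) (hs true) h
      rintro (_ | _)
      exacts [this.1, this.2])
    (fun b => if b then i' else i) (fun b => if b then j' else j)).congr fun x v _ =>
      reflTransGen_equiv_iff (Equiv.boolArrowEquivProd ℕ) (r := P x v)

end NLPred

end OffLine

namespace StackUp

open Relation OffLine

/-! ### Deciding properties of positions -/

section Decide

variable {V : Type}

lemma getElem_lt_bound {w : List Letter} {u : ℕ} {d : Letter} (h : w[u]? = some d) :
    u + 1 < bound w :=
  lt_of_le_of_lt (Nat.succ_le_succ (List.getElem?_eq_some_iff.1 h).1.le) (length_lt_bound w)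

lemma digit_lt_bound {w : List Letter} {u : ℕ} (h : w[u]? = some .zero ∨ w[u]? = some .one) :
    u + 1 < bound w :=
  h.elim getElem_lt_bound getElem_lt_bound

lemma SameStep.lt_bound {w : List Letter} {s s' : ℕ × ℕ} (h : SameStep w s s') :
    s'.1 < bound w ∧ s'.2 < bound w := by
  obtain ⟨h | h, h1, h2⟩ := h <;> rw [← h1, ← h2] <;>
    exact ⟨getElem_lt_bound h.1, getElem_lt_bound h.2⟩

lemma nlPred_sameWalk (i i' j j' : V) :
    NLPred fun x v => ReflTransGen (SameStep x) (v i, v i') (v j, v j') := by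
  refine NLPred.reachPair (P := fun x _ s s' => SameStep x s s') ?_
    (fun _ _ _ _ _ _ h => h.lt_bound) i i' j j'
  exact (((NLPred.getElem_eq _ _).and (NLPred.getElem_eq _ _)).or
    ((NLPred.getElem_eq _ _).and (NLPred.getElem_eq _ _))).and
      ((NLPred.succ_eq _ _).and (NLPred.succ_eq _ _))

variable [Finite V]

lemma nlPred_dig_eq_nil (i : V) : NLPred fun x v => dig x (v i) = [] :=
  ((NLPred.getElem_ne i .zero).and (NLPred.getElem_ne i .one)).congr fun _ _ _ =>
    dig_eq_nil_iff.symm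

lemma nlPred_isNum (i j : V) : NLPred fun x v => IsNum x (v i) (v j) := by
  refine (NLPred.ex (P := fun x v c => ReflTransGen (WalkStep x) (v i) c ∧ x[c]? = some .one ∧
    c + 1 = v j ∧ dig x (v j) = []) ?_).congr fun x v hv => ?_
  · refine .and (NLPred.reachNat (P := fun x _ u u' => WalkStep x u u') ?_ ?_ (some i) none)
      ((NLPred.getElem_eq _ _).and ((NLPred.succ_eq none (some j)).and
        (nlPred_dig_eq_nil (some j))))
    · exact ((NLPred.getElem_eq _ _).or (NLPred.getElem_eq _ _)).and (NLPred.succ_eq _ _)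
    · rintro x v a b - ⟨h, rfl⟩
      exact digit_lt_bound h
  · rw [isNum_iff]
    constructor
    · rintro ⟨c, -, h⟩
      exact ⟨c, h⟩
    · rintro ⟨c, h1, h2, h⟩
      exact ⟨c, (Nat.lt_succ_self c).trans (getElem_lt_bound h2), h1, h2, h⟩

lemma Item.lt_bound {w : List Letter} {u u' : ℕ} (h : Item w u u') : u' < bound w := by
  obtain ⟨t, ht⟩ := item_iff.1 h
  have := ht.le_length
  have := length_lt_bound w
  omega

lemma nlPred_item (i j : V) : NLPred fun x v => Item x (v i) (v j) := by
  refine (NLPred.ex (P := fun x v c => v i + 1 = c ∧ x[v i]? = some .comma ∧ IsNum x c (v j))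
    ((NLPred.succ_eq (some i) none).and ((NLPred.getElem_eq (some i) _).and
      (nlPred_isNum none (some j))))).congr fun x v _ => ?_
  constructor
  · rintro ⟨_, _, rfl, h⟩
    exact h
  · intro h
    exact ⟨_, getElem_lt_bound h.1, rfl, h⟩

lemma nlPred_items (i j : V) : NLPred fun x v => ReflTransGen (Item x) (v i) (v j) :=
  NLPred.reachNat (P := fun x _ u u' => Item x u u') (nlPred_item _ _)
    (fun _ _ _ _ _ h => h.lt_bound) i j

lemma sameWalk_lt_bound {w : List Letter} {s s' : ℕ × ℕ} (h : ReflTransGen (SameStep w) s s')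
    (h1 : s.1 < bound w) (h2 : s.2 < bound w) : s'.1 < bound w ∧ s'.2 < bound w := by
  induction h with
  | refl => exact ⟨h1, h2⟩
  | tail _ h _ => exact h.lt_bound

lemma nlPred_dig_eq (i j : V) : NLPred fun x v => dig x (v i) = dig x (v j) := by
  refine (NLPred.ex (P := fun x v e => ∃ e' < bound x,
    ReflTransGen (SameStep x) (v i, v j) (e, e') ∧ dig x e = [] ∧ dig x e' = [])
    (NLPred.ex ((nlPred_sameWalk (some (some i)) (some (some j)) (some none) none).and
      ((nlPred_dig_eq_nil (some none)).and (nlPred_dig_eq_nil none))))).congr fun x v hv => ?_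
  rw [dig_eq_iff]
  constructor
  · rintro ⟨e, -, e', -, h⟩
    exact ⟨e, e', h⟩
  · rintro ⟨e, e', h, h'⟩
    have := sameWalk_lt_bound h (hv i) (hv j)
    exact ⟨e, this.1, e', this.2, h, h'⟩

lemma nlPred_split (d : Letter) (i j : V) : NLPred fun x v => Split x d (v i) (v j) :=
  ((NLPred.getElem_eq _ _).and (NLPred.getElem_ne _ _)).or
    ((NLPred.getElem_eq _ _).and (NLPred.getElem_ne _ _))

lemma nlPred_dig_ne (i j : V) : NLPred fun x v => dig x (v i) ≠ dig x (v j) := by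
  refine (NLPred.ex (P := fun x v e => ∃ e' < bound x,
    ReflTransGen (SameStep x) (v i, v j) (e, e') ∧ (Split x .zero e e' ∨ Split x .one e e'))
    (NLPred.ex ((nlPred_sameWalk (some (some i)) (some (some j)) (some none) none).and
      ((nlPred_split _ (some none) none).or (nlPred_split _ (some none) none))))).congr
      fun x v hv => ?_
  rw [dig_ne_iff]
  constructor
  · rintro ⟨e, -, e', -, h⟩
    exact ⟨e, e', h⟩
  · rintro ⟨e, e', h, h'⟩
    have := sameWalk_lt_bound h (hv i) (hv j)
    exact ⟨e, this.1, e', this.2, h, h'⟩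

lemma LeStep.lt_bound {w : List Letter} {s s' : ℕ × ℕ} (h : LeStep w s s') (h1 : s.1 < bound w) :
    s'.1 < bound w ∧ s'.2 < bound w :=
  ⟨h.fst_le.trans_lt h1, by
    rw [← h.2]
    exact digit_lt_bound (h.1.imp And.left And.left)⟩

lemma nlPred_le_digVal (i j : V) : NLPred fun x v => v i ≤ digVal (dig x (v j)) := by
  refine (NLPred.ex (P := fun x v z => ∃ e < bound x, z = 0 ∧
    ReflTransGen (LeStep x) (v i, v j) (z, e) ∧ dig x e = []) (NLPred.ex
      ((NLPred.eq_zero (some none)).and (.and (NLPred.reachPair (P := fun x _ s s' => LeStep x s s')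
        ?_ (fun x v s s' h1 _ h => h.lt_bound h1) (some (some i)) (some (some j)) (some none) none)
        (nlPred_dig_eq_nil none))))).congr fun x v hv => ?_
  · refine .and (.or ((NLPred.getElem_eq _ _).and ((NLPred.add_eq _ _ _).or ?_))
      ((NLPred.getElem_eq _ _).and ((NLPred.add_succ_eq _ _ _).or (NLPred.add_eq _ _ _))))
        (NLPred.succ_eq _ _)
    refine (NLPred.ex (P := fun x v d => d + 1 = v (.inr (.inr false)) ∧
      v (.inr (.inr false)) + d = v (.inr (.inl false)))
      ((NLPred.succ_eq none (some _)).and (NLPred.add_eq (some _) none (some _)))).congr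
      fun x v hv => ⟨fun ⟨d, _, h⟩ => ⟨d, h⟩, fun ⟨d, h⟩ => ⟨d, ?_, h⟩⟩
    have := hv (.inr (.inr false))
    omega
  · rw [le_digVal_iff]
    constructor
    · rintro ⟨_, -, e, -, rfl, h⟩
      exact ⟨e, h⟩
    · rintro ⟨e, h, h'⟩
      have key : ∀ s, ReflTransGen (LeStep x) (v i, v j) s → s.1 < bound x ∧ s.2 < bound x := by
        intro s hs
        induction hs with
        | refl => exact ⟨hv i, hv j⟩
        | tail _ hs ih => exact hs.lt_bound ih.1
      exact ⟨0, (key _ h).1, e, (key _ h).2, rfl, h, h'⟩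

lemma nlPred_notMem (i j l : V) : NLPred fun x v => NotMem x (v i) (v j) (v l) := by
  refine NLPred.reachNat (P := fun x v u u' => Item x u u' ∧ dig x (u + 1) ≠ dig x (v i)) ?_
    (fun _ _ _ _ _ h => h.1.lt_bound) j l
  refine (NLPred.ex (P := fun x v a => v (.inr (.inl ())) + 1 = a ∧
    Item x (v (.inr (.inl ()))) (v (.inr (.inr ()))) ∧ dig x a ≠ dig x (v (.inl i)))
    ((NLPred.succ_eq (some _) none).and ((nlPred_item (some _) (some _)).and
      (nlPred_dig_ne none (some _))))).congr fun x v _ => ?_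
  constructor
  · rintro ⟨_, _, rfl, h⟩
    exact h
  · intro h
    exact ⟨_, getElem_lt_bound h.1.1, rfl, h⟩

lemma nlPred_mem (i j l : V) : NLPred fun x v => Mem x (v i) (v j) (v l) := by
  refine (NLPred.ex (P := fun x v u => ∃ u' < bound x, ∃ a < bound x, u + 1 = a ∧
    ReflTransGen (Item x) (v j) u ∧ Item x u u' ∧ dig x a = dig x (v i) ∧
    ReflTransGen (Item x) u' (v l)) (NLPred.ex (NLPred.ex
      ((NLPred.succ_eq (some (some none)) none).and
      ((nlPred_items (some (some (some j))) (some (some none))).and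
      ((nlPred_item (some (some none)) (some none)).and
      ((nlPred_dig_eq none (some (some (some i)))).and
      (nlPred_items (some none) (some (some (some l))))))))))).congr fun x v _ => ?_
  constructor
  · rintro ⟨u, -, u', -, _, -, rfl, h⟩
    exact ⟨u, u', h⟩
  · rintro ⟨u, u', h⟩
    have h1 := getElem_lt_bound h.2.1.1
    exact ⟨u, (Nat.lt_succ_self u).trans h1, u', h.2.1.lt_bound, _, h1, rfl, h⟩

end Decide

end StackUp

namespace StackUp

open Relation OffLine

/-! ### Runs of the procedure in terms of positions -/

section Runs

variable {k : ℕ} {w : List Letter} {b : Fin (k + 1) → ℕ} {p : ℕ+} {Q : Sequences k}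

/-- The position of the first bin of each sequence in the layout `b`. -/
def begins (b : Fin (k + 1) → ℕ) (j : Fin k) : ℕ := b j.castSucc + 1

/-- For each bin there is another bin for the same pallet: earlier or later in its own sequence, or
in another sequence. Here `e j` and `b j.succ` are the positions between which the sequence `q_j` is
written. -/
def TwoBins (w : List Letter) (b : Fin (k + 1) → ℕ) (e : Fin k → ℕ) : Prop :=
  ∀ j, ReflTransGen (fun u u' => Item w u u' ∧ (Mem w (u + 1) (e j) u ∨
    Mem w (u + 1) u' (b j.succ) ∨
    ∃ j', j' ≠ j ∧ Mem w (u + 1) (e j') (b j'.succ))) (e j) (b j.succ)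

/-- One step of the procedure. The entry `some j` of a state is the position in the word of the next
bin of the sequence `q_j`, and the entry `none` is the counter for the open pallets. -/
def PosStep (w : List Letter) (b : Fin (k + 1) → ℕ) (e : Fin k → ℕ) (s s' : Option (Fin k) → ℕ) :
    Prop :=
  ∃ i, Item w (s (some i)) (s' (some i)) ∧ (∀ j, j = i ∨ s (some j) = s' (some j)) ∧
    ∃ c < bound w, s (some i) + 1 = c ∧ ∃ o < bound w, o ≤ digVal (dig w 0) ∧
      (((∀ j, NotMem w c (e j) (s (some j))) ∧ s none + 1 = o) ∨
        ((∃ j, Mem w c (e j) (s (some j))) ∧ s none = o)) ∧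
      (((∀ j, NotMem w c (s' (some j)) (b j.succ)) ∧ o - 1 = s' none) ∨
        ((∃ j, Mem w c (s' (some j)) (b j.succ)) ∧ o = s' none))

lemma PosStep.lt_bound {e : Fin k → ℕ} {s s' : Option (Fin k) → ℕ} (h : PosStep w b e s s')
    (hs : ∀ i, s i < bound w) (i : Option (Fin k)) : s' i < bound w := by
  obtain ⟨i₀, h1, h2, _, _, _, o, ho, _, _, h3⟩ := h
  rcases i with _ | i
  · rcases h3 with ⟨-, h3⟩ | ⟨-, h3⟩ <;> omega
  · rcases h2 i with rfl | h2
    · exact h1.lt_bound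
    · exact h2 ▸ hs _

lemma Layout.ne_comma (h : Layout w b p Q) (j : Fin (k + 1)) : w[b j]? ≠ some .comma := by
  induction j using Fin.lastCases with
  | last => simp [h.last]
  | cast i => simp [h.semicolon i]

lemma Layout.le_length (h : Layout w b p Q) (j : Fin (k + 1)) : b j ≤ w.length := by
  induction j using Fin.lastCases with
  | last => exact h.last.le
  | cast i => exact (List.getElem?_eq_some_iff.1 (h.semicolon i)).1.le

lemma Layout.begins_le_length (h : Layout w b p Q) (j : Fin k) : begins b j ≤ w.length :=
  (List.getElem?_eq_some_iff.1 (h.semicolon j)).1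

lemma Reads.add_length_le {u u' : ℕ} {l : List ℕ+} (h : Reads w u l u') : u + l.length ≤ u' := by
  induction l generalizing u with
  | nil => exact Eq.le h
  | cons t l ih =>
    obtain ⟨m, h1, h2⟩ := h
    have := ih h2
    have := h1.lt
    rw [List.length_cons]
    omega

lemma Layout.numBins_le (h : Layout w b p Q) : numBins Q ≤ w.length := by
  have key : ∀ (n : ℕ) (a : Fin (n + 1) → ℕ) (f : Fin n → ℕ),
      (∀ i, a i.castSucc + f i ≤ a i.succ) → a 0 + ∑ i, f i ≤ a (Fin.last n) := by
    intro n
    induction n with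
    | zero => intro a f _; simp
    | succ n ih =>
      intro a f ha
      rw [Fin.sum_univ_castSucc]
      have h1 : a 0 + _ ≤ a (Fin.last n).castSucc :=
        ih (fun i => a i.castSucc) (fun i => f i.castSucc) fun i => ha i.castSucc
      have h2 : _ ≤ a (Fin.last (n + 1)) := ha (Fin.last n)
      omega
  have := key k b (fun i => (Q i).length) fun i => by
    have := (h.reads i).add_length_le
    omega
  rw [h.last] at this
  rw [numBins]
  omega

lemma Layout.twoBins_iff (h : Layout w b p Q) :
    TwoBins w b (begins b) ↔ ∀ t ∈ plts Q, 2 ≤ ∑ i, (Q i).count t := by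
  have hmem : ∀ {u : ℕ} {t : ℕ+}, dig w u = binary t → ∀ j,
      (Mem w u (begins b j) (b j.succ) ↔ t ∈ Q j) := fun hu j => mem_iff hu (h.reads j)
  constructor
  · intro H t ht
    obtain ⟨j, hj⟩ := mem_plts.1 ht
    obtain ⟨l₁, l₂, hQ⟩ := List.append_of_mem hj
    have hr := h.reads j
    obtain ⟨m, m', h1, h2, h3⟩ := reads_middle.1 (hQ ▸ hr)
    have hd := h2.2.1
    have hsum := Finset.sum_erase_add Finset.univ (fun i => (Q i).count t) (Finset.mem_univ j)
    have hcj : (Q j).count t = l₁.count t + l₂.count t + 1 := by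
      rw [hQ, List.count_append, List.count_cons_self, add_assoc]
    rcases (hr.reflTransGen_iff.1 (H j)) l₁ t l₂ m m' hQ h1 h2 h3 with H | H | ⟨j', hne, H⟩
    · have := List.count_pos_iff.2 ((mem_iff hd h1).1 H)
      omega
    · have := List.count_pos_iff.2 ((mem_iff hd h3).1 H)
      omega
    · have h4 := List.count_pos_iff.2 ((hmem hd j').1 H)
      have h5 := Finset.single_le_sum (f := fun i => (Q i).count t) (s := Finset.univ.erase j)
        (fun _ _ => Nat.zero_le _) (Finset.mem_erase.2 ⟨hne, Finset.mem_univ j'⟩)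
      omega
  · intro H j
    refine (h.reads j).reflTransGen_iff.2 fun l₁ t l₂ m m' hQ h1 h2 h3 => ?_
    have hd := h2.2.1
    by_contra hcon
    simp only [not_or, not_exists, not_and] at hcon
    obtain ⟨k1, k2, k3⟩ := hcon
    rw [show b j.castSucc + 1 = begins b j from rfl] at h1
    rw [mem_iff hd h1] at k1
    rw [mem_iff hd h3] at k2
    have hcount : ∀ i, (Q i).count t = if i = j then 1 else 0 := by
      intro i
      split_ifs with hi
      · rw [hi, hQ, List.count_append, List.count_cons_self, List.count_eq_zero_of_not_mem k1,
          List.count_eq_zero_of_not_mem k2]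
      · exact List.count_eq_zero_of_not_mem ((hmem hd i).not.1 (k3 i hi))
    have := H t (mem_plts.2 ⟨j, by simp [hQ]⟩)
    simp [hcount] at this

/-- The positions in `s` belong to the counter values `c`. -/
def Link (w : List Letter) (b : Fin (k + 1) → ℕ) (Q : Sequences k) (c : Counters k)
    (s : Option (Fin k) → ℕ) : Prop :=
  s none = c.opn ∧ ∀ j, Reads w (begins b j) (front Q c.pos j) (s (some j))

lemma Layout.reads_remaining (h : Layout w b p Q) {pos : Fin k → ℕ} {s : Option (Fin k) → ℕ}
    (hs : ∀ j, Reads w (begins b j) (front Q pos j) (s (some j))) (j : Fin k) :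
    Reads w (s (some j)) (remaining Q pos j) (b j.succ) := by
  have h1 := h.reads j
  rw [← List.take_append_drop (pos j) (Q j), reads_append] at h1
  obtain ⟨m, h1, h2⟩ := h1
  rwa [(hs j).right_unique h1]

lemma front_update (pos : Fin k → ℕ) (i j : Fin k) {t : ℕ+} (ht : (Q i)[pos i]? = some t) :
    front Q (Function.update pos i (pos i + 1)) j =
      if j = i then front Q pos j ++ [t] else front Q pos j := by
  split_ifs with hj
  · subst hj
    simp [front, List.take_add_one, ht]
  · simp [front, hj]

/-- The conditions in `PosStep` describe the step of the procedure that removes the bin for `t`. -/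
lemma Layout.conditions_iff (h : Layout w b p Q) {c c' : Counters k} {s s' : Option (Fin k) → ℕ}
    {t : ℕ+} {u o : ℕ} (hu : dig w u = binary t) (hs : Link w b Q c s)
    (hs' : ∀ j, Reads w (begins b j) (front Q c'.pos j) (s' (some j))) :
    ((((∀ j, NotMem w u (begins b j) (s (some j))) ∧ s none + 1 = o) ∨
        ((∃ j, Mem w u (begins b j) (s (some j))) ∧ s none = o)) ↔ o = c.opened Q t) ∧
      ((((∀ j, NotMem w u (s' (some j)) (b j.succ)) ∧ o - 1 = s' none) ∨
        ((∃ j, Mem w u (s' (some j)) (b j.succ)) ∧ o = s' none)) ↔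
          s' none = if ∀ j, t ∉ (Q j).drop (c'.pos j) then o - 1 else o) := by
  have h1 : ∀ j, (NotMem w u (begins b j) (s (some j)) ↔ t ∉ (Q j).take (c.pos j)) :=
    fun j => notMem_iff hu (hs.2 j)
  have h2 : ∀ j, (Mem w u (begins b j) (s (some j)) ↔ t ∈ (Q j).take (c.pos j)) :=
    fun j => mem_iff hu (hs.2 j)
  have h3 : ∀ j, (NotMem w u (s' (some j)) (b j.succ) ↔ t ∉ (Q j).drop (c'.pos j)) :=
    fun j => notMem_iff hu (h.reads_remaining hs' j)
  have h4 : ∀ j, (Mem w u (s' (some j)) (b j.succ) ↔ t ∈ (Q j).drop (c'.pos j)) :=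
    fun j => mem_iff hu (h.reads_remaining hs' j)
  simp only [h1, h2, h3, h4, Counters.opened, hs.1]
  constructor
  · split_ifs with hf
    · have : ¬ ∃ j, t ∈ (Q j).take (c.pos j) := by simpa using hf
      rw [or_iff_left fun h => this h.1, and_iff_right hf, eq_comm]
    · have : ∃ j, t ∈ (Q j).take (c.pos j) := by simpa using hf
      rw [or_iff_right fun h => hf h.1, and_iff_right this, eq_comm]
  · split_ifs with hf
    · have : ¬ ∃ j, t ∈ (Q j).drop (c'.pos j) := by simpa using hf
      rw [or_iff_left fun h => this h.1, and_iff_right hf, eq_comm]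
    · have : ∃ j, t ∈ (Q j).drop (c'.pos j) := by simpa using hf
      rw [or_iff_right fun h => hf h.1, and_iff_right this, eq_comm]

lemma opened_le_numBins {c : Counters k} (hc : c.Correct Q) {i : Fin k} {t : ℕ+}
    (h : (Q i)[c.pos i]? = some t) : c.opened Q t ≤ numBins Q := by
  rw [opened_eq hc.1 hc.2 h]
  have h1 : insert t (openPallets Q (remaining Q c.pos)) ⊆ plts Q := by
    intro u hu
    rcases Finset.mem_insert.1 hu with rfl | hu
    · exact mem_plts.2 ⟨i, List.mem_of_getElem? h⟩
    · obtain ⟨j, hj⟩ := mem_plts.1 (Finset.mem_inter.1 hu).1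
      exact mem_plts.2 ⟨j, List.mem_of_mem_drop hj⟩
  refine (Finset.card_le_card h1).trans (Finset.card_biUnion_le.trans ?_)
  exact Finset.sum_le_sum fun i _ => (Q i).toFinset_card_le

lemma Link.exists_posStep (h : Layout w b p Q) {c c' : Counters k} {s : Option (Fin k) → ℕ}
    (hs : Link w b Q c s) (hc : c.Correct Q) (hstep : Counters.Step Q p c c') :
    ∃ s', PosStep w b (begins b) s s' ∧ Link w b Q c' s' := by
  obtain ⟨i, t, ht, hpos, hle, hopn⟩ := hstep
  have h1 := h.reads_remaining hs.2 i
  rw [remaining, drop_eq_cons ht] at h1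
  obtain ⟨m, h1, -⟩ := h1
  let s' : Option (Fin k) → ℕ := fun o => o.elim c'.opn fun j => if j = i then m else s (some j)
  have hs' : ∀ j, Reads w (begins b j) (front Q c'.pos j) (s' (some j)) := by
    intro j
    rw [hpos, front_update c.pos i j ht]
    simp only [s', Option.elim]
    split_ifs with hj
    · subst hj
      exact reads_append.2 ⟨_, hs.2 j, m, h1, rfl⟩
    · exact hs.2 j
  have hB := length_lt_bound w
  have hd : dig w (s (some i) + 1) = binary t := h1.2.1
  obtain ⟨k1, k2⟩ := h.conditions_iff (o := c.opened Q t) hd hs hs'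
  refine ⟨s', ⟨i, ?_, fun j => ?_, _, getElem_lt_bound h1.1, rfl, c.opened Q t, ?_, ?_, k1.2 rfl,
    k2.2 ?_⟩, rfl, hs'⟩
  · simpa [s'] using item_iff.2 ⟨t, h1⟩
  · by_cases hj : j = i
    · exact .inl hj
    · exact .inr (by simp [s', hj])
  · have := opened_le_numBins hc ht
    have := h.numBins_le
    omega
  · rwa [h.dig_zero, digVal_binary]
  · simp only [s', Option.elim, hopn]

lemma Link.exists_step (h : Layout w b p Q) {c : Counters k} {s s' : Option (Fin k) → ℕ}
    (hs : Link w b Q c s) (hstep : PosStep w b (begins b) s s') :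
    ∃ c', Counters.Step Q p c c' ∧ Link w b Q c' s' := by
  obtain ⟨i, h1, h2, _, -, rfl, o, -, h3, h4, h5⟩ := hstep
  have hr := h.reads_remaining hs.2 i
  obtain ⟨t, h1⟩ := item_iff.1 h1
  have ht : (Q i)[c.pos i]? = some t := by
    rcases hq : remaining Q c.pos i with _ | ⟨t', l⟩
    · rw [hq] at hr
      exact absurd h1.1 ((hr : s (some i) = b i.succ) ▸ h.ne_comma i.succ)
    · rw [hq] at hr
      obtain ⟨m, h6, -⟩ := hr
      obtain ⟨rfl, -⟩ := h1.unique h6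
      have := congrArg (·[0]?) hq
      simpa [remaining] using this
  let c' : Counters k := ⟨Function.update c.pos i (c.pos i + 1), s' none⟩
  have hs' : ∀ j, Reads w (begins b j) (front Q c'.pos j) (s' (some j)) := by
    intro j
    simp only [c']
    rw [front_update c.pos i j ht]
    split_ifs with hj
    · subst hj
      exact reads_append.2 ⟨_, hs.2 j, _, h1, rfl⟩
    · rcases h2 j with h2 | h2
      · exact absurd h2 hj
      · exact h2 ▸ hs.2 j
  obtain ⟨k1, k2⟩ := h.conditions_iff (o := o) (c' := c') h1.2.1 hs hs'
  obtain rfl := k1.1 h4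
  refine ⟨c', ⟨i, t, ht, rfl, ?_, ?_⟩, rfl, hs'⟩
  · rwa [h.dig_zero, digVal_binary] at h3
  · refine (k2.1 h5).trans ?_
    congr

/-- The state in which all bins remain. -/
def initialState (e : Fin k → ℕ) : Option (Fin k) → ℕ := fun o => o.elim 0 e

lemma Link.initial : Link w b Q (Counters.zero k) (initialState (begins b)) :=
  ⟨rfl, fun _ => rfl⟩

lemma Layout.exists_run_iff (h : Layout w b p Q) :
    (∃ c : Counters k, c.Reachable Q p ∧ ∀ i, c.pos i = (Q i).length) ↔
      ∃ s : Option (Fin k) → ℕ, (∀ i, s i < bound w) ∧ (∀ i, s (some i) = b i.succ) ∧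
        ReflTransGen (PosStep w b (begins b)) (initialState (begins b)) s := by
  constructor
  · rintro ⟨c, hc, hpos⟩
    have key : ∃ s, ReflTransGen (PosStep w b (begins b)) (initialState (begins b)) s ∧
        Link w b Q c s := by
      clear hpos
      induction hc with
      | refl => exact ⟨_, .refl, .initial⟩
      | tail hc hs ih =>
        obtain ⟨s, h1, h2⟩ := ih
        obtain ⟨s', h3, h4⟩ := h2.exists_posStep h (.of_reachable hc) hs
        exact ⟨s', h1.tail h3, h4⟩
    obtain ⟨s, h1, h2⟩ := key
    have h3 : ∀ i, s (some i) = b i.succ := by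
      intro i
      have h3 := h2.2 i
      rw [front, hpos i, List.take_length] at h3
      exact h3.right_unique (h.reads i)
    refine ⟨s, ?_, h3, h1⟩
    have hB := length_lt_bound w
    rintro (_ | i)
    · have := (Counters.Correct.of_reachable hc).opn_le
      have := h.numBins_le
      rw [h2.1]
      omega
    · have := h.le_length i.succ
      rw [h3]
      omega
  · rintro ⟨s, -, hs, hr⟩
    have key : ∃ c : Counters k, c.Reachable Q p ∧ Link w b Q c s := by
      clear hs
      induction hr with
      | refl => exact ⟨_, .refl, .initial⟩
      | tail _ hs ih =>
        obtain ⟨c, h1, h2⟩ := ih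
        obtain ⟨c', h3, h4⟩ := h2.exists_step h hs
        exact ⟨c', h1.tail h3, h4⟩
    obtain ⟨c, hc, h1⟩ := key
    refine ⟨c, hc, fun i => le_antisymm ((Counters.Correct.of_reachable hc).1 i) ?_⟩
    have h2 := h1.2 i
    rw [hs] at h2
    have h3 := h2.unique (h.reads i)
    rw [front] at h3
    exact List.take_eq_self_iff _ |>.1 h3

end Runs

/-! ### The language -/

section Language

variable {k : ℕ}

/-- Membership in `fifoStackUp k` in terms of positions: `s none = 0`, and `s (some j)` is the
position of the first bin of the sequence `q_j`. -/
def Solvable (w : List Letter) (b : Fin (k + 1) → ℕ) (s : Option (Fin k) → ℕ) : Prop :=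
  s none = 0 ∧ IsNum w (s none) (b 0) ∧
    (∀ i : Fin k, w[b i.castSucc]? = some .semicolon ∧ b i.castSucc + 1 = s (some i) ∧
      ReflTransGen (Item w) (s (some i)) (b i.succ)) ∧
    b (Fin.last k) = w.length ∧ TwoBins w b (fun i => s (some i)) ∧
    ∃ s' : Option (Fin k) → ℕ, (∀ i, s' i < bound w) ∧ (∀ i, s' (some i) = b i.succ) ∧
      ReflTransGen (PosStep w b fun i => s (some i)) s s'

lemma mem_fifoStackUp_iff {w : List Letter} : w ∈ fifoStackUp k ↔
    ∃ b : Fin (k + 1) → ℕ, (∀ i, b i < bound w) ∧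
      ∃ s : Option (Fin k) → ℕ, (∀ i, s i < bound w) ∧ Solvable w b s := by
  have hB := length_lt_bound w
  constructor
  · rintro ⟨I, hI, hproc⟩
    obtain ⟨b, h⟩ := exists_layout I.places I.seqs
    have hI' : encodeWord I.places I.seqs = w := hI
    rw [hI'] at h
    refine ⟨b, fun i => ?_, initialState (begins b), ?_, rfl, ?_, fun i => ⟨h.semicolon i, rfl, ?_⟩,
      h.last, h.twoBins_iff.2 I.two_bins, h.exists_run_iff.1 ((processable_iff I.two_bins).1 hproc)⟩
    · have := h.le_length i
      omega
    · rintro (_ | i)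
      · exact Nat.pos_of_ne_zero (by rw [bound]; positivity)
      · exact (h.begins_le_length i).trans_lt (by omega)
    · exact ⟨I.places, h.dig_zero, by rw [h.first]; exact (zero_add _).symm⟩
    · exact reflTransGen_item_iff.2 ⟨_, h.reads i⟩
  · rintro ⟨b, -, s, -, h0, ⟨p, hp, hb0⟩, hseq, hlast, htwo, hrun⟩
    rw [h0] at hp hb0
    rw [zero_add] at hb0
    have hbeg : (fun i => s (some i)) = begins b := funext fun i => (hseq i).2.1.symm
    have hs : s = initialState (begins b) := by
      funext i
      rcases i with _ | i
      · exact h0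
      · exact congrFun hbeg i
    have hreads : ∀ i : Fin k, ∃ q, Reads w (b i.castSucc + 1) q (b i.succ) := by
      intro i
      have := (hseq i).2.2
      rw [← (hseq i).2.1] at this
      exact reflTransGen_item_iff.1 this
    choose Q hQ using hreads
    have h : Layout w b p Q := ⟨hp, hb0, fun i => (hseq i).1, hQ, hlast⟩
    rw [hbeg] at htwo hrun
    rw [hs] at hrun
    have two_bins := h.twoBins_iff.1 htwo
    exact ⟨⟨Q, p, two_bins⟩, h.eq_encodeWord.symm,
      (processable_iff two_bins).2 (h.exists_run_iff.2 hrun)⟩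

end Language

end StackUp

namespace StackUp

open Relation OffLine

section Final

/-! ### The language is in nondeterministic logarithmic space -/

variable {k : ℕ} {V : Type} [Finite V]

lemma nlPred_twoBins (b : Fin (k + 1) → V) (e : Fin k → V) :
    NLPred fun x v => TwoBins x (fun i => v (b i)) (fun j => v (e j)) := by
  refine NLPred.forall_fin fun j => NLPred.reachNat (P := fun x v u u' => Item x u u' ∧
    (Mem x (u + 1) (v (e j)) u ∨ Mem x (u + 1) u' (v (b j.succ)) ∨
      ∃ j', j' ≠ j ∧ Mem x (u + 1) (v (e j')) (v (b j'.succ)))) ?_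
    (fun _ _ _ _ _ h => h.1.lt_bound) _ _
  refine (NLPred.ex (P := fun x v c => v (.inr (.inl ())) + 1 = c ∧
    Item x (v (.inr (.inl ()))) (v (.inr (.inr ()))) ∧
    (Mem x c (v (.inl (e j))) (v (.inr (.inl ()))) ∨
      Mem x c (v (.inr (.inr ()))) (v (.inl (b j.succ))) ∨
      ∃ j', j' ≠ j ∧ Mem x c (v (.inl (e j'))) (v (.inl (b j'.succ)))))
    ((NLPred.succ_eq (some _) none).and ((nlPred_item (some _) (some _)).and
      ((nlPred_mem none (some _) (some _)).or ((nlPred_mem none (some _) (some _)).or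
        (NLPred.exists_fin fun j' => (NLPred.const _).and
          (nlPred_mem none (some _) (some _)))))))).congr fun x v _ => ?_
  constructor
  · rintro ⟨_, _, rfl, h⟩
    exact h
  · intro h
    exact ⟨_, getElem_lt_bound h.1.1, rfl, h⟩

lemma nlPred_posStep (b : Fin (k + 1) → V) (e : Fin k → V) (s s' : Option (Fin k) → V) :
    NLPred fun x v => PosStep x (fun i => v (b i)) (fun j => v (e j)) (fun i => v (s i))
      (fun i => v (s' i)) := by
  refine NLPred.exists_fin fun i => (nlPred_item _ _).and (.and (NLPred.forall_fin fun j =>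
    (NLPred.const _).or (NLPred.eq _ _)) (NLPred.ex ((NLPred.succ_eq (some _) none).and
    (NLPred.ex (.and ?_ (.and ?_ ?_))))))
  · refine (NLPred.ex (P := fun x v z => z = 0 ∧ v none ≤ digVal (dig x z))
      ((NLPred.eq_zero none).and (nlPred_le_digVal (some none) none))).congr fun x v hv => ?_
    constructor
    · rintro ⟨_, -, rfl, h⟩
      exact h
    · exact fun h => ⟨0, (Nat.zero_le _).trans_lt (hv none), rfl, h⟩
  · exact ((NLPred.forall_fin fun j => nlPred_notMem (some none) (some (some _))
      (some (some _))).and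
      (NLPred.succ_eq (some (some (s none))) none)).or
      ((NLPred.exists_fin fun j => nlPred_mem (some none) (some (some _)) (some (some _))).and
      (NLPred.eq (some (some (s none))) none))
  · refine ((NLPred.forall_fin fun j => nlPred_notMem (some none) (some (some _))
      (some (some _))).and ?_).or
      ((NLPred.exists_fin fun j => nlPred_mem (some none) (some (some _)) (some (some _))).and
      (NLPred.eq none (some (some (s' none)))))
    refine ((NLPred.succ_eq (some (some (s' none))) none).or ((NLPred.eq_zero none).and
      (NLPred.eq_zero (some (some (s' none)))))).congr fun x v _ => ?_
    beta_reduce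
    omega

lemma nlPred_solvable (b : Fin (k + 1) → V) (s : Option (Fin k) → V) :
    NLPred fun x v => Solvable x (fun i => v (b i)) (fun i => v (s i)) := by
  refine (NLPred.eq_zero _).and ((nlPred_isNum _ _).and (.and (NLPred.forall_fin fun i =>
    (NLPred.getElem_eq _ _).and ((NLPred.succ_eq _ _).and (nlPred_items _ _)))
    ((NLPred.eq_length _).and ((nlPred_twoBins _ _).and (NLPred.exTuple (.and (NLPred.forall_fin
      fun i => NLPred.eq (Sum.inr (some i)) (Sum.inl (b i.succ))) ?_))))))
  exact NLPred.reachTuple (P := fun x v s₁ s₂ => PosStep x (fun i => v (Sum.inl (b i)))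
    (fun i => v (Sum.inl (s (some i)))) s₁ s₂)
    (nlPred_posStep (fun i => Sum.inl (Sum.inl (b i))) (fun i => Sum.inl (Sum.inl (s (some i))))
      (fun i => Sum.inr (Sum.inl i)) (fun i => Sum.inr (Sum.inr i)))
    (fun x v s₁ s₂ h h' => h'.lt_bound h) (fun i => Sum.inl (s i)) (fun i => Sum.inr i)

end Final

/-- The FIFO stack-up problem is decided in nondeterministic logarithmic space. -/
theorem fifoStackUp_mem_NL (k : ℕ) : fifoStackUp k ∈ NL Letter := by
  refine mem_NL_of_nlPred ((NLPred.exTuple (V := Empty)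
    (P := fun w _ (b : Fin (k + 1) → ℕ) => ∃ s : Option (Fin k) → ℕ, (∀ i, s i < bound w) ∧
      Solvable w b s) (NLPred.exTuple ?_)).congr fun w v _ => mem_fifoStackUp_iff.symm)
  exact nlPred_solvable (fun i => Sum.inl (Sum.inr i)) (fun i => Sum.inr i)

end StackUp

theorem mainTheorem6 (k : ℕ) :
    StackUp.fifoStackUp k ∈ OffLine.NL StackUp.Letter ∧
    ∀ I : StackUp.FifoInstance k,
      (StackUp.Processable I.seqs I.places ↔
        ∃ c : StackUp.Counters k, c.Reachable I.seqs I.places ∧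
          ∀ i, c.pos i = (I.seqs i).length) ∧
      ∀ c : StackUp.Counters k, c.Reachable I.seqs I.places →
        (∀ i, c.pos i ≤ (I.seqs i).length) ∧
        c.opn = (StackUp.openPallets I.seqs fun i => (I.seqs i).drop (c.pos i)).card ∧
        (∀ i, Nat.size (c.pos i) ≤ Nat.log 2 (StackUp.numBins I.seqs) + 1) ∧
        Nat.size c.opn ≤ Nat.log 2 (StackUp.numBins I.seqs) + 1 := by
  refine ⟨StackUp.fifoStackUp_mem_NL k, fun I => ⟨StackUp.processable_iff I.two_bins,
    fun c hc => ?_⟩⟩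
  have h := StackUp.Counters.Correct.of_reachable hc
  exact ⟨h.1, h.2, fun i => StackUp.size_le_log_add_one (h.pos_le i),
    StackUp.size_le_log_add_one h.opn_le⟩
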